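/- Let $R$ be a complete discrete valuation ring with field of fractions $K$, uniformizer $\pi$ and an absolute value $|\cdot|$ on $K$ with unit ball $R$. Let $A$ be an (associative, unital) $R$-algebra, flat as an $R$-module, with an increasing exhaustive filtration $F_0A\subseteq F_1A\subseteq\cdots$ by $R$-submodules such that $1\in F_0A$ and $F_iA\cdot F_jA\subseteq F_{i+j}A$ for all $i,j$. Assume: (1) $F_iA\cdot F_jA=F_jA\cdot F_iA$ as $R$-submodules of $A$, for all $i,j$; (2) $F_0A$ is a commutative noetherian integral domain and $F_0A/\pi F_0A$ is a regular integral domain; (3) the associated graded ring $\mathrm{gr}^F_\bullet A$ is commutative and isomorphic, as a graded ring, to a polynomial ring $F_0A[y_1,\dots,y_r]$ for some $r\ge 0$, graded by total degree. For $n\ge 0$ let $A_n\subseteq A$ be the image of the Rees ring $\bigoplus_{i\ge 0}(F_iA)X^i\subseteq A[X]$ under $X\mapsto\pi^n$, let $\hat A_n=\varprojlim_k A_n/\pi^kA_n$ be its $\pi$-adic completion, and let $\hat A_{n,K}=\hat A_n\otimes_RK$, a normed $K$-algebra with unit ball $\hat A_n$. The inclusions $A_{n+1}\subseteq A_n$ induce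 homomorphisms $\hat A_{n+1,K}\to\hat A_{n,K}$, and $\varprojlim_n\hat A_{n,K}$ carries the projective limit topology. Let $A_K=A\otimes_RK$ carry the finest locally convex (nonarchimedean) topology for which the inclusion of $(F_0A)_K=F_0A\otimes_RK$, normed with unit ball $F_0A$, is continuous. Its Arens–Michael envelope $\hat A_K$ is the Hausdorff completion of $A_K$ with respect to all continuous submultiplicative nonarchimedean seminorms. Then: (a) for every $n\ge 0$ the homomorphism $\hat A_{n+1,K}\to\hat A_{n,K}$ is flat, on the left and on the right; (b) $\varprojlim_n\hat A_{n,K}$ is a (two-sided) Fréchet–Stein algebra: it is a complete Hausdorff $K$-algebra whose topology is defined by an increasing sequence $q_0\le q_1\le\cdots$ of submultiplicative nonarchimedean seminorms such that the completion with respect to each $q_n$ is a left and right noetherian ring and the transition homomorphism from the completion with respect to $q_{n+1}$ to the completion with respect to $q_n$ is flat on both sides, for all $n$; (c) there is an isomorphism of topological $K$-algebras $\varprojlim_n\hat A_{n,K}\cong\hat A_K$ compatible with the canonical homomorphisms from $A_K$ to both sides. -/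

import Mathlib

open scoped TensorProduct Topology

universe u v w

namespace AMEnvelope

noncomputable section

/-! ### Flat homomorphisms of noncommutative rings -/

section Flat

variable {S : Type u} {T : Type v} [Ring S] [Ring T] (f : S →+* T)

/-- The relations `(t * f s) ⊗ n = t ⊗ (s • n)` that cut `T ⊗[S] N` out of `T ⊗[ℤ] N`. -/
def balancedRel (N : Type w) [AddCommGroup N] [Module S N] : AddSubgroup (T ⊗[ℤ] N) :=
  AddSubgroup.closure
    {z | ∃ (t : T) (s : S) (n : N), z = (t * f s) ⊗ₜ[ℤ] n - t ⊗ₜ[ℤ] (s • n)}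

/-- The tensor product `T ⊗[S] N` of `T`, as a right `S`-module via `f`, with a left
`S`-module `N`. -/
abbrev BaseChange (N : Type w) [AddCommGroup N] [Module S N] : Type (max v w) :=
  (T ⊗[ℤ] N) ⧸ balancedRel f N

/-- The map `T ⊗[S] N → T ⊗[S] N'` induced by an `S`-linear map `N → N'`. -/
def baseChangeMap {N N' : Type w} [AddCommGroup N] [Module S N] [AddCommGroup N'] [Module S N']
    (φ : N →ₗ[S] N') : BaseChange f N →+ BaseChange f N' :=
  QuotientAddGroup.map _ _
    (TensorProduct.map LinearMap.id φ.toAddMonoidHom.toIntLinearMap).toAddMonoidHom (by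
      refine (AddSubgroup.closure_le _).2 ?_
      rintro _ ⟨t, s, n, rfl⟩
      refine AddSubgroup.subset_closure ⟨t, s, φ n, ?_⟩
      simp)

/-- `T` is flat as a right `S`-module via `f`: the functor `T ⊗[S] -` on left `S`-modules
preserves injections. -/
def RightFlat : Prop :=
  ∀ (N N' : Type u) [AddCommGroup N] [Module S N] [AddCommGroup N'] [Module S N']
    (φ : N →ₗ[S] N'), Function.Injective φ → Function.Injective (baseChangeMap f φ)

/-- `f` is flat on both sides. Flatness of `T` as a left `S`-module is expressed through the
opposite rings. -/
def IsFlatHom : Prop := RightFlat f ∧ RightFlat (RingHom.op f)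

end Flat

/-! ### Nonarchimedean seminorms and completions -/

section Seminorms

/-- The uniform structure defined by a seminorm. -/
abbrev seminormUniformity {K : Type*} {V : Type*} [NormedField K] [AddCommGroup V] [Module K V]
    (q : Seminorm K V) : UniformSpace V :=
  q.toAddGroupSeminorm.toSeminormedAddCommGroup.toUniformSpace

/-- A submultiplicative nonarchimedean seminorm on a `K`-algebra. -/
structure AlgSeminorm (K : Type*) (V : Type*) [NormedField K] [Ring V] [Algebra K V] extends
    Seminorm K V where
  add_le_max' : ∀ x y, toFun (x + y) ≤ max (toFun x) (toFun y)
  mul_le' : ∀ x y, toFun (x * y) ≤ toFun x * toFun y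

variable {K : Type*} {V : Type*} [NormedField K] [Ring V] [Algebra K V]

/-- The algebra `V`, endowed with the uniform structure defined by a set of submultiplicative
seminorms. -/
def SeminormedAlg (_Q : Set (AlgSeminorm K V)) : Type _ := V

namespace SeminormedAlg

variable (Q : Set (AlgSeminorm K V))

instance : Ring (SeminormedAlg Q) := inferInstanceAs (Ring V)

instance : Algebra K (SeminormedAlg Q) := inferInstanceAs (Algebra K V)

instance : UniformSpace (SeminormedAlg Q) :=
  (⨅ q : Q, seminormUniformity q.1.toSeminorm : UniformSpace V)

instance : IsUniformAddGroup (SeminormedAlg Q) :=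
  isUniformAddGroup_iInf (G := V) fun q =>
    q.1.toSeminorm.toAddGroupSeminorm.toSeminormedAddCommGroup.to_isUniformAddGroup

instance : ContinuousMul (SeminormedAlg Q) := by
  have h : @ContinuousMul V (⨅ q : Q, (seminormUniformity q.1.toSeminorm).toTopologicalSpace) _ :=
    continuousMul_iInf fun q => by
      let _ : SeminormedRing V :=
        { q.1.toSeminorm.toAddGroupSeminorm.toSeminormedAddCommGroup, ‹Ring V› with
          norm_mul_le := q.1.mul_le' }
      exact (inferInstance : ContinuousMul V)
  rw [← UniformSpace.toTopologicalSpace_iInf] at h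
  exact h

instance : IsTopologicalRing (SeminormedAlg Q) where

instance : UniformContinuousConstSMul K (SeminormedAlg Q) :=
  haveI : ContinuousConstSMul K (SeminormedAlg Q) :=
    ⟨fun c => by simpa only [Algebra.smul_def] using continuous_const_mul _⟩
  uniformContinuousConstSMul_of_continuousConstSMul K _

end SeminormedAlg

/-- The Banach algebra `V_q`: the Hausdorff completion of `V` with respect to the submultiplicative
seminorm `q`. -/
abbrev SeminormCompletion (q : AlgSeminorm K V) : Type _ :=
  UniformSpace.Completion (SeminormedAlg ({q} : Set (AlgSeminorm K V)))

/-- The identity of `V`, from the `q'`-topology to the `q`-topology. -/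
def idHom (q q' : AlgSeminorm K V) :
    SeminormedAlg ({q'} : Set (AlgSeminorm K V)) →+* SeminormedAlg ({q} : Set (AlgSeminorm K V)) :=
  RingHom.id V

theorem continuous_idHom {q q' : AlgSeminorm K V} (h : q.toSeminorm ≤ q'.toSeminorm) :
    Continuous (idHom q q') := by
  have key : seminormUniformity q'.toSeminorm ≤ seminormUniformity q.toSeminorm := by
    let u' := q'.toSeminorm.toAddGroupSeminorm.toSeminormedAddCommGroup
    let u := q.toSeminorm.toAddGroupSeminorm.toSeminormedAddCommGroup
    have h1 := @LipschitzWith.of_dist_le_mul V V u'.toPseudoMetricSpace u.toPseudoMetricSpace 1 id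
        fun x y => by
          simp only [NNReal.coe_one, one_mul, id]
          rw [@dist_eq_norm V u, @dist_eq_norm V u']
          exact h (x - y)
    exact le_iff_uniformContinuous_id.2
      (@LipschitzWith.uniformContinuous V V u'.toPseudoMetricSpace.toPseudoEMetricSpace
        u.toPseudoMetricSpace.toPseudoEMetricSpace 1 id h1)
  have key2 : (⨅ r : ({q'} : Set (AlgSeminorm K V)), seminormUniformity r.1.toSeminorm) ≤
      ⨅ r : ({q} : Set (AlgSeminorm K V)), seminormUniformity r.1.toSeminorm :=
    le_iInf fun r => (iInf_le _ ⟨q', rfl⟩).trans (by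
      obtain ⟨r, rfl⟩ := r
      exact key)
  exact continuous_id_iff_le.2 (UniformSpace.toTopologicalSpace_mono key2)

/-- The transition homomorphism `V_{q'} → V_q` for `q ≤ q'`. -/
def completionTransition {q q' : AlgSeminorm K V} (h : q.toSeminorm ≤ q'.toSeminorm) :
    SeminormCompletion q' →+* SeminormCompletion q :=
  UniformSpace.Completion.mapRingHom (idHom q q') (continuous_idHom h)

/-- (Two-sided) Fréchet–Stein algebras: the `K`-algebra is a Fréchet space, i.e. complete, Hausdorff,
with topology defined by an increasing sequence of submultiplicative nonarchimedean seminorms `q n`,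
the Banach algebras attached to the `q n` are left and right noetherian, and the transition
homomorphisms between them are flat on both sides. -/
structure IsFrechetStein (K : Type*) (V : Type*) [NormedField K] [Ring V] [Algebra K V]
    [UniformSpace V] : Prop where
  isUniformAddGroup : IsUniformAddGroup V
  completeSpace : CompleteSpace V
  t2Space : T2Space V
  exists_seminorms : ∃ (q : ℕ → AlgSeminorm K V)
    (hq : ∀ n, (q n).toSeminorm ≤ (q (n + 1)).toSeminorm),
    ‹UniformSpace V›.toTopologicalSpace =
      ⨅ n, (seminormUniformity (q n).toSeminorm).toTopologicalSpace ∧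
    (∀ n, IsNoetherianRing (SeminormCompletion (q n)) ∧
      IsNoetherianRing (SeminormCompletion (q n))ᵐᵒᵖ) ∧
    ∀ n, IsFlatHom (completionTransition (hq n))

end Seminorms

/-! ### Normed algebras defined by a lattice -/

section Lattice

/-- The absolute value of `K` has `R` as its unit ball. -/
class IsUnitBall (R K : Type*) [CommRing R] [NormedField K] [Algebra R K] : Prop where
  norm_le_one_iff : ∀ x : K, ‖x‖ ≤ 1 ↔ ∃ r : R, algebraMap R K r = x

variable (R K : Type*) [CommRing R] [NormedField K] [Algebra R K]
variable (B : Type*) [Ring B] [Algebra R B]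

/-- The `K`-algebra `B_K = K ⊗[R] B`; it carries the topology for which the image of `B` is the
unit ball, see `latticeSeminorm`. -/
def LatticeAlg : Type _ := K ⊗[R] B

instance : Ring (LatticeAlg R K B) := inferInstanceAs (Ring (K ⊗[R] B))

instance : Algebra K (LatticeAlg R K B) := inferInstanceAs (Algebra K (K ⊗[R] B))

/-- The map `B → K ⊗[R] B`. -/
def latticeIncl : B →+* LatticeAlg R K B :=
  (Algebra.TensorProduct.includeRight : B →ₐ[R] K ⊗[R] B).toRingHom

variable {B} in
theorem latticeIncl_smul (r : R) (b : B) :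
    latticeIncl R K B (r • b) = algebraMap R K r • latticeIncl R K B b := by
  change (1 : K) ⊗ₜ[R] (r • b) = algebraMap R K r • ((1 : K) ⊗ₜ[R] b)
  rw [TensorProduct.smul_tmul', ← TensorProduct.smul_tmul, Algebra.smul_def, smul_eq_mul]

/-- The absolute values of the scalars `c` with `v ∈ c • B`. -/
def gaugeSet (v : LatticeAlg R K B) : Set ℝ :=
  {r | ∃ (c : K) (b : B), v = c • latticeIncl R K B b ∧ r = ‖c‖}

theorem gaugeSet_bddBelow (v : LatticeAlg R K B) : BddBelow (gaugeSet R K B v) :=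
  ⟨0, by rintro _ ⟨c, b, -, rfl⟩; exact norm_nonneg c⟩

theorem exists_common [IsUnitBall R K] (c d : K) (b b' : B) (h : ‖d‖ ≤ ‖c‖) :
    ∃ b'' : B, c • latticeIncl R K B b + d • latticeIncl R K B b' =
      c • latticeIncl R K B b'' := by
  by_cases hc : c = 0
  · have hd : d = 0 := by simpa [hc] using h
    exact ⟨0, by simp [hc, hd]⟩
  · obtain ⟨r, hr⟩ := (IsUnitBall.norm_le_one_iff (R := R) (d / c)).1 (by
      rw [norm_div]
      exact div_le_one_of_le₀ h (norm_nonneg _))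
    refine ⟨b + r • b', ?_⟩
    rw [map_add, latticeIncl_smul, hr, smul_add, smul_smul, mul_div_cancel₀ _ hc]

theorem exists_add_mem_gaugeSet [IsUnitBall R K] {v w : LatticeAlg R K B} {r s : ℝ}
    (hr : r ∈ gaugeSet R K B v) (hs : s ∈ gaugeSet R K B w) :
    max r s ∈ gaugeSet R K B (v + w) := by
  obtain ⟨c, b, rfl, rfl⟩ := hr
  obtain ⟨d, b', rfl, rfl⟩ := hs
  rcases le_total ‖d‖ ‖c‖ with h | h
  · obtain ⟨b'', hb⟩ := exists_common R K B c d b b' h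
    exact ⟨c, b'', hb, max_eq_left h⟩
  · obtain ⟨b'', hb⟩ := exists_common R K B d c b' b h
    exact ⟨d, b'', by rw [add_comm, hb], max_eq_right h⟩

theorem gaugeSet_nonempty [IsUnitBall R K] (v : LatticeAlg R K B) :
    (gaugeSet R K B v).Nonempty := by
  induction (show K ⊗[R] B from v) using TensorProduct.induction_on with
  | zero => exact ⟨_, 0, 0, by simp; rfl, rfl⟩
  | tmul c b =>
    refine ⟨_, c, b, ?_, rfl⟩
    change c ⊗ₜ[R] b = c • ((1 : K) ⊗ₜ[R] b)
    rw [TensorProduct.smul_tmul', smul_eq_mul, mul_one]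
  | add x y hx hy =>
    obtain ⟨r, hr⟩ := hx
    obtain ⟨s, hs⟩ := hy
    exact ⟨_, exists_add_mem_gaugeSet R K B hr hs⟩

/-- The seminorm `v ↦ inf {|c| : v ∈ c • B}` on `B_K`, whose unit ball is the image of `B`. -/
def latticeSeminorm [IsUnitBall R K] : Seminorm K (LatticeAlg R K B) :=
  Seminorm.of (fun v => sInf (gaugeSet R K B v))
    (fun v w => by
      refine le_of_forall_pos_lt_add fun ε hε => ?_
      obtain ⟨r, hr, hr'⟩ := Real.lt_sInf_add_pos (gaugeSet_nonempty R K B v) (half_pos hε)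
      obtain ⟨s, hs, hs'⟩ := Real.lt_sInf_add_pos (gaugeSet_nonempty R K B w) (half_pos hε)
      have h0 : 0 ≤ r := by obtain ⟨c, -, -, rfl⟩ := hr; exact norm_nonneg c
      have h1 : 0 ≤ s := by obtain ⟨c, -, -, rfl⟩ := hs; exact norm_nonneg c
      have h2 := csInf_le (gaugeSet_bddBelow R K B (v + w)) (exists_add_mem_gaugeSet R K B hr hs)
      have h3 : max r s ≤ r + s := max_le (by linarith) (by linarith)
      linarith)
    (fun a v => by
      have aux : ∀ (a : K) (v : LatticeAlg R K B),
          sInf (gaugeSet R K B (a • v)) ≤ ‖a‖ * sInf (gaugeSet R K B v) := by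
        intro a v
        refine le_of_forall_pos_lt_add fun ε hε => ?_
        have h4 : 0 < ε / (‖a‖ + 1) := by positivity
        obtain ⟨r, ⟨c, b, hv, rfl⟩, hr'⟩ :=
          Real.lt_sInf_add_pos (gaugeSet_nonempty R K B v) h4
        have h5 : sInf (gaugeSet R K B (a • v)) ≤ ‖a * c‖ :=
          csInf_le (gaugeSet_bddBelow R K B _) ⟨a * c, b, by rw [hv, smul_smul], rfl⟩
        rw [norm_mul] at h5
        have h6 : ‖a‖ * (ε / (‖a‖ + 1)) < ε := by
          rw [mul_div_assoc', div_lt_iff₀ (by positivity)]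
          nlinarith [norm_nonneg a]
        nlinarith [norm_nonneg a]
      refine le_antisymm (aux a v) ?_
      by_cases ha : a = 0
      · rw [ha, norm_zero, zero_mul]
        exact Real.sInf_nonneg (by rintro _ ⟨c, -, -, rfl⟩; exact norm_nonneg c)
      · have h7 := aux a⁻¹ (a • v)
        rw [smul_smul, inv_mul_cancel₀ ha, one_smul, norm_inv] at h7
        rwa [← le_inv_mul_iff₀ (norm_pos_iff.2 ha)])

instance [IsUnitBall R K] : UniformSpace (LatticeAlg R K B) :=
  seminormUniformity (latticeSeminorm R K B)

variable {B} in
/-- The homomorphism `B_K → C_K` induced by a homomorphism `B → C`. -/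
def latticeMap {C : Type*} [Ring C] [Algebra R C] (f : B →ₐ[R] C) :
    LatticeAlg R K B →ₐ[K] LatticeAlg R K C :=
  (Algebra.TensorProduct.map (AlgHom.id K K) f : K ⊗[R] B →ₐ[K] K ⊗[R] C)

variable {R K B} in
theorem latticeAlg_hom_ext {W : Type*} [Ring W] [Algebra K W] {φ ψ : LatticeAlg R K B →ₐ[K] W}
    (h : ∀ b, φ (latticeIncl R K B b) = ψ (latticeIncl R K B b)) (z : LatticeAlg R K B) :
    φ z = ψ z := by
  induction (show K ⊗[R] B from z) using TensorProduct.induction_on with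
  | zero => exact (map_zero φ).trans (map_zero ψ).symm
  | tmul c b =>
    have hc : (show LatticeAlg R K B from c ⊗ₜ[R] b) = c • latticeIncl R K B b := by
      change c ⊗ₜ[R] b = c • ((1 : K) ⊗ₜ[R] b)
      rw [TensorProduct.smul_tmul', smul_eq_mul, mul_one]
    exact (congrArg φ hc).trans ((map_smul φ c _).trans ((congrArg (c • ·) (h b)).trans
      ((map_smul ψ c _).symm.trans (congrArg ψ hc).symm)))
  | add x y hx hy =>
    exact (map_add φ _ _).trans ((congrArg₂ (· + ·) hx hy).trans (map_add ψ _ _).symm)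

variable {B} in
theorem latticeMap_latticeIncl {C : Type*} [Ring C] [Algebra R C] (f : B →ₐ[R] C) (b : B) :
    latticeMap R K f (latticeIncl R K B b) = latticeIncl R K C (f b) := rfl

end Lattice

/-! ### The `ϖ`-adic completion of a (noncommutative) algebra -/

section AdicCompletion

variable {R : Type*} [CommRing R] (ϖ : R) (B : Type*) [Ring B] [Algebra R B]

/-- The two-sided ideal `ϖ ^ k B`. -/
def powIdeal (k : ℕ) : Ideal B := Ideal.span {algebraMap R B (ϖ ^ k)}

instance (k : ℕ) : (powIdeal ϖ B k).IsTwoSided where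
  mul_mem_of_left b ha := by
    rw [powIdeal, Ideal.mem_span_singleton'] at ha ⊢
    obtain ⟨c, rfl⟩ := ha
    exact ⟨c * b, by rw [mul_assoc, mul_assoc, Algebra.commutes]⟩

theorem powIdeal_antitone {k l : ℕ} (h : k ≤ l) : powIdeal ϖ B l ≤ powIdeal ϖ B k := by
  rw [powIdeal, Ideal.span_singleton_le_iff_mem, powIdeal, Ideal.mem_span_singleton']
  exact ⟨algebraMap R B (ϖ ^ (l - k)), by rw [← map_mul, ← pow_add, Nat.sub_add_cancel h]⟩

/-- The projection `B / ϖ ^ l B → B / ϖ ^ k B` for `k ≤ l`. -/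
def powProj {k l : ℕ} (h : k ≤ l) : B ⧸ powIdeal ϖ B l →ₐ[R] B ⧸ powIdeal ϖ B k :=
  Ideal.quotientMapₐ (powIdeal ϖ B k) (AlgHom.id R B) (powIdeal_antitone ϖ B h)

/-- The `ϖ`-adic completion of `B`, the projective limit of the rings `B / ϖ ^ k B`. -/
def piCompletionSub : Subalgebra R (∀ k, B ⧸ powIdeal ϖ B k) where
  carrier := {x | ∀ k l (h : k ≤ l), powProj ϖ B h (x l) = x k}
  mul_mem' hx hy k l h := by
    rw [Pi.mul_apply, Pi.mul_apply, map_mul, hx k l h, hy k l h]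
  add_mem' hx hy k l h := by
    rw [Pi.add_apply, Pi.add_apply, map_add, hx k l h, hy k l h]
  algebraMap_mem' r k l h := by
    rw [Pi.algebraMap_apply, Pi.algebraMap_apply, AlgHom.commutes]

/-- The `ϖ`-adic completion of `B`, as a type. -/
def PiCompletion : Type _ := piCompletionSub ϖ B

instance : Ring (PiCompletion ϖ B) := inferInstanceAs (Ring (piCompletionSub ϖ B))

instance : Algebra R (PiCompletion ϖ B) := inferInstanceAs (Algebra R (piCompletionSub ϖ B))

/-- The canonical homomorphism from `B` to its completion. -/
def toPiCompletion : B →ₐ[R] PiCompletion ϖ B :=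
  AlgHom.codRestrict (AlgHom.pi fun k => Ideal.Quotient.mkₐ R (powIdeal ϖ B k))
    (piCompletionSub ϖ B) fun _ _ _ _ => rfl

variable {B} {C : Type*} [Ring C] [Algebra R C] (f : B →ₐ[R] C)

theorem powIdeal_le_comap (k : ℕ) : powIdeal ϖ B k ≤ (powIdeal ϖ C k).comap f := by
  rw [powIdeal, Ideal.span_singleton_le_iff_mem, Ideal.mem_comap, AlgHom.commutes]
  exact Ideal.subset_span rfl

/-- The map `B / ϖ ^ k B → C / ϖ ^ k C` induced by `f`. -/
def powMap (k : ℕ) : B ⧸ powIdeal ϖ B k →ₐ[R] C ⧸ powIdeal ϖ C k :=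
  Ideal.quotientMapₐ (powIdeal ϖ C k) f (powIdeal_le_comap ϖ f k)

theorem powProj_powMap {k l : ℕ} (h : k ≤ l) (x : B ⧸ powIdeal ϖ B l) :
    powProj ϖ C h (powMap ϖ f l x) = powMap ϖ f k (powProj ϖ B h x) := by
  obtain ⟨x, rfl⟩ := Ideal.Quotient.mk_surjective x
  rfl

/-- The map of `ϖ`-adic completions induced by `f`. -/
def piCompletionMap : PiCompletion ϖ B →ₐ[R] PiCompletion ϖ C :=
  AlgHom.codRestrict
    (AlgHom.pi fun k =>
      (powMap ϖ f k).comp ((Pi.evalAlgHom R _ k).comp (piCompletionSub ϖ B).val))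
    (piCompletionSub ϖ C) fun x k l h => by
      have := x.2 k l h
      exact (powProj_powMap ϖ f h _).trans (congrArg _ this)

theorem piCompletionMap_toPiCompletion (b : B) :
    piCompletionMap ϖ f (toPiCompletion ϖ B b) = toPiCompletion ϖ C (f b) := rfl

end AdicCompletion

/-! ### Filtered algebras and their associated graded rings -/

section Filtration

/-- An increasing exhaustive multiplicative filtration `F 0 ⊆ F 1 ⊆ ...` of an `R`-algebra by
`R`-submodules. -/
structure AlgFiltration (R A : Type*) [CommRing R] [Ring A] [Algebra R A] where
  F : ℕ → Submodule R A
  mono : Monotone F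
  exhaustive : ∀ a : A, ∃ i, a ∈ F i
  one_mem : (1 : A) ∈ F 0
  mul_mem : ∀ {i j : ℕ} {a b : A}, a ∈ F i → b ∈ F j → a * b ∈ F (i + j)

namespace AlgFiltration

variable {R A : Type*} [CommRing R] [Ring A] [Algebra R A] (𝓕 : AlgFiltration R A)

/-- The subalgebra `F 0`. -/
def zeroPart : Subalgebra R A where
  carrier := 𝓕.F 0
  mul_mem' ha hb := 𝓕.mul_mem ha hb
  add_mem' ha hb := (𝓕.F 0).add_mem ha hb
  algebraMap_mem' r := by
    rw [Algebra.algebraMap_eq_smul_one]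
    exact (𝓕.F 0).smul_mem r 𝓕.one_mem

/-- The ring `F 0` as a commutative ring, once multiplication in it is known to commute. -/
abbrev zeroPartCommRing (h : ∀ x y : 𝓕.zeroPart, x * y = y * x) : CommRing 𝓕.zeroPart :=
  { (inferInstance : Ring 𝓕.zeroPart) with mul_comm := h }

/-- The step `F (i - 1)` of the filtration, with `F (-1) = 0`. -/
def lower : ℕ → Submodule R A
  | 0 => ⊥
  | i + 1 => 𝓕.F i

theorem mul_mem_lower_left {i j : ℕ} {a b : A} (ha : a ∈ 𝓕.lower i) (hb : b ∈ 𝓕.F j) :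
    a * b ∈ 𝓕.lower (i + j) := by
  cases i with
  | zero =>
    rw [(Submodule.mem_bot R).1 ha, zero_mul]
    exact Submodule.zero_mem _
  | succ i =>
    rw [Nat.add_right_comm]
    exact 𝓕.mul_mem ha hb

theorem mul_mem_lower_right {i j : ℕ} {a b : A} (ha : a ∈ 𝓕.F i) (hb : b ∈ 𝓕.lower j) :
    a * b ∈ 𝓕.lower (i + j) := by
  cases j with
  | zero =>
    rw [(Submodule.mem_bot R).1 hb, mul_zero]
    exact Submodule.zero_mem _
  | succ j => exact 𝓕.mul_mem ha hb

/-- The piece `gr_i = F i / F (i - 1)`. -/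
def grPiece (i : ℕ) : Type _ := 𝓕.F i ⧸ (𝓕.lower i).submoduleOf (𝓕.F i)

instance (i : ℕ) : AddCommGroup (𝓕.grPiece i) :=
  inferInstanceAs (AddCommGroup (𝓕.F i ⧸ (𝓕.lower i).submoduleOf (𝓕.F i)))

/-- The class in `gr_i` of an element of `F i`. -/
def symb (i : ℕ) : 𝓕.F i →+ 𝓕.grPiece i :=
  (Submodule.mkQ ((𝓕.lower i).submoduleOf (𝓕.F i))).toAddMonoidHom

theorem symb_surjective (i : ℕ) : Function.Surjective (𝓕.symb i) :=
  Submodule.mkQ_surjective _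

theorem symb_eq_iff {i : ℕ} {x y : 𝓕.F i} :
    𝓕.symb i x = 𝓕.symb i y ↔ (x : A) - y ∈ 𝓕.lower i :=
  Submodule.Quotient.eq _

/-- The product `F i × F j → F (i + j)`. -/
def fmul {i j : ℕ} (x : 𝓕.F i) (y : 𝓕.F j) : 𝓕.F (i + j) := ⟨x * y, 𝓕.mul_mem x.2 y.2⟩

/-- The product `gr_i × gr_j → gr_{i + j}`. -/
def grMul {i j : ℕ} : 𝓕.grPiece i → 𝓕.grPiece j → 𝓕.grPiece (i + j) :=
  Quotient.map₂ 𝓕.fmul (fun x x' hx y y' hy => by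
    have hx' : (x : A) - x' ∈ 𝓕.lower i := 𝓕.symb_eq_iff.1 (Quotient.sound hx)
    have hy' : (y : A) - y' ∈ 𝓕.lower j := 𝓕.symb_eq_iff.1 (Quotient.sound hy)
    refine Quotient.exact (𝓕.symb_eq_iff.2 ?_)
    have : (x : A) * y - x' * y' = (x - x') * y + x' * (y - y') := by noncomm_ring
    change (x : A) * y - x' * y' ∈ _
    rw [this]
    exact Submodule.add_mem _ (𝓕.mul_mem_lower_left hx' y.2) (𝓕.mul_mem_lower_right x'.2 hy'))

theorem symb_sigma_ext {i j : ℕ} (h : i = j) {x : 𝓕.F i} {y : 𝓕.F j} (hxy : (x : A) = y) :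
    (GradedMonoid.mk i (𝓕.symb i x) : GradedMonoid 𝓕.grPiece) =
      GradedMonoid.mk j (𝓕.symb j y) := by
  subst h
  rw [Subtype.ext hxy]

instance : GradedMonoid.GMul 𝓕.grPiece := ⟨𝓕.grMul⟩

theorem grMul_symb {i j : ℕ} (x : 𝓕.F i) (y : 𝓕.F j) :
    GradedMonoid.GMul.mul (𝓕.symb i x) (𝓕.symb j y) = 𝓕.symb (i + j) (𝓕.fmul x y) := rfl

instance : GradedMonoid.GOne 𝓕.grPiece := ⟨𝓕.symb 0 ⟨1, 𝓕.one_mem⟩⟩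

instance : DirectSum.GRing 𝓕.grPiece where
  mul_zero {i j} x := by
    obtain ⟨x, rfl⟩ := 𝓕.symb_surjective i x
    rw [← map_zero (𝓕.symb j), grMul_symb, ← map_zero (𝓕.symb (i + j))]
    exact congrArg _ (Subtype.ext (mul_zero _))
  zero_mul {i j} x := by
    obtain ⟨x, rfl⟩ := 𝓕.symb_surjective j x
    rw [← map_zero (𝓕.symb i), grMul_symb, ← map_zero (𝓕.symb (i + j))]
    exact congrArg _ (Subtype.ext (zero_mul _))
  mul_add {i j} x y z := by
    obtain ⟨x, rfl⟩ := 𝓕.symb_surjective i x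
    obtain ⟨y, rfl⟩ := 𝓕.symb_surjective j y
    obtain ⟨z, rfl⟩ := 𝓕.symb_surjective j z
    rw [← map_add, grMul_symb, grMul_symb, grMul_symb, ← map_add]
    exact congrArg _ (Subtype.ext (mul_add _ _ _))
  add_mul {i j} x y z := by
    obtain ⟨x, rfl⟩ := 𝓕.symb_surjective i x
    obtain ⟨y, rfl⟩ := 𝓕.symb_surjective i y
    obtain ⟨z, rfl⟩ := 𝓕.symb_surjective j z
    rw [← map_add, grMul_symb, grMul_symb, grMul_symb, ← map_add]
    exact congrArg _ (Subtype.ext (add_mul _ _ _))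
  one_mul := by
    rintro ⟨i, x⟩
    obtain ⟨x, rfl⟩ := 𝓕.symb_surjective i x
    exact 𝓕.symb_sigma_ext (zero_add i) (one_mul _)
  mul_one := by
    rintro ⟨i, x⟩
    obtain ⟨x, rfl⟩ := 𝓕.symb_surjective i x
    exact 𝓕.symb_sigma_ext (add_zero i) (mul_one _)
  mul_assoc := by
    rintro ⟨i, x⟩ ⟨j, y⟩ ⟨k, z⟩
    obtain ⟨x, rfl⟩ := 𝓕.symb_surjective i x
    obtain ⟨y, rfl⟩ := 𝓕.symb_surjective j y
    obtain ⟨z, rfl⟩ := 𝓕.symb_surjective k z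
    exact 𝓕.symb_sigma_ext (add_assoc i j k) (mul_assoc _ _ _)
  natCast n := 𝓕.symb 0 ⟨n, natCast_mem 𝓕.zeroPart n⟩
  natCast_zero := by
    rw [← map_zero (𝓕.symb 0)]
    exact congrArg _ (Subtype.ext Nat.cast_zero)
  natCast_succ n := by
    refine Eq.trans ?_ (map_add (𝓕.symb 0) _ _)
    exact congrArg _ (Subtype.ext (Nat.cast_succ n))
  intCast n := 𝓕.symb 0 ⟨n, intCast_mem 𝓕.zeroPart n⟩
  intCast_ofNat n := congrArg _ (Subtype.ext (Int.cast_natCast n))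
  intCast_negSucc_ofNat n := by
    rw [← map_neg]
    exact congrArg _ (Subtype.ext (Int.cast_negSucc n))

/-- The associated graded ring. -/
abbrev gr : Type _ := DirectSum ℕ 𝓕.grPiece

/-- The standing conditions on the filtration. -/
structure IsAdmissible (ϖ : R) : Prop where
  mul_swap : ∀ i j, 𝓕.F i * 𝓕.F j = 𝓕.F j * 𝓕.F i
  zero_comm : ∀ x y : 𝓕.zeroPart, x * y = y * x
  zero_noetherian : IsNoetherianRing 𝓕.zeroPart
  zero_domain : IsDomain 𝓕.zeroPart
  red_domain : letI := 𝓕.zeroPartCommRing zero_comm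
    IsDomain (𝓕.zeroPart ⧸ Ideal.span {algebraMap R 𝓕.zeroPart ϖ})
  red_regular : letI := 𝓕.zeroPartCommRing zero_comm
    IsRegularRing (𝓕.zeroPart ⧸ Ideal.span {algebraMap R 𝓕.zeroPart ϖ})
  gr_comm : ∀ x y : 𝓕.gr, x * y = y * x
  gr_polynomial : letI := 𝓕.zeroPartCommRing zero_comm
    ∃ (r : ℕ) (e : 𝓕.gr ≃+* MvPolynomial (Fin r) 𝓕.zeroPart),
      ∀ (i : ℕ) (x : 𝓕.gr),
        (∃ y : 𝓕.grPiece i, x = DirectSum.of 𝓕.grPiece i y) ↔ (e x).IsHomogeneous i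

/-! ### The algebras `A_n`, their completions and the projective limit -/

/-- The Rees ring, as a subring of `A[X]`. -/
def rees : Subalgebra R (Polynomial A) where
  carrier := {p | ∀ i, p.coeff i ∈ 𝓕.F i}
  mul_mem' {p q} hp hq i := by
    rw [Polynomial.coeff_mul]
    refine Submodule.sum_mem _ fun x hx => ?_
    rw [← Finset.HasAntidiagonal.mem_antidiagonal.1 hx]
    exact 𝓕.mul_mem (hp _) (hq _)
  add_mem' {p q} hp hq i := by
    rw [Polynomial.coeff_add]
    exact Submodule.add_mem _ (hp i) (hq i)
  algebraMap_mem' r i := by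
    rw [Polynomial.algebraMap_apply, Polynomial.coeff_C]
    split_ifs with h
    · rw [h]
      exact 𝓕.zeroPart.algebraMap_mem r
    · exact Submodule.zero_mem _

variable (R A) in
/-- Evaluation `A[X] → A` at a scalar. -/
def evalScalar (c : R) : Polynomial A →ₐ[R] A :=
  Polynomial.eval₂AlgHom (AlgHom.id R A) (algebraMap R A c) fun a => (Algebra.commutes c a).symm

/-- The subalgebra `A_n` of `A`: the image of the Rees ring under `X ↦ ϖ ^ n`. -/
def deform (ϖ : R) (n : ℕ) : Subalgebra R A := 𝓕.rees.map (evalScalar R A (ϖ ^ n))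

theorem pow_smul_mem_deform (ϖ : R) (n : ℕ) {i : ℕ} {a : A} (ha : a ∈ 𝓕.F i) :
    ϖ ^ (n * i) • a ∈ 𝓕.deform ϖ n := by
  refine ⟨Polynomial.monomial i a, fun j => ?_, ?_⟩
  · rw [Polynomial.coeff_monomial]
    split_ifs with h
    · rwa [← h]
    · exact Submodule.zero_mem _
  · change Polynomial.eval₂ _ _ (Polynomial.monomial i a) = _
    rw [Polynomial.eval₂_monomial, ← map_pow, ← pow_mul, Algebra.smul_def, Algebra.commutes]
    rfl

theorem deform_succ_le (ϖ : R) (n : ℕ) : 𝓕.deform ϖ (n + 1) ≤ 𝓕.deform ϖ n := by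
  rintro _ ⟨p, hp, rfl⟩
  change Polynomial.eval₂ _ _ p ∈ _
  rw [Polynomial.eval₂_eq_sum, Polynomial.sum]
  refine Subalgebra.sum_mem _ fun i _ => ?_
  have h := (𝓕.deform ϖ n).smul_mem (𝓕.pow_smul_mem_deform ϖ n (hp i)) (ϖ ^ i)
  rw [smul_smul, ← pow_add, Algebra.smul_def, Algebra.commutes] at h
  rw [← map_pow, ← pow_mul, Nat.succ_mul, Nat.add_comm]
  exact h

variable (K : Type*) [NormedField K] [Algebra R K] (ϖ : R)

/-- The algebra `Â_{n,K}`: the `ϖ`-adic completion of `A_n`, tensored with `K`. -/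
abbrev hatK (n : ℕ) : Type _ := LatticeAlg R K (PiCompletion ϖ (𝓕.deform ϖ n))

/-- The transition homomorphism `Â_{n+1,K} → Â_{n,K}`. -/
def hatTransition (n : ℕ) : 𝓕.hatK K ϖ (n + 1) →ₐ[K] 𝓕.hatK K ϖ n :=
  latticeMap R K (piCompletionMap ϖ (Subalgebra.inclusion (𝓕.deform_succ_le ϖ n)))

/-- The projective limit of the algebras `Â_{n,K}`, a subalgebra of their product with the
subspace topology. -/
def hatLimit : Subalgebra K (∀ n, 𝓕.hatK K ϖ n) where
  carrier := {x | ∀ n, 𝓕.hatTransition K ϖ n (x (n + 1)) = x n}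
  mul_mem' hx hy n := by rw [Pi.mul_apply, Pi.mul_apply, map_mul, hx n, hy n]
  add_mem' hx hy n := by rw [Pi.add_apply, Pi.add_apply, map_add, hx n, hy n]
  algebraMap_mem' r n := by rw [Pi.algebraMap_apply, Pi.algebraMap_apply, AlgHom.commutes]

/-- The homomorphism `A_n ⊗ K → A ⊗ K`. -/
def deformToAK (n : ℕ) : LatticeAlg R K (𝓕.deform ϖ n) →ₐ[K] K ⊗[R] A :=
  latticeMap R K (𝓕.deform ϖ n).val

theorem deformToAK_bijective [IsDomain R] [IsFractionRing R K] {ϖ : R} (hϖ : Irreducible ϖ)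
    (n : ℕ) : Function.Bijective (𝓕.deformToAK K ϖ n) := by
  have : Module.Flat R K := IsLocalization.flat K (nonZeroDivisors R)
  refine ⟨?_, fun v => ?_⟩
  · exact Module.Flat.lTensor_preserves_injective_linearMap (M := K)
      (𝓕.deform ϖ n).val.toLinearMap Subtype.val_injective
  · induction v using TensorProduct.induction_on with
    | zero => exact ⟨0, map_zero _⟩
    | tmul c a =>
      obtain ⟨i, hi⟩ := 𝓕.exhaustive a
      have h0 : algebraMap R K (ϖ ^ (n * i)) ≠ 0 := by
        rw [Ne, IsFractionRing.to_map_eq_zero_iff]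
        exact pow_ne_zero _ hϖ.ne_zero
      refine ⟨(c * (algebraMap R K (ϖ ^ (n * i)))⁻¹) ⊗ₜ[R]
        ⟨_, 𝓕.pow_smul_mem_deform ϖ n hi⟩, ?_⟩
      change (c * (algebraMap R K (ϖ ^ (n * i)))⁻¹) ⊗ₜ[R] (ϖ ^ (n * i) • a) = c ⊗ₜ[R] a
      rw [← TensorProduct.smul_tmul, Algebra.smul_def, mul_comm c, mul_inv_cancel_left₀ h0]
    | add x y hx hy =>
      obtain ⟨x, rfl⟩ := hx
      obtain ⟨y, rfl⟩ := hy
      exact ⟨x + y, map_add _ _ _⟩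

/-- The canonical homomorphism `A_K = A_n ⊗ K → Â_{n,K}`. -/
def toHatK [IsDomain R] [IsFractionRing R K] {ϖ : R} (hϖ : Irreducible ϖ) (n : ℕ) :
    K ⊗[R] A →ₐ[K] 𝓕.hatK K ϖ n :=
  (latticeMap R K (toPiCompletion ϖ (𝓕.deform ϖ n))).comp
    (AlgEquiv.ofBijective _ (𝓕.deformToAK_bijective K hϖ n)).symm.toAlgHom

theorem toHatK_deformToAK [IsDomain R] [IsFractionRing R K] {ϖ : R} (hϖ : Irreducible ϖ) (n : ℕ)
    (z : LatticeAlg R K (𝓕.deform ϖ n)) :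
    𝓕.toHatK K hϖ n (𝓕.deformToAK K ϖ n z) =
      latticeMap R K (toPiCompletion ϖ (𝓕.deform ϖ n)) z :=
  congrArg _ ((AlgEquiv.ofBijective _ (𝓕.deformToAK_bijective K hϖ n)).symm_apply_apply z)

theorem hatTransition_toHatK [IsDomain R] [IsFractionRing R K] {ϖ : R} (hϖ : Irreducible ϖ)
    (n : ℕ) (v : K ⊗[R] A) :
    𝓕.hatTransition K ϖ n (𝓕.toHatK K hϖ (n + 1) v) = 𝓕.toHatK K hϖ n v := by
  obtain ⟨z, rfl⟩ := (𝓕.deformToAK_bijective K hϖ (n + 1)).2 v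
  have h : 𝓕.deformToAK K ϖ (n + 1) z = 𝓕.deformToAK K ϖ n
      (latticeMap R K (Subalgebra.inclusion (𝓕.deform_succ_le ϖ n)) z) :=
    latticeAlg_hom_ext (φ := 𝓕.deformToAK K ϖ (n + 1)) (ψ := (𝓕.deformToAK K ϖ n).comp
      (latticeMap R K (Subalgebra.inclusion (𝓕.deform_succ_le ϖ n)))) (fun _ => rfl) z
  have h2 : 𝓕.hatTransition K ϖ n (latticeMap R K (toPiCompletion ϖ (𝓕.deform ϖ (n + 1))) z) =
      latticeMap R K (toPiCompletion ϖ (𝓕.deform ϖ n))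
        (latticeMap R K (Subalgebra.inclusion (𝓕.deform_succ_le ϖ n)) z) :=
    latticeAlg_hom_ext (φ := (𝓕.hatTransition K ϖ n).comp
        (latticeMap R K (toPiCompletion ϖ (𝓕.deform ϖ (n + 1)))))
      (ψ := (latticeMap R K (toPiCompletion ϖ (𝓕.deform ϖ n))).comp
        (latticeMap R K (Subalgebra.inclusion (𝓕.deform_succ_le ϖ n)))) (fun b => by
        rw [AlgHom.comp_apply, AlgHom.comp_apply, latticeMap_latticeIncl, latticeMap_latticeIncl,
          latticeMap_latticeIncl, hatTransition, latticeMap_latticeIncl,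
          piCompletionMap_toPiCompletion]) z
  rw [toHatK_deformToAK, h2, h, toHatK_deformToAK]

/-- The canonical homomorphism from `A_K` to the projective limit of the algebras `Â_{n,K}`. -/
def toHatLimit [IsDomain R] [IsFractionRing R K] {ϖ : R} (hϖ : Irreducible ϖ) :
    K ⊗[R] A →ₐ[K] 𝓕.hatLimit K ϖ :=
  AlgHom.codRestrict (AlgHom.pi fun n => 𝓕.toHatK K hϖ n) (𝓕.hatLimit K ϖ)
    fun v n => 𝓕.hatTransition_toHatK K hϖ n v

/-! ### The Arens–Michael envelope -/

/-- A topology on a `K`-vector space is locally convex (in the nonarchimedean sense) if it is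
defined by a family of nonarchimedean seminorms. -/
def IsLocallyConvex {V : Type*} [AddCommGroup V] [Module K V] (τ : TopologicalSpace V) : Prop :=
  ∃ Q : Set (Seminorm K V), (∀ q ∈ Q, ∀ x y, q (x + y) ≤ max (q x) (q y)) ∧
    τ = ⨅ q ∈ Q, (seminormUniformity q).toTopologicalSpace

/-- The inclusion of `(F 0)_K`, a normed algebra with unit ball `F 0`, into `A_K`. -/
def zeroPartToAK : LatticeAlg R K 𝓕.zeroPart →ₐ[K] K ⊗[R] A :=
  latticeMap R K 𝓕.zeroPart.val

/-- The finest locally convex topology on `A_K` for which the inclusion of `(F 0)_K` is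
continuous. -/
abbrev topologyAK [IsUnitBall R K] : TopologicalSpace (K ⊗[R] A) :=
  sInf {τ | IsLocallyConvex K τ ∧ Continuous[inferInstance, τ] (𝓕.zeroPartToAK K)}

/-- The set of continuous submultiplicative nonarchimedean seminorms on `A_K`. -/
def contSeminorms [IsUnitBall R K] : Set (AlgSeminorm K (K ⊗[R] A)) :=
  {q | Continuous[𝓕.topologyAK K, inferInstance] q.toSeminorm}

/-- The Arens–Michael envelope of `A_K`: its Hausdorff completion with respect to all continuous
submultiplicative seminorms. -/
abbrev ArensMichael [IsUnitBall R K] : Type _ :=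
  UniformSpace.Completion (SeminormedAlg (𝓕.contSeminorms K))

/-- The canonical homomorphism from `A_K` to its Arens–Michael envelope. -/
def toArensMichael [IsUnitBall R K] : K ⊗[R] A →+* 𝓕.ArensMichael K :=
  (UniformSpace.Completion.coeRingHom : SeminormedAlg (𝓕.contSeminorms K) →+* _)

end AlgFiltration

end Filtration

end

end AMEnvelope

open AMEnvelope

/-! Lift the polynomial generators of `gr A` to elements Y_1, …, Y_r of F_1. Then F_i is spanned
over F_0 by the words of length at most i in the Y_j (`IsAdmissible.exists_generators`), and
commutativity of `gr A` says that a commutator loses one degree. So A_n, the sum of the ϖ^(ni) F_i,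
is generated over F_0 by the elements ϖ^n Y_j, which commute with F_0 and with each other up to
terms of lower degree. A Hilbert basis argument with degree-lexicographic leading coefficients
(`IsAlmostPolynomial.isNoetherianRing`) makes A_n noetherian on both sides. This passes to the
ϖ-adic completion Â_n (`IsCentralComplete.isNoetherianRing`) and, after inverting ϖ, to Â_{n,K}.

Flatness. Let D (`hatSub`) be the preimage of Â_n in Â_{n+1,K}. It is the sum of Â_{n+1} and the
image of A_n, and it is almost polynomial over Â_{n+1} with generators ϖ^n Y_j: bracketing with ϖ^n
Y_j preserves A_{n+1}, and [ϖ^n Y_j, ϖu] = [ϖ^(n+1) Y_j, u]. Hence D is noetherian. Since D contains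
the image of A_n and is a full preimage, Â_n is the ϖ-adic completion of D, and completing a
noetherian ring along a central element is flat (`eqFlat_of_complete`). Inverting ϖ turns D → Â_n
into the transition homomorphism. All this is done with the equational criterion `EqFlat`;
`EqFlat.rightFlat` converts it into exactness of the tensor product, through injectivity of the
character module.

Fréchet–Stein property. The image of A_K is dense in every Â_{n,K}, so the completion of the
projective limit for its n-th seminorm is Â_{n,K}, and noetherianity and flatness carry over.

Arens–Michael envelope. The projective limit is complete, contains a dense image of A_K and induces
on it the gauges of the A_n. Each gauge is continuous because F_0 lies in A_n. Conversely, a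
continuous submultiplicative q is bounded by some C on F_0 and by some M ≥ 1 on the Y_j; once |ϖ|^n
M ≤ 1, it is bounded by C on A_n, hence by C times the n-th gauge. So both sides complete A_K for
the same uniform structure. -/

namespace AMEnvelope

noncomputable section

/-! ### The equational criterion for flatness -/

section EqFlat

variable {S T : Type*} [Ring S] [Ring T]

/-- Every linear relation over `T` between elements of `S` is a combination of relations
over `S`. -/
def EqFlat (f : S →+* T) : Prop :=
  ∀ (m : ℕ) (t : Fin m → T) (a : Fin m → S), ∑ i, t i * f (a i) = 0 →
    ∃ (k : ℕ) (t' : Fin k → T) (s : Fin k → Fin m → S),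
      (∀ i, t i = ∑ l, t' l * f (s l i)) ∧ ∀ l, ∑ i, s l i * a i = 0

/-- The left `S`-module of characters of the right `S`-module `T`. -/
def RightDual (_f : S →+* T) : Type _ := T →+ AddCircle (1 : ℚ)

variable (f : S →+* T)

instance : AddCommGroup (RightDual f) := inferInstanceAs (AddCommGroup (T →+ AddCircle (1 : ℚ)))

instance : FunLike (RightDual f) T (AddCircle (1 : ℚ)) :=
  inferInstanceAs (FunLike (T →+ AddCircle (1 : ℚ)) T _)

instance : AddMonoidHomClass (RightDual f) T (AddCircle (1 : ℚ)) :=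
  inferInstanceAs (AddMonoidHomClass (T →+ AddCircle (1 : ℚ)) T _)

theorem RightDual.add_apply (χ ψ : RightDual f) (t : T) : (χ + ψ) t = χ t + ψ t := rfl

instance : Module S (RightDual f) where
  smul s χ := AddMonoidHom.comp (χ : T →+ AddCircle (1 : ℚ)) (AddMonoidHom.mulRight (f s))
  one_smul χ := DFunLike.ext (F := RightDual f) _ _ fun t => by
    change χ (t * f 1) = χ t
    rw [map_one, mul_one]
  mul_smul s s' χ := DFunLike.ext (F := RightDual f) _ _ fun t => by
    change χ (t * f (s * s')) = χ (t * f s * f s')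
    rw [f.map_mul, mul_assoc]
  smul_zero _ := rfl
  smul_add _ _ _ := rfl
  add_smul s s' χ := DFunLike.ext (F := RightDual f) _ _ fun t => by
    change χ (t * f (s + s')) = χ (t * f s) + χ (t * f s')
    rw [map_add, mul_add, map_add]
  zero_smul χ := DFunLike.ext (F := RightDual f) _ _ fun t => by
    change χ (t * f 0) = 0
    rw [map_zero, mul_zero, map_zero]

theorem RightDual.smul_apply (s : S) (χ : RightDual f) (t : T) : (s • χ) t = χ (t * f s) := rfl

variable {f}

/-- The additive map `T ⊗ N → ℚ/ℤ` defined by a map from `N` to the characters of `T`. -/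
def RightDual.uncurry {N : Type*} [AddCommGroup N] [Module S N] (g : N →ₗ[S] RightDual f) :
    T ⊗[ℤ] N →+ AddCircle (1 : ℚ) :=
  TensorProduct.liftAddHom
    (AddMonoidHom.mk' (fun t => AddMonoidHom.mk' (fun n => g n t)
        fun x y => by rw [map_add, RightDual.add_apply])
      fun t t' => by ext n; exact map_add (g n) t t')
    fun r t n => by
      change g n (r • t) = g (r • n) t
      rw [map_zsmul, map_zsmul]
      exact (AddMonoidHom.zsmul_apply (g n : T →+ AddCircle (1 : ℚ)) r t).symm

theorem RightDual.uncurry_tmul {N : Type*} [AddCommGroup N] [Module S N]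
    (g : N →ₗ[S] RightDual f) (t : T) (n : N) : RightDual.uncurry g (t ⊗ₜ n) = g n t := rfl

/-- A linear map from a left ideal `I` to the characters of `T` is the same as a balanced map T ⊗ I
→ ℚ/ℤ. The equational criterion makes it vanish on the kernel of the multiplication T ⊗ I → T, so it
factors through the image of the latter and extends to `T` by divisibility of ℚ/ℤ. -/
theorem EqFlat.baer (hf : EqFlat f) : Module.Baer S (RightDual f) := by
  intro I g
  let μ : T ⊗[ℤ] I →+ T := TensorProduct.liftAddHom
    (AddMonoidHom.mk' (fun t => AddMonoidHom.mk' (fun n : I => t * f n)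
        fun x y => by rw [Submodule.coe_add, map_add, mul_add])
      fun t t' => by ext n; exact add_mul t t' _)
    fun r t n => by
      change (r • t) * f n = t * f (r • n : I)
      rw [Submodule.coe_smul_of_tower, map_zsmul, smul_mul_assoc, mul_smul_comm]
  have hμ : ∀ t n, μ (t ⊗ₜ n) = t * f n := fun _ _ => rfl
  have hker : μ.ker ≤ (RightDual.uncurry g).ker := by
    intro x hx
    obtain ⟨m, t, a, rfl⟩ := TensorProduct.exists_sum_tmul_eq x
    have h0 : ∑ i, t i * f (a i) = 0 := by
      simpa only [AddMonoidHom.mem_ker, map_sum, hμ] using hx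
    obtain ⟨k, t', s, ht, hs⟩ := hf m t (fun i => a i) h0
    rw [AddMonoidHom.mem_ker, map_sum]
    simp only [RightDual.uncurry_tmul]
    calc ∑ i, g (a i) (t i) = ∑ i, ∑ l, (g (s l i • a i)) (t' l) := by
          refine Finset.sum_congr rfl fun i _ => ?_
          rw [ht i, map_sum]
          exact Finset.sum_congr rfl fun l _ => by rw [map_smul, RightDual.smul_apply]
      _ = ∑ l, (RightDual.uncurry g) (t' l ⊗ₜ (∑ i, s l i • a i)) := by
          rw [Finset.sum_comm]
          refine Finset.sum_congr rfl fun l _ => ?_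
          rw [TensorProduct.tmul_sum, map_sum]
          rfl
      _ = 0 := by
          refine Finset.sum_eq_zero fun l _ => ?_
          have : ∑ i, s l i • a i = 0 := Subtype.ext (by
            simpa only [Submodule.coe_sum, Submodule.coe_smul, smul_eq_mul, Submodule.coe_zero]
                using hs l)
          rw [this, TensorProduct.tmul_zero, map_zero]
  obtain ⟨χ, hχ⟩ := (Module.Baer.of_divisible (AddCircle (1 : ℚ))).extension_property_addMonoidHom
    (QuotientAddGroup.kerLift μ) (QuotientAddGroup.kerLift_injective μ)
    (QuotientAddGroup.lift μ.ker (RightDual.uncurry g) hker)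
  have hχ' : ∀ x, χ (μ x) = RightDual.uncurry g x := fun x => DFunLike.congr_fun hχ (x : _ ⧸ μ.ker)
  refine ⟨LinearMap.toSpanSingleton S (RightDual f) χ, fun x hx => ?_⟩
  refine DFunLike.ext (F := RightDual f) _ _ fun t => ?_
  exact hχ' (t ⊗ₜ ⟨x, hx⟩)

end EqFlat

/-- Characters of T ⊗ N separate points and correspond to `S`-linear maps from N to the characters
of `T`. By Baer's criterion such a map extends along N → N', so every character of T ⊗ N factors
through T ⊗ N' and kills the kernel. -/
theorem EqFlat.rightFlat {S : Type u} {T : Type v} [Ring S] [Ring T] {f : S →+* T}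
    (hf : EqFlat f) : RightFlat f := by
  intro N N' _ _ _ _ φ hφ
  rw [injective_iff_map_eq_zero]
  intro x hx
  refine CharacterModule.eq_zero_of_character_apply fun χ => ?_
  let g : N →ₗ[S] RightDual f :=
    { toFun n := AddMonoidHom.mk' (fun t => χ (QuotientAddGroup.mk (t ⊗ₜ n)))
        fun t t' => by rw [TensorProduct.add_tmul, QuotientAddGroup.mk_add, map_add]
      map_add' n n' := DFunLike.ext (F := RightDual f) _ _ fun t => by
        change χ (QuotientAddGroup.mk (t ⊗ₜ (n + n'))) =
          χ (QuotientAddGroup.mk (t ⊗ₜ n)) + χ (QuotientAddGroup.mk (t ⊗ₜ n'))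
        rw [TensorProduct.tmul_add, QuotientAddGroup.mk_add, map_add]
      map_smul' s n := DFunLike.ext (F := RightDual f) _ _ fun t => by
        change χ (QuotientAddGroup.mk (t ⊗ₜ (s • n))) =
          χ (QuotientAddGroup.mk ((t * f s) ⊗ₜ n))
        refine congrArg χ (QuotientAddGroup.eq_iff_sub_mem.2 ?_)
        rw [← neg_sub]
        exact neg_mem (AddSubgroup.subset_closure ⟨t, s, n, rfl⟩) }
  obtain ⟨h, hh⟩ := hf.baer.extension_property φ hφ g
  have hrel : balancedRel f N' ≤ (RightDual.uncurry h).ker := by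
    refine (AddSubgroup.closure_le _).2 ?_
    rintro _ ⟨t, s, n, rfl⟩
    rw [SetLike.mem_coe, AddMonoidHom.mem_ker, map_sub, RightDual.uncurry_tmul,
      RightDual.uncurry_tmul, map_smul, RightDual.smul_apply, sub_self]
  have key : ∀ x : T ⊗[ℤ] N, χ (QuotientAddGroup.mk x) = RightDual.uncurry h
      (TensorProduct.map LinearMap.id φ.toAddMonoidHom.toIntLinearMap x) := by
    intro x
    induction x using TensorProduct.induction_on with
    | zero => rw [QuotientAddGroup.mk_zero, map_zero, map_zero, map_zero]
    | tmul t n => exact (DFunLike.congr_fun (LinearMap.congr_fun hh n) t).symm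
    | add x y hx hy => rw [QuotientAddGroup.mk_add, map_add, map_add, map_add, hx, hy]
  obtain ⟨x, rfl⟩ := QuotientAddGroup.mk_surjective x
  have h1 := congrArg (QuotientAddGroup.lift (balancedRel f N') (RightDual.uncurry h) hrel) hx
  rw [map_zero] at h1
  exact (key x).trans h1

theorem EqFlat.of_ringEquiv {S T S' T' : Type*} [Ring S] [Ring T] [Ring S'] [Ring T']
    {f : S →+* T} {f' : S' →+* T'} (eS : S ≃+* S') (eT : T ≃+* T')
    (h : ∀ x, eT (f x) = f' (eS x)) (hf : EqFlat f) : EqFlat f' := by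
  intro m t a hta
  obtain ⟨k, t', s, ht, hs⟩ := hf m (fun i => eT.symm (t i)) (fun i => eS.symm (a i)) (by
    apply eT.injective
    simpa only [map_sum, map_mul, h, RingEquiv.apply_symm_apply, map_zero] using hta)
  refine ⟨k, fun l => eT (t' l), fun l i => eS (s l i), fun i => ?_, fun l => ?_⟩
  · rw [← eT.apply_symm_apply (t i), ht i, map_sum]
    simp only [map_mul, h]
  · apply eS.symm.injective
    simpa only [map_sum, map_mul, RingEquiv.symm_apply_apply, map_zero] using hs l

/-! ### Adically complete noncommutative rings -/

section Complete

/-- The ring `U` is complete and separated for the adic topology of the central element `p`. -/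
structure IsCentralComplete {U : Type*} [Ring U] (p : U) : Prop where
  comm : ∀ x, p * x = x * p
  separated : ∀ x, (∀ k : ℕ, ∃ y, x = p ^ k * y) → x = 0
  complete : ∀ c : ℕ → U, ∃ u, ∀ k, ∃ y, u = ∑ i ∈ Finset.range k, p ^ i * c i + p ^ k * y

theorem commute_pow {U : Type*} [Ring U] {p : U} (h : ∀ x, p * x = x * p) (k : ℕ) (x : U) :
    p ^ k * x = x * p ^ k :=
  ((show Commute p x from h x).pow_left k).eq

theorem IsCentralComplete.op {U : Type*} [Ring U] {p : U} (h : IsCentralComplete p) :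
    IsCentralComplete (MulOpposite.op p) where
  comm x := MulOpposite.unop_injective (h.comm x.unop).symm
  separated x hx := MulOpposite.unop_injective (h.separated x.unop fun k => by
    obtain ⟨y, rfl⟩ := hx k
    exact ⟨y.unop, by
      rw [MulOpposite.unop_mul, MulOpposite.unop_pow, MulOpposite.unop_op,
        commute_pow h.comm]⟩)
  complete c := by
    obtain ⟨u, hu⟩ := h.complete fun i => (c i).unop
    refine ⟨MulOpposite.op u, fun k => ?_⟩
    obtain ⟨y, hy⟩ := hu k
    refine ⟨MulOpposite.op y, MulOpposite.unop_injective ?_⟩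
    simp only [MulOpposite.unop_op, MulOpposite.unop_add, MulOpposite.unop_mul,
      MulOpposite.unop_pow, Finset.unop_sum, ← commute_pow h.comm]
    exact hy

/-- A form of Nakayama's lemma over a complete ring. -/
theorem IsCentralComplete.exists_eq_sum {U E : Type*} [Ring U] {p : U} (hp : IsCentralComplete p)
    [AddCommGroup E] [Module U E] (hE : ∀ x : E, (∀ k : ℕ, ∃ y : E, x = p ^ k • y) → x = 0)
    {ι : Type*} [Fintype ι] (z : ι → E) (M : Set E)
    (h : ∀ x ∈ M, ∃ (a : ι → U) (x' : E), x' ∈ M ∧ x = ∑ l, a l • z l + p • x') :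
    ∀ x ∈ M, ∃ a : ι → U, x = ∑ l, a l • z l := by
  intro x hx
  choose a x' hx' hxx using fun x : M => h x x.2
  -- The successive remainders; expanding n times leaves the error `p ^ n • s n`.
  let s : ℕ → M := fun n => (fun y : M => (⟨x' y, hx' y⟩ : M))^[n] ⟨x, hx⟩
  have hs : ∀ n, (s n : E) = ∑ l, a (s n) l • z l + p • (s (n + 1) : E) := fun n => by
    rw [show (s (n + 1) : E) = x' (s n) from
      congrArg Subtype.val (Function.iterate_succ_apply' _ n _)]
    exact hxx (s n)
  have hsum : ∀ n, x = ∑ i ∈ Finset.range n, p ^ i • ∑ l, a (s i) l • z l + p ^ n • (s n : E) := by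
    intro n
    induction n with
    | zero => simp [s]
    | succ n ih =>
      rw [Finset.sum_range_succ, add_assoc, pow_succ, mul_smul, ← smul_add, ← hs n]
      exact ih
  -- The coefficient of `z l` is the sum of the p-adic series of the coefficients found at each
  -- stage; `hE` then shows that no error remains.
  choose u hu using fun l => hp.complete fun n => a (s n) l
  refine ⟨u, sub_eq_zero.1 (hE _ fun k => ?_)⟩
  choose y hy using fun l => hu l k
  refine ⟨s k - ∑ l, y l • z l, ?_⟩
  have h1 : ∑ l, u l • z l = ∑ i ∈ Finset.range k, p ^ i • ∑ l, a (s i) l • z l +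
      p ^ k • ∑ l, y l • z l := by
    simp only [Finset.smul_sum]
    rw [Finset.sum_comm, ← Finset.sum_add_distrib]
    refine Finset.sum_congr rfl fun l _ => ?_
    rw [hy l, add_smul, Finset.sum_smul]
    simp only [mul_smul]
  rw [h1]
  nth_rewrite 1 [hsum k]
  rw [smul_sub]
  abel

variable {P U : Type*} [Ring P] [Ring U]

/-- Approximation of `U` by the image of `P`, modulo powers of `p`. -/
theorem exists_eq_add_pow {g : P → U} {p : U} {q : P} (hq : ∀ t t', g t + p * g t' = g (t + q * t'))
    (happ : ∀ u, ∃ t u', u = g t + p * u') (k : ℕ) (u : U) :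
    ∃ t u', u = g t + p ^ (k + 1) * u' := by
  induction k generalizing u with
  | zero => simpa using happ u
  | succ k ih =>
    obtain ⟨t, u', rfl⟩ := happ u
    obtain ⟨t', u'', rfl⟩ := ih u'
    exact ⟨t + q * t', u'', by rw [mul_add, ← add_assoc, hq, ← mul_assoc, ← pow_succ']⟩

/-- One power of `p` is extracted by `hdiv`, and `htf` cancels it before the next one is extracted.
-/
theorem exists_eq_pow_mul {g : P →+* U} {p : P}
    (htf : ∀ u, g p * u = 0 → u = 0) (hdiv : ∀ t u, g t = g p * u → ∃ t', t = p * t') (k : ℕ) :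
    ∀ t u, g t = g p ^ k * u → ∃ t', t = p ^ k * t' := by
  induction k with
  | zero => exact fun t u _ => ⟨t, by simp⟩
  | succ k ih =>
    intro t u h
    rw [pow_succ', mul_assoc] at h
    obtain ⟨t', rfl⟩ := hdiv t _ h
    obtain ⟨t'', rfl⟩ := ih t' u (by
      rw [map_mul, ← sub_eq_zero, ← mul_sub] at h
      exact sub_eq_zero.1 (htf _ h))
    exact ⟨t'', by rw [pow_succ', mul_assoc]⟩

/-- The completion of a left noetherian ring along a central element is flat. -/
theorem eqFlat_of_complete [IsNoetherianRing P] (g : P →+* U) {p : P}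
    (hp : ∀ x, p * x = x * p) (hU : IsCentralComplete (g p))
    (htf : ∀ u, g p * u = 0 → u = 0) (happ : ∀ u, ∃ t u', u = g t + g p * u')
    (hdiv : ∀ t u, g t = g p * u → ∃ t', t = p * t') : EqFlat g := by
  intro m t a hta
  let J : Ideal P := Ideal.span (Set.range a)
  -- The increasing left ideals (J : p^k) become stationary at some `c`. This plays the role of the
  -- Artin–Rees lemma.
  let Jk : ℕ →o Ideal P :=
    { toFun k :=
        { carrier := {x | p ^ k * x ∈ J}
          add_mem' hx hy := by
            rw [Set.mem_ofPred_eq, mul_add]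
            exact J.add_mem hx hy
          zero_mem' := by simp
          smul_mem' c x hx := by
            rw [Set.mem_ofPred_eq, smul_eq_mul, ← mul_assoc, commute_pow hp, mul_assoc]
            exact J.mul_mem_left c hx }
      monotone' k l h x hx := by
        change p ^ l * x ∈ J
        rw [← Nat.sub_add_cancel h, pow_add, mul_assoc]
        exact J.mul_mem_left _ hx }
  obtain ⟨c, hc⟩ := monotone_stabilizes_iff_noetherian.2 ‹IsNoetherianRing P› Jk
  -- The relations between the `a i` over `P`, finitely generated because `P` is noetherian.
  -- Nakayama's lemma will show that they generate the relations over `U`.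
  let Z : Submodule P (Fin m → P) := LinearMap.ker (Fintype.linearCombination P a)
  have hZ : ∀ w, w ∈ Z ↔ ∑ i, w i * a i = 0 := fun w => by
    simp [Z, Fintype.linearCombination_apply]
  obtain ⟨k, z, hz⟩ := Submodule.fg_iff_exists_fin_generating_family.1
    (IsNoetherian.noetherian Z)
  have hzZ : ∀ l, z l ∈ Z := fun l => hz ▸ Submodule.subset_span ⟨l, rfl⟩
  obtain ⟨b, hb⟩ := hU.exists_eq_sum (E := Fin m → U)
    (fun x hx => funext fun i => hU.separated _ fun k => by
      obtain ⟨y, rfl⟩ := hx k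
      exact ⟨y i, rfl⟩)
    (fun l i => g (z l i)) {t | ∑ i, t i * g (a i) = 0} (by
      intro t ht
      rw [Set.mem_ofPred_eq] at ht
      -- Approximation to order `c + 1` gives p^(c+1) x ∈ J, hence already p^c x ∈ J by
      -- stationarity. The spare factor `p` makes the correction of `u` to a true relation a
      -- multiple of `p`.
      choose u t' hut using fun i => exists_eq_add_pow (g := g) (p := g p) (q := p)
        (fun t t' => by rw [map_add, map_mul]) happ c (t i)
      obtain ⟨x, hx⟩ := exists_eq_pow_mul htf hdiv (c + 1) (∑ i, u i * a i)
        (-∑ i, t' i * g (a i)) (by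
          rw [mul_neg, eq_neg_iff_add_eq_zero, ← ht, map_sum, Finset.mul_sum,
            ← Finset.sum_add_distrib]
          exact Finset.sum_congr rfl fun i _ => by
            rw [hut i, add_mul, map_mul, mul_assoc])
      have hxJ : x ∈ Jk c := by
        rw [hc (c + 1) (Nat.le_succ c)]
        change p ^ (c + 1) * x ∈ J
        rw [← hx]
        exact Submodule.sum_mem _ fun i _ => J.mul_mem_left _ (Ideal.subset_span ⟨i, rfl⟩)
      obtain ⟨v, hv⟩ := (Submodule.mem_span_range_iff_exists_fun P).1 hxJ
      simp only [smul_eq_mul] at hv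
      have hwZ : (fun i => u i - p * v i) ∈ Z := by
        rw [hZ]
        simp only [sub_mul, mul_assoc]
        rw [Finset.sum_sub_distrib, ← Finset.mul_sum, hv, hx, pow_succ', mul_assoc, sub_self]
      rw [← hz] at hwZ
      obtain ⟨b, hb⟩ := (Submodule.mem_span_range_iff_exists_fun P).1 hwZ
      have hteq : ∀ i, t i = g (u i - p * v i) + g p * (g p ^ c * t' i + g (v i)) := fun i => by
        nth_rewrite 1 [hut i]
        rw [map_sub, map_mul, pow_succ', mul_add]
        noncomm_ring
      refine ⟨fun l => g (b l), fun i => g p ^ c * t' i + g (v i), ?_, ?_⟩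
      -- The remainder is again a relation, since `g p` times it is the difference of two relations.
      · refine htf _ ?_
        have h1 : ∑ i, g (u i - p * v i) * g (a i) = 0 := by
          simp only [← map_mul, ← map_sum]
          rw [(hZ _).1 (hz ▸ hwZ), map_zero]
        have h2 := ht
        simp only [hteq, add_mul _ _ (g (a _)), Finset.sum_add_distrib, h1, zero_add] at h2
        rw [Finset.mul_sum, ← h2]
        exact Finset.sum_congr rfl fun i _ => (mul_assoc _ _ _).symm
      · funext i
        rw [hteq i, ← congrFun hb i]
        simp [Finset.sum_apply])
    t hta
  refine ⟨k, b, z, fun i => ?_, fun l => (hZ _).1 (hzZ l)⟩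
  rw [hb]
  simp [Finset.sum_apply]

/-- Flatness is preserved by inverting a central element. -/
theorem EqFlat.localization {S T : Type*} [Ring S] [Ring T] {g : P →+* U} (hg : EqFlat g)
    {f : S →+* T} {j : P →+* S} {i : U →+* T} (hi : Function.Injective i)
    (hij : ∀ x, i (g x) = f (j x)) {q : S} (hq : IsUnit q)
    (hqS : ∀ x, q * x = x * q) (hqT : ∀ x, f q * x = x * f q)
    (hS : ∀ x, ∃ (k : ℕ) (y : P), q ^ k * x = j y)
    (hT : ∀ x, ∃ (k : ℕ) (y : U), f q ^ k * x = i y)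
    (hqP : ∃ y, j y = q) (hqU : ∃ y, i y = f q) : EqFlat f := by
  intro m t a hta
  obtain ⟨qP, hqP⟩ := hqP
  obtain ⟨qU, hqU⟩ := hqU
  choose ka a' ha using fun l => hS (a l)
  choose kt t' ht using fun l => hT (t l)
  -- The sums of the exponents serve as common denominators for all coefficients at once.
  let N := ∑ l, ka l
  let N' := ∑ l, kt l
  have haN : ∀ l, q ^ N * a l = j (qP ^ (N - ka l) * a' l) := fun l => by
    rw [map_mul, map_pow, hqP, ← ha l, ← mul_assoc, ← pow_add, Nat.sub_add_cancel
      (Finset.single_le_sum (fun _ _ => Nat.zero_le _) (Finset.mem_univ l))]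
  have htN : ∀ l, f q ^ N' * t l = i (qU ^ (N' - kt l) * t' l) := fun l => by
    rw [map_mul, map_pow, hqU, ← ht l, ← mul_assoc, ← pow_add, Nat.sub_add_cancel
      (Finset.single_le_sum (fun _ _ => Nat.zero_le _) (Finset.mem_univ l))]
  obtain ⟨k, b, s, hbs, hs⟩ := hg m (fun l => qU ^ (N' - kt l) * t' l)
    (fun l => qP ^ (N - ka l) * a' l) (by
      apply hi
      rw [map_sum, map_zero]
      calc _ = ∑ l, f q ^ N' * f q ^ N * (t l * f (a l)) := by
            refine Finset.sum_congr rfl fun l _ => ?_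
            rw [map_mul i, ← htN, hij, ← haN, map_mul, map_pow, mul_assoc, ← mul_assoc (t l),
              ← commute_pow hqT, mul_assoc, mul_assoc]
        _ = 0 := by rw [← Finset.mul_sum, hta, mul_zero])
  have hfq : IsUnit (f q) := hq.map f
  refine ⟨k, fun l => Ring.inverse (f q ^ N') * i (b l), fun l r => j (s l r), fun r => ?_,
    fun l => ?_⟩
  · have h1 : f q ^ N' * t r = ∑ l, i (b l) * f (j (s l r)) := by
      rw [htN, hbs r, map_sum]
      simp only [map_mul, hij]
    simp only [mul_assoc]
    rw [← Finset.mul_sum, ← h1, ← mul_assoc, Ring.inverse_mul_cancel _ (hfq.pow N'), one_mul]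
  · refine (hq.pow N).mul_right_injective ?_
    change q ^ N * _ = q ^ N * 0
    rw [mul_zero, ← map_zero j, ← hs l, map_sum, Finset.mul_sum]
    refine Finset.sum_congr rfl fun r _ => ?_
    rw [map_mul, ← haN, ← mul_assoc, ← mul_assoc, commute_pow hqS]

end Complete

/-! ### Criteria for a noncommutative ring to be noetherian -/

section CompleteNoetherian

variable {B U : Type*} [Ring B] [Ring U]

/-- The elements of `B` congruent modulo `p` to elements of `I` form a left ideal, and lifts of its
generators generate `I` modulo `p`. The error `p * u'` lies in `I`, but `u'` need not. -/
theorem exists_generators_mod [IsNoetherianRing B] (ι : B →+* U) {p : U}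
    (hp : ∀ x, p * x = x * p) (happ : ∀ u, ∃ b u', u = ι b + p * u') (I : Ideal U) :
    ∃ (k : ℕ) (g : Fin k → U), (∀ l, g l ∈ I) ∧
      ∀ x ∈ I, ∃ (a : Fin k → U) (u' : U), x = ∑ l, a l * g l + p * u' := by
  let J : Ideal B :=
    { carrier := {b | ∃ x ∈ I, ∃ u, ι b = x + p * u}
      add_mem' := by
        rintro b b' ⟨x, hx, u, h⟩ ⟨x', hx', u', h'⟩
        exact ⟨x + x', I.add_mem hx hx', u + u', by rw [map_add, h, h', mul_add]; abel⟩
      zero_mem' := ⟨0, I.zero_mem, 0, by simp⟩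
      smul_mem' := by
        rintro c b ⟨x, hx, u, h⟩
        exact ⟨ι c * x, I.mul_mem_left _ hx, ι c * u, by
          rw [smul_eq_mul, map_mul, h, mul_add, ← mul_assoc, ← hp, mul_assoc]⟩ }
  obtain ⟨k, b, hb⟩ := Submodule.fg_iff_exists_fin_generating_family.1
    (IsNoetherian.noetherian J)
  choose g hg w hw using fun l => show b l ∈ J from hb ▸ Submodule.subset_span ⟨l, rfl⟩
  refine ⟨k, g, hg, fun x hx => ?_⟩
  obtain ⟨c, u, hu⟩ := happ x
  have hc : c ∈ J := ⟨x, hx, -u, by rw [hu]; simp⟩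
  rw [← hb] at hc
  obtain ⟨a, rfl⟩ := (Submodule.mem_span_range_iff_exists_fun B).1 hc
  refine ⟨fun l => ι (a l), ∑ l, ι (a l) * w l + u, ?_⟩
  rw [hu, mul_add, ← add_assoc, map_sum, Finset.mul_sum, ← Finset.sum_add_distrib]
  congr 1
  refine Finset.sum_congr rfl fun l _ => ?_
  rw [smul_eq_mul, map_mul, hw, mul_add, ← mul_assoc p, hp (ι (a l)), mul_assoc]

/-- A ring that is complete along a central element `p` is left noetherian if it is approximated
modulo `p` by a left noetherian ring. -/
theorem IsCentralComplete.isNoetherianRing [IsNoetherianRing B] (ι : B →+* U) {p : U}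
    (hp : IsCentralComplete p) (happ : ∀ u, ∃ b u', u = ι b + p * u') : IsNoetherianRing U := by
  -- For a saturated ideal the quotient of the error by `p` does stay in `I`, so Nakayama's lemma
  -- applies.
  have hsat : ∀ I : Ideal U, (∀ x, p * x ∈ I → x ∈ I) → I.FG := by
    intro I hI
    obtain ⟨k, g, hg, hgen⟩ := exists_generators_mod ι hp.comm happ I
    refine Submodule.fg_iff_exists_fin_generating_family.2 ⟨k, g, le_antisymm ?_ fun x hx => ?_⟩
    · rw [Submodule.span_le]
      rintro _ ⟨l, rfl⟩
      exact hg l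
    · rw [Submodule.mem_span_range_iff_exists_fun]
      obtain ⟨a, ha⟩ := hp.exists_eq_sum (E := U) hp.separated g I (fun x hx => by
        obtain ⟨a, u, hu⟩ := hgen x hx
        refine ⟨a, u, hI u ?_, hu⟩
        rw [← sub_eq_iff_eq_add'.2 hu]
        exact I.sub_mem hx (Submodule.sum_mem _ fun l _ => I.mul_mem_left _ (hg l))) x hx
      exact ⟨a, ha.symm⟩
  let L : ℕ → (U →ₗ[U] U) := fun k => LinearMap.toSpanSingleton U U (p ^ k)
  have hL : ∀ k x, L k x = x * p ^ k := fun _ _ => rfl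
  -- In general `I` is generated by the lifts together with p (I : p).
  have hstep : ∀ I : Ideal U, (Submodule.comap (L 1) I).FG → I.FG := by
    intro I hI
    obtain ⟨k, g, hg, hgen⟩ := exists_generators_mod ι hp.comm happ I
    have : I = Submodule.span U (Set.range g) ⊔ (Submodule.comap (L 1) I).map (L 1) := by
      refine le_antisymm (fun x hx => ?_) (sup_le ?_ ?_)
      · obtain ⟨a, u, hu⟩ := hgen x hx
        have h1 : ∑ l, a l * g l ∈ Submodule.span U (Set.range g) :=
          Submodule.sum_mem _ fun l _ => Submodule.smul_mem _ _ (Submodule.subset_span ⟨l, rfl⟩)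
        rw [hu]
        refine Submodule.add_mem_sup h1 ⟨u, ?_, ?_⟩
        · rw [SetLike.mem_coe, Submodule.mem_comap, hL, pow_one, ← hp.comm,
            ← sub_eq_iff_eq_add'.2 hu]
          exact I.sub_mem hx (Submodule.sum_mem _ fun l _ => I.mul_mem_left _ (hg l))
        · rw [hL, pow_one, hp.comm]
      · rw [Submodule.span_le]
        rintro _ ⟨l, rfl⟩
        exact hg l
      · exact Submodule.map_comap_le _ _
    rw [this]
    exact (Submodule.fg_span (Set.finite_range g)).sup (hI.map _)
  rw [isNoetherianRing_iff_ideal_fg]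
  intro I
  have hmono : ∀ {k l x}, k ≤ l → x * p ^ k ∈ I → x * p ^ l ∈ I := fun {k l x} h hx => by
    rw [← Nat.add_sub_cancel' h, pow_add, ← mul_assoc, ← commute_pow hp.comm]
    exact I.mul_mem_left _ hx
  -- The saturation is finitely generated, hence equal to (I : p^N) for one N; finite generation
  -- then descends from (I : p^N) to `I`, one power at a time.
  let Isat : Ideal U :=
    { carrier := {x | ∃ k, x * p ^ k ∈ I}
      add_mem' := by
        rintro x x' ⟨k, hk⟩ ⟨k', hk'⟩
        refine ⟨max k k', ?_⟩
        rw [add_mul]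
        exact I.add_mem (hmono (le_max_left _ _) hk) (hmono (le_max_right _ _) hk')
      zero_mem' := ⟨0, by simp⟩
      smul_mem' := by
        rintro c x ⟨k, hk⟩
        refine ⟨k, ?_⟩
        rw [smul_eq_mul, mul_assoc]
        exact I.mul_mem_left c hk }
  have hIsat : Isat.FG := hsat Isat fun x hx => by
    obtain ⟨k, hk⟩ := hx
    exact ⟨k + 1, by rwa [pow_succ', ← mul_assoc, ← hp.comm]⟩
  obtain ⟨m, g, hg⟩ := Submodule.fg_iff_exists_fin_generating_family.1 hIsat
  choose k hk using fun l => show g l ∈ Isat from hg ▸ Submodule.subset_span ⟨l, rfl⟩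
  have hN : Submodule.comap (L (∑ l, k l)) I = Isat := by
    refine le_antisymm (fun x hx => ⟨_, hx⟩) ?_
    rw [← hg, Submodule.span_le]
    rintro _ ⟨l, rfl⟩
    exact hmono (Finset.single_le_sum (fun _ _ => Nat.zero_le _) (Finset.mem_univ l)) (hk l)
  have hdown : ∀ n, (Submodule.comap (L n) I).FG → I.FG := by
    intro n
    induction n with
    | zero =>
      intro h
      rwa [show Submodule.comap (L 0) I = I from Submodule.ext fun x => by
        rw [Submodule.mem_comap, hL, pow_zero, mul_one]] at h
    | succ n ih =>
      refine fun h => ih (hstep _ ?_)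
      rwa [show Submodule.comap (L 1) (Submodule.comap (L n) I) = Submodule.comap (L (n + 1)) I from
        Submodule.ext fun x => by
          rw [Submodule.mem_comap, Submodule.mem_comap, Submodule.mem_comap, hL, hL, hL, pow_one,
            pow_succ', mul_assoc]]
  exact hdown _ (hN ▸ hIsat)

/-- Inverting a central element preserves left noetherian rings. -/
theorem isNoetherianRing_localization [IsNoetherianRing U] {T : Type*} [Ring T] (i : U →+* T)
    {q : T} (hq : IsUnit q) (hT : ∀ x, ∃ (k : ℕ) (y : U), q ^ k * x = i y) :
    IsNoetherianRing T := by
  rw [isNoetherianRing_iff_ideal_fg]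
  intro I
  have : I = (I.comap i).map i := by
    refine le_antisymm (fun x hx => ?_) Ideal.map_comap_le
    obtain ⟨k, y, hy⟩ := hT x
    have h1 : i y ∈ (I.comap i).map i :=
      Ideal.mem_map_of_mem i (by rw [Ideal.mem_comap, ← hy]; exact I.mul_mem_left _ hx)
    rw [← one_mul x, ← Ring.inverse_mul_cancel _ (hq.pow k), mul_assoc, hy]
    exact Ideal.mul_mem_left _ _ h1
  obtain ⟨s, hs⟩ := (isNoetherianRing_iff_ideal_fg U).1 ‹_› (I.comap i)
  rw [this, ← hs, Ideal.map_span]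
  exact Submodule.fg_span ((Finset.finite_toSet s).image i)

end CompleteNoetherian

/-- A ring is left noetherian if its left ideals are determined by families of leading terms that
take values in an order with the ascending chain condition. -/
theorem isNoetherianRing_of_leadingTerms {Λ Q B : Type*} [Preorder Λ] [PartialOrder Q]
    [WellFoundedGT Q] [Ring B] [WellQuasiOrderedLE Λ] (L : Ideal B → Λ → Q)
    (hL : Monotone L) (hLI : ∀ I, Monotone (L I)) (hinj : ∀ I J, I ≤ J → L I = L J → I = J) :
    IsNoetherianRing B := by
  rw [isNoetherianRing_iff, isNoetherian_iff', wellFoundedGT_iff_monotone_chain_condition]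
  by_contra! hcon
  obtain ⟨a, ha⟩ := hcon
  choose s hs hne using ha
  let d : ℕ → ℕ := fun n => s^[n] 0
  have hd : ∀ n, d (n + 1) = s (d n) := fun n => Function.iterate_succ_apply' s n 0
  have hdm : Monotone d := monotone_nat_of_le_succ fun n => by rw [hd]; exact hs _
  have hex : ∀ n, ∃ α, L (a (d n)) α < L (a (d (n + 1))) α := by
    intro n
    by_contra! h
    refine hne (d n) ?_
    rw [← hd]
    have hle : a (d n) ≤ a (d (n + 1)) := a.monotone (hdm n.le_succ)
    exact hinj _ _ hle (funext fun α => (hL hle α).eq_of_not_lt (h α))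
  choose α hα using hex
  -- `α n` is an index at which the n-th step of the chain is strict. Along a subsequence where
  -- these indices increase, monotonicity in both arguments yields a strictly increasing sequence in
  -- `Q`.
  obtain ⟨g, hg⟩ := (wellQuasiOrdered_le (α := Λ)).exists_monotone_subseq α
  have hb : StrictMono fun n => L (a (d (g n + 1))) (α (g n)) := by
    refine strictMono_nat_of_lt_succ fun n => ?_
    refine lt_of_le_of_lt ?_ (hα (g (n + 1)))
    exact (hL (a.monotone (hdm (Nat.succ_le_of_lt (g.strictMono n.lt_succ_self)))) _).trans
      (hLI _ (hg _ _ n.le_succ))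
  obtain ⟨n, hn⟩ := WellFoundedGT.monotone_chain_condition ⟨_, hb.monotone⟩
  exact (hb n.lt_succ_self).ne (hn (n + 1) n.le_succ)

/-! ### Almost commutative extensions -/

section AlmostCommutative

theorem degree_add_single_one {r : ℕ} (α : Fin r →₀ ℕ) (j : Fin r) :
    (α + Finsupp.single j 1).degree = α.degree + 1 := by
  rw [map_add, Finsupp.degree_single]

theorem length_toList_toMultiset {r : ℕ} (α : Fin r →₀ ℕ) :
    (Finsupp.toMultiset α).toList.length = α.degree := by
  rw [Multiset.length_toList, Finsupp.card_toMultiset, Finsupp.degree_eq_sum, Finsupp.sum_fintype]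
  · rfl
  · exact fun _ => rfl

variable {C B : Type*} [Ring C] [Ring B]

/-- The ring `B` is generated by the image of `φ` and by the elements `y j`, which commute with the
image of `φ` and with each other up to terms of lower degree. -/
structure IsAlmostPolynomial (φ : C →+* B) {r : ℕ} (y : Fin r → B) : Prop where
  comm_base : ∀ j c, ∃ c', y j * φ c = φ c * y j + φ c'
  comm_gen : ∀ i j, ∃ (c₀ : C) (c : Fin r → C),
    y i * y j = y j * y i + (φ c₀ + ∑ k, φ (c k) * y k)
  generates : ∀ P : Subring B, (∀ c, φ c ∈ P) → (∀ j, y j ∈ P) → P = ⊤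

variable (φ : C →+* B) {r : ℕ} (y : Fin r → B)

/-- The combinations of the words of length at most `n` in the elements `y j`. -/
def wordSpan (n : ℕ) : AddSubgroup B :=
  AddSubgroup.closure {x | ∃ (c : C) (l : List (Fin r)), l.length ≤ n ∧ x = φ c * (l.map y).prod}

theorem wordSpan_mono : Monotone (wordSpan φ y) := fun _ _ h =>
  AddSubgroup.closure_mono fun _ ⟨c, l, hl, hx⟩ => ⟨c, l, hl.trans h, hx⟩

theorem word_mem_wordSpan (c : C) (l : List (Fin r)) :
    φ c * (l.map y).prod ∈ wordSpan φ y l.length :=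
  AddSubgroup.subset_closure ⟨c, l, le_rfl, rfl⟩

theorem base_mul_mem_wordSpan {n : ℕ} (c : C) {x : B} (hx : x ∈ wordSpan φ y n) :
    φ c * x ∈ wordSpan φ y n := by
  induction hx using AddSubgroup.closure_induction with
  | mem x hx =>
    obtain ⟨c', l, hl, rfl⟩ := hx
    exact AddSubgroup.subset_closure ⟨c * c', l, hl, by rw [map_mul, mul_assoc]⟩
  | zero => rw [mul_zero]; exact zero_mem _
  | add x y _ _ hx hy => rw [mul_add]; exact add_mem hx hy
  | neg x _ hx => rw [mul_neg]; exact neg_mem hx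

variable {φ y}

theorem IsAlmostPolynomial.gen_mul_mem (h : IsAlmostPolynomial φ y) {n : ℕ} (j : Fin r) {x : B}
    (hx : x ∈ wordSpan φ y n) :
    y j * x ∈ wordSpan φ y (n + 1) := by
  induction hx using AddSubgroup.closure_induction with
  | mem x hx =>
    obtain ⟨c, l, hl, rfl⟩ := hx
    obtain ⟨c', hc'⟩ := h.comm_base j c
    rw [← mul_assoc, hc', add_mul, mul_assoc]
    exact add_mem
      (AddSubgroup.subset_closure ⟨c, j :: l, by simpa using hl, by simp⟩)
      (AddSubgroup.subset_closure ⟨c', l, hl.trans n.le_succ, rfl⟩)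
  | zero => rw [mul_zero]; exact zero_mem _
  | add x y _ _ hx hy => rw [mul_add]; exact add_mem hx hy
  | neg x _ hx => rw [mul_neg]; exact neg_mem hx

theorem IsAlmostPolynomial.mul_mem (h : IsAlmostPolynomial φ y) {m n : ℕ} {x z : B}
    (hx : x ∈ wordSpan φ y m)
    (hz : z ∈ wordSpan φ y n) : x * z ∈ wordSpan φ y (m + n) := by
  have hw : ∀ l : List (Fin r), (l.map y).prod * z ∈ wordSpan φ y (l.length + n) := by
    intro l
    induction l with
    | nil => simpa using hz
    | cons j l ih =>
      rw [List.map_cons, List.prod_cons, mul_assoc, List.length_cons, Nat.add_right_comm]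
      exact h.gen_mul_mem j ih
  induction hx using AddSubgroup.closure_induction with
  | mem x hx =>
    obtain ⟨c, l, hl, rfl⟩ := hx
    rw [mul_assoc]
    exact base_mul_mem_wordSpan φ y c (wordSpan_mono φ y (Nat.add_le_add_right hl n) (hw l))
  | zero => rw [zero_mul]; exact zero_mem _
  | add x y _ _ hx hy => rw [add_mul]; exact add_mem hx hy
  | neg x _ hx => rw [neg_mul]; exact neg_mem hx

theorem IsAlmostPolynomial.exists_mem_wordSpan (h : IsAlmostPolynomial φ y) (b : B) :
    ∃ n, b ∈ wordSpan φ y n := by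
  let P : Subring B :=
    { carrier := {b | ∃ n, b ∈ wordSpan φ y n}
      mul_mem' := fun ⟨m, hm⟩ ⟨n, hn⟩ => ⟨m + n, h.mul_mem hm hn⟩
      one_mem' := ⟨0, by simpa using word_mem_wordSpan φ y 1 []⟩
      add_mem' := fun ⟨m, hm⟩ ⟨n, hn⟩ => ⟨max m n, add_mem
        (wordSpan_mono φ y (le_max_left _ _) hm) (wordSpan_mono φ y (le_max_right _ _) hn)⟩
      zero_mem' := ⟨0, zero_mem _⟩
      neg_mem' := fun ⟨n, hn⟩ => ⟨n, neg_mem hn⟩ }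
  have : P = ⊤ := h.generates P (fun c => ⟨0, by simpa using word_mem_wordSpan φ y c []⟩)
    fun j => ⟨1, by simpa using word_mem_wordSpan φ y 1 [j]⟩
  exact this.ge (Subring.mem_top b)

/-- Exchanging two adjacent letters replaces the pair by at most one letter in the correction terms.
Truncated subtraction is harmless, since for the empty word the difference is zero. -/
theorem IsAlmostPolynomial.sub_mem_of_perm (h : IsAlmostPolynomial φ y) {l l' : List (Fin r)}
    (hl : l.Perm l') :
    (l.map y).prod - (l'.map y).prod ∈ wordSpan φ y (l.length - 1) := by
  induction hl with
  | nil => simp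
  | cons j hl ih =>
    rename_i l l'
    rw [List.map_cons, List.map_cons, List.prod_cons, List.prod_cons, ← mul_sub,
      List.length_cons, Nat.add_sub_cancel]
    rcases l with _ | ⟨i, l⟩
    · rw [List.nil_perm.1 hl]
      simp
    · exact h.gen_mul_mem j ih
  | swap i j l =>
    obtain ⟨c₀, c, hc⟩ := h.comm_gen j i
    simp only [List.map_cons, List.prod_cons, ← mul_assoc]
    rw [← sub_mul, hc, add_sub_cancel_left, add_mul, Finset.sum_mul]
    refine add_mem (AddSubgroup.subset_closure ⟨c₀, l, by simp, rfl⟩)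
      (sum_mem fun k _ => AddSubgroup.subset_closure ⟨c k, k :: l, by simp, by
        rw [List.map_cons, List.prod_cons, mul_assoc]⟩)
  | trans hl hl' ih ih' =>
    rw [← hl.length_eq] at ih'
    simpa using add_mem ih ih'

/-- The monomial attached to an exponent, with its letters in some order. -/
def mon (y : Fin r → B) (α : Fin r →₀ ℕ) : B := ((Finsupp.toMultiset α).toList.map y).prod

variable (φ y) in
/-- The combinations of the monomials with exponent in `s`. -/
def monSpan (s : Set (Fin r →₀ ℕ)) : AddSubgroup B :=
  AddSubgroup.closure {x | ∃ (c : C) (α : Fin r →₀ ℕ), α ∈ s ∧ x = φ c * mon y α}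

theorem monSpan_mono : Monotone (monSpan φ y) := fun _ _ h =>
  AddSubgroup.closure_mono fun _ ⟨c, α, hα, hx⟩ => ⟨c, α, h hα, hx⟩

theorem base_mul_mem_monSpan {s : Set (Fin r →₀ ℕ)} (c : C) {x : B} (hx : x ∈ monSpan φ y s) :
    φ c * x ∈ monSpan φ y s := by
  induction hx using AddSubgroup.closure_induction with
  | mem x hx =>
    obtain ⟨c', α, hα, rfl⟩ := hx
    exact AddSubgroup.subset_closure ⟨c * c', α, hα, by rw [map_mul, mul_assoc]⟩
  | zero => rw [mul_zero]; exact zero_mem _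
  | add x y _ _ hx hy => rw [mul_add]; exact add_mem hx hy
  | neg x _ hx => rw [mul_neg]; exact neg_mem hx

/-- Rearranging a word into the chosen order of its monomial costs only shorter words, which are
covered by induction. -/
theorem IsAlmostPolynomial.wordSpan_le (h : IsAlmostPolynomial φ y) (n : ℕ) :
    wordSpan φ y n ≤ monSpan φ y {α | α.degree ≤ n} := by
  induction n using Nat.strong_induction_on with
  | _ n ih =>
    refine (AddSubgroup.closure_le _).2 ?_
    rintro _ ⟨c, l, hl, rfl⟩
    let α : Fin r →₀ ℕ := Multiset.toFinsupp (l : Multiset (Fin r))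
    have hα : (Finsupp.toMultiset α).toList.Perm l := by
      rw [← Multiset.coe_eq_coe, Multiset.coe_toList, Multiset.toFinsupp_toMultiset]
    have hdeg : α.degree = l.length := by rw [← length_toList_toMultiset, hα.length_eq]
    have hsub := h.sub_mem_of_perm hα.symm
    rw [SetLike.mem_coe, ← sub_add_cancel (l.map y).prod (mon y α), mul_add]
    refine add_mem (base_mul_mem_monSpan c ?_)
      (AddSubgroup.subset_closure ⟨c, α, hdeg.trans_le hl, rfl⟩)
    rcases l with _ | ⟨j, l⟩
    · have h0 : (Finsupp.toMultiset α).toList = [] := List.perm_nil.1 hα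
      rw [mon, h0, sub_self]
      exact zero_mem _
    · have hlt : l.length < n := lt_of_lt_of_le l.length.lt_succ_self hl
      exact monSpan_mono (fun β (hβ : β.degree ≤ l.length) =>
          show β.degree ≤ n from hβ.trans hlt.le)
        (ih _ hlt hsub)

theorem IsAlmostPolynomial.gen_mul_mon (h : IsAlmostPolynomial φ y) (j : Fin r) (α : Fin r →₀ ℕ) :
    y j * mon y α - mon y (α + Finsupp.single j 1) ∈ wordSpan φ y α.degree := by
  have hp : (j :: (Finsupp.toMultiset α).toList).Perm
      (Finsupp.toMultiset (α + Finsupp.single j 1)).toList := by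
    rw [← Multiset.coe_eq_coe, Multiset.coe_toList, ← Multiset.cons_coe, Multiset.coe_toList,
      map_add, Finsupp.toMultiset_single, one_smul, add_comm, Multiset.singleton_add]
  have := h.sub_mem_of_perm hp
  rwa [List.length_cons, Nat.add_sub_cancel, length_toList_toMultiset, List.map_cons,
    List.prod_cons] at this

variable (φ y) in
/-- The combinations of the monomials whose exponent precedes `α` in the degree-lexicographic
order. -/
def lowSpan (α : Fin r →₀ ℕ) : AddSubgroup B := monSpan φ y {β | toDegLex β < toDegLex α}

theorem toDegLex_lt_of_degree_lt {α β : Fin r →₀ ℕ} (h : α.degree < β.degree) :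
    toDegLex α < toDegLex β :=
  Finsupp.DegLex.lt_iff.2 (Or.inl h)

theorem degree_le_of_toDegLex_lt {α β : Fin r →₀ ℕ} (h : toDegLex α < toDegLex β) :
    α.degree ≤ β.degree :=
  Finsupp.DegLex.monotone_degree h.le

/-- The reason for a graded monomial order: the corrections from commutation have smaller degree and
so never reach the leading term. -/
theorem IsAlmostPolynomial.wordSpan_le_lowSpan (h : IsAlmostPolynomial φ y) {n : ℕ}
    {α : Fin r →₀ ℕ} (hn : n < α.degree) :
    wordSpan φ y n ≤ lowSpan φ y α :=
  (h.wordSpan_le n).trans (monSpan_mono fun _ hβ =>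
    toDegLex_lt_of_degree_lt (lt_of_le_of_lt hβ hn))

/-- Since `y j` commutes with `φ c` up to an element of the base, left multiplication by it keeps
the leading coefficient. -/
theorem IsAlmostPolynomial.gen_mul_term (h : IsAlmostPolynomial φ y) (j : Fin r) (c : C)
    (α : Fin r →₀ ℕ) :
    y j * (φ c * mon y α) - φ c * mon y (α + Finsupp.single j 1) ∈ wordSpan φ y α.degree := by
  obtain ⟨c', hc'⟩ := h.comm_base j c
  rw [← mul_assoc, hc', add_mul, mul_assoc, add_sub_right_comm, ← mul_sub]
  refine add_mem (base_mul_mem_wordSpan φ y c (h.gen_mul_mon j α)) ?_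
  rw [← length_toList_toMultiset]
  exact word_mem_wordSpan φ y c' _

theorem IsAlmostPolynomial.gen_mul_lowSpan (h : IsAlmostPolynomial φ y) (j : Fin r)
    {α : Fin r →₀ ℕ} {x : B}
    (hx : x ∈ lowSpan φ y α) : y j * x ∈ lowSpan φ y (α + Finsupp.single j 1) := by
  induction hx using AddSubgroup.closure_induction with
  | mem x hx =>
    obtain ⟨c, β, hβ, rfl⟩ := hx
    rw [← sub_add_cancel (y j * (φ c * mon y β)) (φ c * mon y (β + Finsupp.single j 1))]
    refine add_mem (h.wordSpan_le_lowSpan ?_ (h.gen_mul_term j c β))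
      (AddSubgroup.subset_closure ⟨c, _, ?_, rfl⟩)
    · rw [degree_add_single_one]
      exact Nat.lt_succ_of_le (degree_le_of_toDegLex_lt hβ)
    · exact add_lt_add_left (α := DegLex (Fin r →₀ ℕ)) hβ _
  | zero => rw [mul_zero]; exact zero_mem _
  | add x y _ _ hx hy => rw [mul_add]; exact add_mem hx hy
  | neg x _ hx => rw [mul_neg]; exact neg_mem hx

variable (φ y) in
/-- The leading coefficients in degree `α` of the elements of a left ideal. -/
def leadIdeal (I : Ideal B) (α : Fin r →₀ ℕ) : Ideal C where
  carrier := {c | ∃ x ∈ lowSpan φ y α, φ c * mon y α + x ∈ I}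
  add_mem' := by
    rintro c c' ⟨x, hx, hI⟩ ⟨x', hx', hI'⟩
    refine ⟨x + x', add_mem hx hx', ?_⟩
    rw [map_add, add_mul, add_add_add_comm]
    exact I.add_mem hI hI'
  zero_mem' := ⟨0, zero_mem _, by simp⟩
  smul_mem' := by
    rintro d c ⟨x, hx, hI⟩
    refine ⟨φ d * x, base_mul_mem_monSpan d hx, ?_⟩
    rw [smul_eq_mul, map_mul, mul_assoc, ← mul_add]
    exact I.mul_mem_left _ hI

/-- Left multiplication by `y j` shifts the leading exponent by one unit vector, strictly preserves
the order of the lower terms and leaves the coefficient alone. -/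
theorem IsAlmostPolynomial.leadIdeal_le_add (h : IsAlmostPolynomial φ y) (I : Ideal B)
    (γ : Fin r →₀ ℕ) :
    ∀ α, leadIdeal φ y I α ≤ leadIdeal φ y I (α + γ) := by
  induction γ using Finsupp.induction_linear with
  | zero => exact fun α => by rw [add_zero]
  | add γ γ' hγ hγ' => exact fun α => by rw [← add_assoc]; exact (hγ α).trans (hγ' _)
  | single j n =>
    induction n with
    | zero => exact fun α => by rw [Finsupp.single_zero, add_zero]
    | succ n ih =>
      intro α
      rw [Finsupp.single_add, ← add_assoc]
      refine (ih α).trans ?_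
      generalize α + Finsupp.single j n = β
      rintro c ⟨x, hx, hI⟩
      refine ⟨y j * (φ c * mon y β + x) - φ c * mon y (β + Finsupp.single j 1), ?_, ?_⟩
      · rw [mul_add, add_sub_right_comm]
        refine add_mem (h.wordSpan_le_lowSpan ?_ (h.gen_mul_term j c β)) (h.gen_mul_lowSpan j hx)
        rw [degree_add_single_one]
        exact Nat.lt_succ_self _
      · rw [add_sub_cancel]
        exact I.mul_mem_left _ hI

/-- The monomials need not be linearly independent over `C`, so there is no leading exponent as
such; a largest exponent in some representation is enough. -/
theorem eq_zero_or_exists_of_mem_monSpan {s : Set (Fin r →₀ ℕ)} {x : B}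
    (hx : x ∈ monSpan φ y s) :
    x = 0 ∨ ∃ β ∈ s, x ∈ monSpan φ y {γ | toDegLex γ ≤ toDegLex β} := by
  induction hx using AddSubgroup.closure_induction with
  | mem x hx =>
    obtain ⟨c, α, hα, rfl⟩ := hx
    exact Or.inr ⟨α, hα, AddSubgroup.subset_closure ⟨c, α, le_refl (toDegLex α), rfl⟩⟩
  | zero => exact Or.inl rfl
  | add x z _ _ hx hz =>
    rcases hx with rfl | ⟨β, hβ, hx⟩
    · rwa [zero_add]
    rcases hz with rfl | ⟨β', hβ', hz⟩
    · exact Or.inr ⟨β, hβ, by rwa [add_zero]⟩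
    right
    rcases le_total (toDegLex β) (toDegLex β') with hle | hle
    · exact ⟨β', hβ', add_mem (monSpan_mono (fun γ hγ => le_trans hγ hle) hx) hz⟩
    · exact ⟨β, hβ, add_mem hx (monSpan_mono (fun γ hγ => le_trans hγ hle) hz)⟩
  | neg x _ hx =>
    rcases hx with rfl | ⟨β, hβ, hx⟩
    · exact Or.inl neg_zero
    · exact Or.inr ⟨β, hβ, neg_mem hx⟩

theorem exists_leading_of_mem_monSpan {α : Fin r →₀ ℕ} {x : B}
    (hx : x ∈ monSpan φ y {γ | toDegLex γ ≤ toDegLex α}) :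
    ∃ c, ∃ z ∈ lowSpan φ y α, x = φ c * mon y α + z := by
  induction hx using AddSubgroup.closure_induction with
  | mem x hx =>
    obtain ⟨c, β, hβ, rfl⟩ := hx
    rcases (show toDegLex β ≤ toDegLex α from hβ).eq_or_lt with heq | hlt
    · exact ⟨c, 0, zero_mem _, by rw [toDegLex_inj.1 heq, add_zero]⟩
    · exact ⟨0, _, AddSubgroup.subset_closure ⟨c, β, hlt, rfl⟩, by simp⟩
  | zero => exact ⟨0, 0, zero_mem _, by simp⟩
  | add x x' _ _ hx hx' =>
    obtain ⟨c, z, hz, rfl⟩ := hx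
    obtain ⟨c', z', hz', rfl⟩ := hx'
    exact ⟨c + c', z + z', add_mem hz hz', by rw [map_add, add_mul, add_add_add_comm]⟩
  | neg x _ hx =>
    obtain ⟨c, z, hz, rfl⟩ := hx
    exact ⟨-c, -z, neg_mem hz, by rw [map_neg, neg_mul, neg_add]⟩

/-- Division algorithm: an element of `I` with the same leading term is subtracted, and the
difference lies in `J` and involves only smaller exponents. The degree-lexicographic order is
well-founded. -/
theorem mem_of_leadIdeal_eq {I J : Ideal B} (hIJ : I ≤ J)
    (hlead : leadIdeal φ y I = leadIdeal φ y J) (α : DegLex (Fin r →₀ ℕ)) :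
    ∀ x ∈ J, x ∈ monSpan φ y {γ | toDegLex γ ≤ α} → x ∈ I := by
  induction α using WellFoundedLT.induction with
  | _ α ih =>
    intro x hxJ hx
    obtain ⟨c, z, hz, rfl⟩ := exists_leading_of_mem_monSpan (α := ofDegLex α) hx
    have hc : c ∈ leadIdeal φ y J (ofDegLex α) := ⟨z, hz, hxJ⟩
    rw [← hlead] at hc
    obtain ⟨w, hw, hwI⟩ := hc
    have hzw : z - w ∈ I := by
      have hJ : z - w ∈ J := by
        have := J.sub_mem hxJ (hIJ hwI)
        rwa [add_sub_add_left_eq_sub] at this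
      rcases eq_zero_or_exists_of_mem_monSpan (sub_mem hz hw) with h0 | ⟨β, hβ, hm⟩
      · rw [h0]
        exact I.zero_mem
      · exact ih (toDegLex β) hβ _ hJ hm
    rw [← sub_add_cancel z w, add_left_comm]
    exact I.add_mem hzw hwI

/-- An almost polynomial extension of a left noetherian ring is left noetherian. -/
theorem IsAlmostPolynomial.isNoetherianRing [IsNoetherianRing C] (h : IsAlmostPolynomial φ y) :
    IsNoetherianRing B := by
  have : WellFoundedGT (Ideal C) := isNoetherian_iff'.1 ‹_›
  refine isNoetherianRing_of_leadingTerms (Λ := Fin r →₀ ℕ) (leadIdeal φ y)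
    (fun I J hIJ α c ⟨x, hx, hI⟩ => ⟨x, hx, hIJ hI⟩) (fun I α β hαβ => ?_)
    fun I J hIJ hlead => le_antisymm hIJ fun x hx => ?_
  · obtain ⟨γ, rfl⟩ := exists_add_of_le hαβ
    exact h.leadIdeal_le_add I γ α
  · obtain ⟨n, hn⟩ := h.exists_mem_wordSpan x
    rcases eq_zero_or_exists_of_mem_monSpan (h.wordSpan_le n hn) with rfl | ⟨β, -, hm⟩
    · exact I.zero_mem
    · exact mem_of_leadIdeal_eq hIJ hlead (toDegLex β) x hx hm

theorem IsAlmostPolynomial.op (h : IsAlmostPolynomial φ y) :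
    IsAlmostPolynomial (RingHom.op φ) fun j => MulOpposite.op (y j) where
  comm_base j c := by
    obtain ⟨c', hc'⟩ := h.comm_base j c.unop
    refine ⟨MulOpposite.op (-c'), MulOpposite.unop_injective ?_⟩
    change φ c.unop * y j = y j * φ c.unop + φ (-c')
    rw [hc', map_neg, add_neg_cancel_right]
  comm_gen i j := by
    obtain ⟨c₀, c, hc⟩ := h.comm_gen j i
    choose d hd using fun k => h.comm_base k (c k)
    -- Moving each coefficient `c k` to the right of `y k` produces a correction `d k`, absorbed
    -- into the constant term.
    refine ⟨MulOpposite.op (c₀ - ∑ k, d k), fun k => MulOpposite.op (c k),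
      MulOpposite.unop_injective ?_⟩
    have hs : MulOpposite.unop (∑ k, (RingHom.op φ) (MulOpposite.op (c k)) * MulOpposite.op (y k)) =
        ∑ k, y k * φ (c k) := Finset.unop_sum _ _
    rw [MulOpposite.unop_add, MulOpposite.unop_add, hs]
    change y j * y i = y i * y j + (φ (c₀ - ∑ k, d k) + _)
    simp only [hc, hd, Finset.sum_add_distrib, map_sub, map_sum]
    abel
  generates P hφ hy := by
    have := h.generates P.unop (fun c => hφ (MulOpposite.op c)) hy
    rw [← Subring.op_unop P, this, Subring.op_top]

end AlmostCommutative

/-! ### Properties of the `ϖ`-adic completion -/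

section PiCompletion

variable {R : Type*} [CommRing R] {ϖ : R} {B : Type*} [Ring B] [Algebra R B]

theorem mem_powIdeal_iff {k : ℕ} {b : B} : b ∈ powIdeal ϖ B k ↔ ∃ c : B, b = ϖ ^ k • c := by
  rw [powIdeal, Ideal.mem_span_singleton']
  exact exists_congr fun c => by rw [← Algebra.commutes, ← Algebra.smul_def, eq_comm]

theorem mk_powIdeal_eq_iff {k : ℕ} {b c : B} :
    Ideal.Quotient.mk (powIdeal ϖ B k) b = Ideal.Quotient.mk (powIdeal ϖ B k) c ↔
      ∃ d : B, b = c + ϖ ^ k • d := by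
  rw [Ideal.Quotient.eq, mem_powIdeal_iff]
  exact exists_congr fun d => sub_eq_iff_eq_add'

/-- The component of an element of the completion modulo `ϖ ^ k`. -/
def piComponent (k : ℕ) : PiCompletion ϖ B →ₐ[R] B ⧸ powIdeal ϖ B k :=
  (Pi.evalAlgHom R _ k).comp (piCompletionSub ϖ B).val

/-- The element of the completion defined by a compatible family. -/
def piMk (x : ∀ k, B ⧸ powIdeal ϖ B k) (hx : ∀ k l (h : k ≤ l), powProj ϖ B h (x l) = x k) :
    PiCompletion ϖ B :=
  (⟨x, hx⟩ : piCompletionSub ϖ B)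

theorem piComponent_piMk (x : ∀ k, B ⧸ powIdeal ϖ B k)
    (hx : ∀ k l (h : k ≤ l), powProj ϖ B h (x l) = x k) (k : ℕ) :
    piComponent k (piMk x hx) = x k := rfl

theorem piComponent_toPiCompletion (k : ℕ) (b : B) :
    piComponent k (toPiCompletion ϖ B b) = Ideal.Quotient.mk (powIdeal ϖ B k) b := rfl

theorem piComponent_ext {x y : PiCompletion ϖ B} (h : ∀ k, piComponent k x = piComponent k y) :
    x = y := Subtype.ext (funext h)

theorem powProj_piComponent (x : PiCompletion ϖ B) {k l : ℕ} (h : k ≤ l) :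
    powProj ϖ B h (piComponent l x) = piComponent k x := x.2 k l h

theorem powProj_mk {k l : ℕ} (h : k ≤ l) (b : B) :
    powProj ϖ B h (Ideal.Quotient.mk (powIdeal ϖ B l) b) = Ideal.Quotient.mk (powIdeal ϖ B k) b :=
  rfl

theorem piComponent_pow_smul (k : ℕ) (x : PiCompletion ϖ B) : piComponent k (ϖ ^ k • x) = 0 := by
  obtain ⟨b, hb⟩ := Ideal.Quotient.mk_surjective (piComponent k x)
  rw [map_smul, ← hb, ← Ideal.Quotient.mkₐ_eq_mk R, ← map_smul, Ideal.Quotient.mkₐ_eq_mk,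
    Ideal.Quotient.eq_zero_iff_mem]
  exact mem_powIdeal_iff.2 ⟨b, rfl⟩

theorem mk_pow_smul (k l : ℕ) (b : B) :
    Ideal.Quotient.mk (powIdeal ϖ B l) (ϖ ^ k • b) =
      ϖ ^ k • Ideal.Quotient.mk (powIdeal ϖ B l) b := rfl

theorem pow_smul_eq_zero (htf : ∀ b : B, ϖ • b = 0 → b = 0) (k : ℕ) {b : B}
    (h : ϖ ^ k • b = 0) : b = 0 := by
  induction k with
  | zero => simpa using h
  | succ k ih =>
    rw [pow_succ', mul_smul] at h
    exact ih (htf _ h)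

/-- The component of `z` at level k + l has a representative divisible by ϖ^k. Without ϖ-torsion the
quotients agree modulo ϖ^l, so they form an element of the completion. -/
theorem exists_eq_pow_smul_of_piComponent (htf : ∀ b : B, ϖ • b = 0 → b = 0) {k : ℕ}
    {z : PiCompletion ϖ B} (hz : piComponent k z = 0) : ∃ u, z = ϖ ^ k • u := by
  have hc : ∀ l, ∃ c : B, Ideal.Quotient.mk (powIdeal ϖ B (k + l)) (ϖ ^ k • c) =
      piComponent (k + l) z := fun l => by
    obtain ⟨b, hb⟩ := Ideal.Quotient.mk_surjective (piComponent (k + l) z)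
    have h0 : Ideal.Quotient.mk (powIdeal ϖ B k) b = 0 := by
      rw [← hz, ← powProj_piComponent z (Nat.le_add_right k l), ← hb, powProj_mk]
    obtain ⟨c, rfl⟩ := mem_powIdeal_iff.1 (Ideal.Quotient.eq_zero_iff_mem.1 h0)
    exact ⟨c, hb⟩
  choose c hc using hc
  refine ⟨piMk (fun l => Ideal.Quotient.mk _ (c l)) fun l m h => ?_,
    piComponent_ext fun l => ?_⟩
  · rw [powProj_mk, mk_powIdeal_eq_iff]
    have h1 : Ideal.Quotient.mk (powIdeal ϖ B (k + l)) (ϖ ^ k • c m) =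
        Ideal.Quotient.mk (powIdeal ϖ B (k + l)) (ϖ ^ k • c l) := by
      rw [hc l, ← powProj_piComponent z (Nat.add_le_add_left h k), ← hc m, powProj_mk]
    obtain ⟨d, hd⟩ := mk_powIdeal_eq_iff.1 h1
    refine ⟨d, sub_eq_zero.1 (pow_smul_eq_zero htf k ?_)⟩
    rw [smul_sub, smul_add, hd, smul_smul, ← pow_add, sub_self]
  · rw [map_smul, piComponent_piMk, ← mk_pow_smul, ← powProj_piComponent z (Nat.le_add_left l k),
      ← hc l, powProj_mk]

theorem exists_eq_toPiCompletion_add (htf : ∀ b : B, ϖ • b = 0 → b = 0) (k : ℕ)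
    (x : PiCompletion ϖ B) : ∃ b u, x = toPiCompletion ϖ B b + ϖ ^ k • u := by
  obtain ⟨b, hb⟩ := Ideal.Quotient.mk_surjective (piComponent k x)
  obtain ⟨u, hu⟩ := exists_eq_pow_smul_of_piComponent htf (k := k)
    (z := x - toPiCompletion ϖ B b) (by
      rw [map_sub, piComponent_toPiCompletion, hb, sub_self])
  exact ⟨b, u, by rw [← hu, add_sub_cancel]⟩

theorem exists_eq_pow_smul_of_toPiCompletion {k : ℕ} {b : B} {u : PiCompletion ϖ B}
    (h : toPiCompletion ϖ B b = ϖ ^ k • u) : ∃ c : B, b = ϖ ^ k • c := by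
  have h1 := congrArg (piComponent k) h
  rw [piComponent_pow_smul, piComponent_toPiCompletion, Ideal.Quotient.eq_zero_iff_mem] at h1
  exact mem_powIdeal_iff.1 h1

theorem piCompletion_torsionFree (htf : ∀ b : B, ϖ • b = 0 → b = 0) (u : PiCompletion ϖ B)
    (hu : ϖ • u = 0) : u = 0 := by
  refine piComponent_ext fun k => ?_
  -- Cancelling ϖ loses one level of precision, so the k-th component is read off from level k + 1.
  obtain ⟨b, hb⟩ := Ideal.Quotient.mk_surjective (piComponent (k + 1) u)
  have h1 : Ideal.Quotient.mk (powIdeal ϖ B (k + 1)) (ϖ • b) = 0 := by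
    have := congrArg (piComponent (k + 1)) hu
    rw [map_smul, ← hb, map_zero] at this
    exact this
  obtain ⟨c, hc⟩ := mem_powIdeal_iff.1 (Ideal.Quotient.eq_zero_iff_mem.1 h1)
  have h2 : b = ϖ ^ k • c := sub_eq_zero.1 (htf _ (by
    rw [smul_sub, hc, smul_smul, ← pow_succ', sub_self]))
  rw [map_zero, ← powProj_piComponent u k.le_succ, ← hb, powProj_mk,
    Ideal.Quotient.eq_zero_iff_mem]
  exact mem_powIdeal_iff.2 ⟨c, h2⟩

theorem isCentralComplete_piCompletion (htf : ∀ b : B, ϖ • b = 0 → b = 0) :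
    IsCentralComplete (algebraMap R (PiCompletion ϖ B) ϖ) where
  comm x := Algebra.commutes ϖ x
  separated x hx := piComponent_ext fun k => by
    obtain ⟨y, hy⟩ := hx k
    rw [hy, ← map_pow, ← Algebra.smul_def, piComponent_pow_smul, map_zero]
  complete c := by
    -- At level `k` the terms of the series of index at least `k` vanish, so its partial sums define
    -- a compatible family.
    have hcoh : ∀ k l (h : k ≤ l),
        powProj ϖ B h (∑ i ∈ Finset.range l, piComponent l (ϖ ^ i • c i)) =
          ∑ i ∈ Finset.range k, piComponent k (ϖ ^ i • c i) := by
      intro k l h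
      rw [map_sum]
      simp only [powProj_piComponent]
      refine (Finset.sum_subset (Finset.range_mono h) fun i _ hi => ?_).symm
      have hki : k ≤ i := by simpa using hi
      rw [← powProj_piComponent _ hki, piComponent_pow_smul, map_zero]
    refine ⟨piMk _ hcoh, fun k => ?_⟩
    obtain ⟨y, hy⟩ := exists_eq_pow_smul_of_piComponent htf (k := k)
      (z := piMk _ hcoh - ∑ i ∈ Finset.range k, ϖ ^ i • c i) (by
        rw [map_sub, map_sum, piComponent_piMk, sub_self])
    refine ⟨y, ?_⟩
    simp only [← map_pow, ← Algebra.smul_def]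
    rw [← hy, add_sub_cancel]

end PiCompletion

/-! ### Properties of the normed algebras defined by a lattice -/

/-! ### The uniform structure of a single seminorm. -/

section SeminormUniformity

variable {K : Type*} {V : Type*} [NormedField K] [AddCommGroup V] [Module K V]

theorem isUniformAddGroup_seminormUniformity (q : Seminorm K V) :
    @IsUniformAddGroup V (seminormUniformity q) _ :=
  q.toAddGroupSeminorm.toSeminormedAddCommGroup.to_isUniformAddGroup

theorem hasBasis_uniformity_seminorm (q : Seminorm K V) :
    (@uniformity V (seminormUniformity q)).HasBasis (0 < ·)
      fun ε => {x : V × V | q (x.1 - x.2) < ε} := by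
  let _ := q.toAddGroupSeminorm.toSeminormedAddCommGroup
  have := Metric.uniformity_basis_dist (α := V)
  simp only [dist_eq_norm] at this
  exact this

theorem hasBasis_nhds_seminorm (q : Seminorm K V) (x : V) :
    (@nhds V (seminormUniformity q).toTopologicalSpace x).HasBasis (0 < ·)
      fun ε => {y : V | q (y - x) < ε} := by
  let _ := q.toAddGroupSeminorm.toSeminormedAddCommGroup
  have h : (fun ε => Metric.ball x ε) = fun ε => {y : V | q (y - x) < ε} := by
    ext ε y
    rw [Metric.mem_ball, dist_eq_norm]
    rfl
  rw [← h]
  exact Metric.nhds_basis_ball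

theorem continuous_seminormUniformity (q : Seminorm K V) :
    @Continuous V ℝ (seminormUniformity q).toTopologicalSpace _ q := by
  let _ := q.toAddGroupSeminorm.toSeminormedAddCommGroup
  exact continuous_norm (E := V)

theorem seminormUniformity_le {q q' : Seminorm K V} {C : ℝ} (hC : 0 < C)
    (h : ∀ x, q x ≤ C * q' x) : seminormUniformity q' ≤ seminormUniformity q := by
  refine ((hasBasis_uniformity_seminorm q').le_basis_iff (hasBasis_uniformity_seminorm q)).2
    fun ε hε => ⟨ε / C, div_pos hε hC, fun x hx => ?_⟩
  have h1 : q' (x.1 - x.2) < ε / C := hx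
  exact (h _).trans_lt (by rwa [lt_div_iff₀' hC] at h1)

theorem seminormUniformity_comap {W : Type*} [AddCommGroup W] [Module K W] (q : Seminorm K V)
    (q' : Seminorm K W) (f : W →+ V) (h : ∀ x, q' x = q (f x)) :
    seminormUniformity q' = UniformSpace.comap f (seminormUniformity q) := by
  ext1
  refine (hasBasis_uniformity_seminorm q').eq_of_same_basis ?_
  rw [uniformity_comap]
  convert (hasBasis_uniformity_seminorm q).comap (Prod.map f f) using 2
  ext x
  change q' (x.1 - x.2) < _ ↔ q (f x.1 - f x.2) < _
  rw [h, map_sub]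

end SeminormUniformity

/-! ### Gauge seminorms of lattices: submultiplicativity, separation and completeness. -/

section LatticeAlg

variable {R K : Type*} [CommRing R] [NormedField K] [Algebra R K]

theorem norm_algebraMap_le_one [IsUnitBall R K] (r : R) : ‖algebraMap R K r‖ ≤ 1 :=
  (IsUnitBall.norm_le_one_iff _).2 ⟨r, rfl⟩

theorem algebraMap_irreducible_ne_zero [IsDomain R] [IsFractionRing R K] {ϖ : R}
    (hϖ : Irreducible ϖ) : algebraMap R K ϖ ≠ 0 := by
  rw [Ne, IsFractionRing.to_map_eq_zero_iff]
  exact hϖ.ne_zero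

/-- With norm 1, the inverse of ϖ would also lie in the unit ball `R`, making ϖ a unit. -/
theorem norm_irreducible_lt_one [IsDomain R] [IsFractionRing R K] [IsUnitBall R K] {ϖ : R}
    (hϖ : Irreducible ϖ) : ‖algebraMap R K ϖ‖ < 1 := by
  refine (norm_algebraMap_le_one ϖ).lt_of_ne fun h => hϖ.not_isUnit ?_
  obtain ⟨s, hs⟩ := (IsUnitBall.norm_le_one_iff (R := R) (algebraMap R K ϖ)⁻¹).1 (by
    rw [norm_inv, h, inv_one])
  refine .of_mul_eq_one s (IsFractionRing.injective R K ?_)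
  rw [map_mul, hs, map_one, mul_inv_cancel₀ (algebraMap_irreducible_ne_zero hϖ)]

variable {B : Type*} [Ring B] [Algebra R B]

theorem latticeSeminorm_smul_le [IsUnitBall R K] (c : K) (b : B) :
    latticeSeminorm R K B (c • latticeIncl R K B b) ≤ ‖c‖ :=
  csInf_le (gaugeSet_bddBelow R K B _) ⟨c, b, rfl, rfl⟩

theorem exists_of_latticeSeminorm_lt [IsUnitBall R K] {v : LatticeAlg R K B} {r : ℝ}
    (h : latticeSeminorm R K B v < r) :
    ∃ (c : K) (b : B), v = c • latticeIncl R K B b ∧ ‖c‖ < r := by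
  obtain ⟨_, ⟨c, b, hv, rfl⟩, hc⟩ := exists_lt_of_csInf_lt (gaugeSet_nonempty R K B v) h
  exact ⟨c, b, hv, hc⟩

theorem exists_of_latticeSeminorm_lt_norm [IsUnitBall R K] {v : LatticeAlg R K B} {d : K}
    (h : latticeSeminorm R K B v < ‖d‖) : ∃ b : B, v = d • latticeIncl R K B b := by
  obtain ⟨c, b, rfl, hc⟩ := exists_of_latticeSeminorm_lt h
  obtain ⟨b', hb'⟩ := exists_common R K B d c 0 b hc.le
  exact ⟨b', by rw [← hb', map_zero, smul_zero, zero_add]⟩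

theorem latticeSeminorm_add_le [IsUnitBall R K] (v w : LatticeAlg R K B) :
    latticeSeminorm R K B (v + w) ≤ max (latticeSeminorm R K B v) (latticeSeminorm R K B w) := by
  refine le_of_forall_gt fun r hr => ?_
  obtain ⟨s, hs, hs'⟩ := exists_lt_of_csInf_lt (gaugeSet_nonempty R K B v) (max_lt_iff.1 hr).1
  obtain ⟨t, ht, ht'⟩ := exists_lt_of_csInf_lt (gaugeSet_nonempty R K B w) (max_lt_iff.1 hr).2
  exact (csInf_le (gaugeSet_bddBelow R K B _)
    (exists_add_mem_gaugeSet R K B hs ht)).trans_lt (max_lt hs' ht')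

theorem latticeSeminorm_mul_le [IsUnitBall R K] (v w : LatticeAlg R K B) :
    latticeSeminorm R K B (v * w) ≤ latticeSeminorm R K B v * latticeSeminorm R K B w := by
  have hpos : ∀ v : LatticeAlg R K B, 0 ≤ latticeSeminorm R K B v := fun v => apply_nonneg _ v
  refine le_of_forall_pos_lt_add fun ε hε => ?_
  -- The infima are not known to be attained, so both factors are enlarged by a small `δ`.
  obtain ⟨δ, hδ, hδε⟩ : ∃ δ > 0, (latticeSeminorm R K B v + δ) * (latticeSeminorm R K B w + δ) <
      latticeSeminorm R K B v * latticeSeminorm R K B w + ε := by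
    have hcont : Filter.Tendsto (fun δ : ℝ => (latticeSeminorm R K B v + δ) *
        (latticeSeminorm R K B w + δ)) (𝓝[>] 0)
        (𝓝 (latticeSeminorm R K B v * latticeSeminorm R K B w)) := by
      refine tendsto_nhdsWithin_of_tendsto_nhds ?_
      have : Continuous fun δ : ℝ => (latticeSeminorm R K B v + δ) *
        (latticeSeminorm R K B w + δ) := by fun_prop
      simpa using this.tendsto 0
    obtain ⟨δ, h1, h2⟩ := ((hcont.eventually (gt_mem_nhds (lt_add_of_pos_right _ hε))).and
      self_mem_nhdsWithin).exists
    exact ⟨δ, h2, h1⟩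
  obtain ⟨c, b, hv, hc⟩ := exists_of_latticeSeminorm_lt (lt_add_of_pos_right
    (latticeSeminorm R K B v) hδ)
  obtain ⟨d, b', hw, hd⟩ := exists_of_latticeSeminorm_lt (lt_add_of_pos_right
    (latticeSeminorm R K B w) hδ)
  have h1 : v * w = (c * d) • latticeIncl R K B (b * b') := by
    rw [hv, hw, smul_mul_smul_comm, map_mul]
  have h2 : latticeSeminorm R K B (v * w) ≤ ‖c‖ * ‖d‖ := by
    rw [h1, ← norm_mul]
    exact latticeSeminorm_smul_le _ _
  exact h2.trans_lt (lt_of_le_of_lt (mul_le_mul hc.le hd.le (norm_nonneg _)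
    (add_nonneg (hpos _) hδ.le)) hδε)

variable (R K B) in
/-- The gauge seminorm of a lattice, as a submultiplicative nonarchimedean seminorm. -/
def latticeAlgSeminorm [IsUnitBall R K] : AlgSeminorm K (LatticeAlg R K B) where
  toSeminorm := latticeSeminorm R K B
  add_le_max' := latticeSeminorm_add_le
  mul_le' := latticeSeminorm_mul_le

theorem latticeSeminorm_latticeMap_le [IsUnitBall R K] {C : Type*} [Ring C] [Algebra R C]
    (f : B →ₐ[R] C) (v : LatticeAlg R K B) :
    latticeSeminorm R K C (latticeMap R K f v) ≤ latticeSeminorm R K B v := by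
  refine le_of_forall_gt fun r hr => ?_
  obtain ⟨c, b, rfl, hc⟩ := exists_of_latticeSeminorm_lt hr
  rw [map_smul, latticeMap_latticeIncl]
  exact (latticeSeminorm_smul_le _ _).trans_lt hc

theorem exists_pow_smul_eq_latticeIncl [IsDomain R] [IsFractionRing R K] [IsUnitBall R K] {ϖ : R}
    (hϖ : Irreducible ϖ) (v : LatticeAlg R K B) :
    ∃ (k : ℕ) (b : B), algebraMap R K ϖ ^ k • v = latticeIncl R K B b := by
  obtain ⟨_, c, b, rfl, -⟩ := gaugeSet_nonempty R K B v
  have hlim := (tendsto_pow_atTop_nhds_zero_of_lt_one (norm_nonneg _)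
    (norm_irreducible_lt_one (K := K) hϖ)).mul_const ‖c‖
  rw [zero_mul] at hlim
  obtain ⟨k, hk⟩ := (hlim.eventually (gt_mem_nhds one_pos)).exists
  obtain ⟨r, hr⟩ := (IsUnitBall.norm_le_one_iff (R := R) (algebraMap R K ϖ ^ k * c)).1 (by
    rw [norm_mul, norm_pow]
    exact hk.le)
  exact ⟨k, r • b, by rw [latticeIncl_smul, hr, smul_smul]⟩

/-- The kernel of a localization map is torsion, and every nonzero element of `R` is a unit times a
power of ϖ. -/
theorem latticeIncl_injective [IsDomain R] [IsDiscreteValuationRing R] [IsFractionRing R K] {ϖ : R}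
    (hϖ : Irreducible ϖ) (htf : ∀ b : B, ϖ • b = 0 → b = 0) :
    Function.Injective (latticeIncl R K B) := by
  rw [injective_iff_map_eq_zero]
  intro b hb
  have hb' : TensorProduct.mk R K B 1 b = 0 := hb
  obtain ⟨s, hs⟩ := (IsLocalizedModule.eq_zero_iff (nonZeroDivisors R)
    (TensorProduct.mk R K B 1)).1 hb'
  obtain ⟨n, u, hu⟩ := IsDiscreteValuationRing.eq_unit_mul_pow_irreducible
    (nonZeroDivisors.ne_zero s.2) hϖ
  refine pow_smul_eq_zero htf n ?_
  rw [Submonoid.smul_def, hu, mul_smul] at hs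
  exact (IsUnit.smul_eq_zero u.isUnit).1 hs

instance [IsUnitBall R K] : IsUniformAddGroup (LatticeAlg R K B) :=
  isUniformAddGroup_seminormUniformity _

instance [IsUnitBall R K] : IsTopologicalRing (LatticeAlg R K B) := by
  let _ : SeminormedRing (LatticeAlg R K B) :=
    { (latticeSeminorm R K B).toAddGroupSeminorm.toSeminormedAddCommGroup,
      (inferInstance : Ring (LatticeAlg R K B)) with
      norm_mul_le := latticeSeminorm_mul_le }
  exact (inferInstance : IsTopologicalRing (LatticeAlg R K B))

theorem continuous_latticeMap [IsUnitBall R K] {C : Type*} [Ring C] [Algebra R C]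
    (f : B →ₐ[R] C) : Continuous (latticeMap R K f) := by
  refine continuous_of_continuousAt_zero (latticeMap R K f) ?_
  rw [ContinuousAt, map_zero]
  refine ((hasBasis_nhds_seminorm _ _).tendsto_iff (hasBasis_nhds_seminorm _ _)).2
    fun ε hε => ⟨ε, hε, fun x hx => ?_⟩
  simp only [sub_zero, Set.mem_ofPred_eq] at hx ⊢
  exact (latticeSeminorm_latticeMap_le f x).trans_lt hx

variable [IsDomain R] [IsFractionRing R K] [IsUnitBall R K] {ϖ : R}

theorem t2Space_latticeAlg [IsDiscreteValuationRing R] (hϖ : Irreducible ϖ)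
    (hB : IsCentralComplete (algebraMap R B ϖ)) (htf : ∀ b : B, ϖ • b = 0 → b = 0) :
    T2Space (LatticeAlg R K B) := by
  have hpos := norm_pos_iff.2 (algebraMap_irreducible_ne_zero (K := K) hϖ)
  -- After scaling into `B`, a vector of seminorm zero is divisible by every power of ϖ.
  have key : ∀ v : LatticeAlg R K B, latticeSeminorm R K B v = 0 → v = 0 := by
    intro v hv
    obtain ⟨k, b, hb⟩ := exists_pow_smul_eq_latticeIncl hϖ v
    have hb0 : b = 0 := hB.separated b fun m => by
      have : latticeSeminorm R K B (latticeIncl R K B b) < ‖algebraMap R K ϖ ^ m‖ := by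
        rw [← hb, map_smul_eq_mul, hv, mul_zero, norm_pow]
        exact pow_pos hpos m
      obtain ⟨c, hc⟩ := exists_of_latticeSeminorm_lt_norm this
      refine ⟨c, latticeIncl_injective (K := K) hϖ htf ?_⟩
      rw [hc, ← map_pow, ← map_pow, ← Algebra.smul_def, latticeIncl_smul]
    rw [hb0, map_zero] at hb
    exact (smul_eq_zero.1 hb).resolve_left (pow_ne_zero _ (norm_pos_iff.1 hpos))
  have hT0 : T0Space (LatticeAlg R K B) := by
    let u := (latticeSeminorm R K B).toAddGroupSeminorm.toSeminormedAddCommGroup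
    refine (t0Space_iff_inseparable _).2 fun x y h => ?_
    have h1 : dist x y = 0 := Metric.inseparable_iff.1 h
    rw [dist_eq_norm] at h1
    exact sub_eq_zero.1 (key _ h1)
  infer_instance

/-- It suffices to treat sequences whose n-th difference lies in ϖ^n B; they telescope to a ϖ-adic
series, which converges in `B`. -/
theorem completeSpace_latticeAlg (hϖ : Irreducible ϖ)
    (hB : IsCentralComplete (algebraMap R B ϖ)) : CompleteSpace (LatticeAlg R K B) := by
  have hpos := norm_pos_iff.2 (algebraMap_irreducible_ne_zero (K := K) hϖ)
  let u := (latticeSeminorm R K B).toAddGroupSeminorm.toSeminormedAddCommGroup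
  refine Metric.complete_of_convergent_controlled_sequences (α := LatticeAlg R K B)
    (fun n => ‖algebraMap R K ϖ ^ n‖) (fun n => by rw [norm_pow]; exact pow_pos hpos n) ?_
  intro s hs
  have hdiff : ∀ n, ∃ c : B, s (n + 1) - s n = algebraMap R K ϖ ^ n • latticeIncl R K B c := by
    intro n
    have h1 := hs n (n + 1) n n.le_succ le_rfl
    rw [dist_eq_norm] at h1
    exact exists_of_latticeSeminorm_lt_norm h1
  choose c hc using hdiff
  obtain ⟨w, hw⟩ := hB.complete c
  have hsum : ∀ n, s n = s 0 + latticeIncl R K B (∑ i ∈ Finset.range n,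
      algebraMap R B ϖ ^ i * c i) := by
    intro n
    induction n with
    | zero => simp
    | succ n ih =>
      rw [Finset.sum_range_succ, map_add, ← add_assoc, ← ih, ← map_pow, ← Algebra.smul_def,
        latticeIncl_smul, map_pow, ← hc n, add_sub_cancel]
  refine ⟨s 0 + latticeIncl R K B w, ?_⟩
  rw [tendsto_iff_dist_tendsto_zero]
  refine squeeze_zero (fun _ => dist_nonneg) (fun n => ?_)
    (tendsto_pow_atTop_nhds_zero_of_lt_one (norm_nonneg _) (norm_irreducible_lt_one (K := K) hϖ))
  obtain ⟨y, hy⟩ := hw n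
  rw [dist_comm, dist_eq_norm, hsum n, add_sub_add_left_eq_sub, ← map_sub, hy,
    add_sub_cancel_left, ← map_pow, ← Algebra.smul_def, latticeIncl_smul, ← norm_pow, ← map_pow]
  exact latticeSeminorm_smul_le _ _

end LatticeAlg

/-! ### Generators of the filtered algebra -/

namespace AlgFiltration

section Generators

variable {R A : Type*} [CommRing R] [Ring A] [Algebra R A] (𝓕 : AlgFiltration R A)

/-- The symbol of degree `i` of an element of `F i`, in the associated graded ring. -/
def grSymb (i : ℕ) (x : A) (hx : x ∈ 𝓕.F i) : 𝓕.gr :=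
  DirectSum.of 𝓕.grPiece i (𝓕.symb i ⟨x, hx⟩)

variable {𝓕}

theorem grSymb_eq_iff {i : ℕ} {x y : A} {hx : x ∈ 𝓕.F i} {hy : y ∈ 𝓕.F i} :
    𝓕.grSymb i x hx = 𝓕.grSymb i y hy ↔ x - y ∈ 𝓕.lower i :=
  (DirectSum.of_injective i).eq_iff.trans 𝓕.symb_eq_iff

theorem grSymb_congr {i j : ℕ} (h : i = j) {x y : A} (hxy : x = y) (hx : x ∈ 𝓕.F i)
    (hy : y ∈ 𝓕.F j) : 𝓕.grSymb i x hx = 𝓕.grSymb j y hy := by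
  subst h hxy
  rfl

theorem grSymb_mul {i j : ℕ} {x y : A} (hx : x ∈ 𝓕.F i) (hy : y ∈ 𝓕.F j) :
    𝓕.grSymb i x hx * 𝓕.grSymb j y hy = 𝓕.grSymb (i + j) (x * y) (𝓕.mul_mem hx hy) :=
  DirectSum.of_mul_of _ _

theorem grSymb_add {i : ℕ} {x y : A} (hx : x ∈ 𝓕.F i) (hy : y ∈ 𝓕.F i) :
    𝓕.grSymb i x hx + 𝓕.grSymb i y hy = 𝓕.grSymb i (x + y) (add_mem hx hy) := by
  rw [grSymb, grSymb, ← map_add, ← map_add]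
  rfl

theorem grSymb_zero (i : ℕ) : 𝓕.grSymb i 0 (zero_mem _) = 0 := by
  rw [grSymb, show (⟨0, zero_mem _⟩ : 𝓕.F i) = 0 from rfl, map_zero, map_zero]

/-- Commutativity of the graded ring kills the symbol of degree i + j of the commutator. -/
theorem commutator_mem_lower (hcomm : ∀ x y : 𝓕.gr, x * y = y * x) {i j : ℕ} {x y : A}
    (hx : x ∈ 𝓕.F i) (hy : y ∈ 𝓕.F j) : x * y - y * x ∈ 𝓕.lower (i + j) := by
  have h1 := hcomm (𝓕.grSymb i x hx) (𝓕.grSymb j y hy)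
  rw [grSymb_mul, grSymb_mul] at h1
  have hyx : y * x ∈ 𝓕.F (i + j) := by
    rw [Nat.add_comm]
    exact 𝓕.mul_mem hy hx
  rw [grSymb_congr (Nat.add_comm j i) rfl (𝓕.mul_mem hy hx) hyx] at h1
  exact grSymb_eq_iff.1 h1

theorem prod_map_X_toMultiset {σ S : Type*} [CommRing S] (α : σ →₀ ℕ) :
    ((Finsupp.toMultiset α).map MvPolynomial.X).prod = (MvPolynomial.monomial α (1 : S)) := by
  induction α using Finsupp.induction_linear with
  | zero => simp
  | add α β hα hβ =>
    rw [map_add, Multiset.map_add, Multiset.prod_add, hα, hβ, MvPolynomial.monomial_mul, one_mul]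
  | single j n =>
    rw [Finsupp.toMultiset_single, Multiset.map_nsmul, Multiset.prod_nsmul, Multiset.map_singleton,
      Multiset.prod_singleton, MvPolynomial.X_pow_eq_monomial]

/-- The algebra is generated over `F 0` by finitely many elements of `F 1`, compatibly with the
filtration. -/
theorem IsAdmissible.exists_generators {ϖ : R} (h : 𝓕.IsAdmissible ϖ) :
    ∃ (r : ℕ) (Y : Fin r → A), (∀ j, Y j ∈ 𝓕.F 1) ∧
      ∀ i, ∀ x ∈ 𝓕.F i, x ∈ wordSpan (𝓕.zeroPart.val : 𝓕.zeroPart →+* A) Y i := by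
  let _ := 𝓕.zeroPartCommRing h.zero_comm
  obtain ⟨r, e, he⟩ := h.gr_polynomial
  have hlift : ∀ i (P : MvPolynomial (Fin r) 𝓕.zeroPart), P.IsHomogeneous i →
      ∃ (x : A) (hx : x ∈ 𝓕.F i), e (𝓕.grSymb i x hx) = P := by
    intro i P hP
    obtain ⟨y, hy⟩ := (he i (e.symm P)).2 (by rwa [e.apply_symm_apply])
    obtain ⟨x, rfl⟩ := 𝓕.symb_surjective i y
    exact ⟨x, x.2, by rw [← e.apply_symm_apply P, hy]; rfl⟩
  choose Y hY hYX using fun j => hlift 1 (MvPolynomial.X j) (MvPolynomial.isHomogeneous_X _ j)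
  -- `e` is only a graded ring isomorphism and may move F_0, so the constant polynomial `c` is
  -- lifted to some `d c` in F_0 rather than to `c` itself.
  choose d hd hdC using fun c => hlift 0 (MvPolynomial.C c) (MvPolynomial.isHomogeneous_C _ c)
  refine ⟨r, Y, hY, ?_⟩
  have hword : ∀ l : List (Fin r), ∃ hx : (l.map Y).prod ∈ 𝓕.F l.length,
      e (𝓕.grSymb l.length _ hx) = (l.map MvPolynomial.X).prod := by
    intro l
    induction l with
    | nil => exact ⟨𝓕.one_mem, map_one e⟩
    | cons j l ih =>
      obtain ⟨hx, hxe⟩ := ih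
      have hm := 𝓕.mul_mem (hY j) hx
      rw [Nat.add_comm] at hm
      refine ⟨hm, ?_⟩
      have h1 := grSymb_mul (hY j) hx
      rw [grSymb_congr (Nat.add_comm _ _) rfl _ hm] at h1
      refine (congrArg e h1.symm).trans ?_
      rw [map_mul, hYX, hxe, List.map_cons, List.prod_cons]
  have hhom : ∀ i (P : MvPolynomial (Fin r) 𝓕.zeroPart), P.IsHomogeneous i →
      ∃ (x : A) (hx : x ∈ 𝓕.F i),
        x ∈ wordSpan (𝓕.zeroPart.val : 𝓕.zeroPart →+* A) Y i ∧ e (𝓕.grSymb i x hx) = P := by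
    intro i P hP
    rw [P.as_sum]
    refine Finset.sum_induction _ (fun P => ∃ (x : A) (hx : x ∈ 𝓕.F i),
        x ∈ wordSpan (𝓕.zeroPart.val : 𝓕.zeroPart →+* A) Y i ∧ e (𝓕.grSymb i x hx) = P) ?_ ?_ ?_
    · rintro _ _ ⟨x, hx, hxw, rfl⟩ ⟨y, hy, hyw, rfl⟩
      exact ⟨x + y, add_mem hx hy, add_mem hxw hyw, by rw [← map_add, grSymb_add]⟩
    · exact ⟨0, zero_mem _, zero_mem _, by rw [grSymb_zero, map_zero]⟩
    · intro α hα
      have hdeg : (Finsupp.toMultiset α).toList.length = i := by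
        rw [length_toList_toMultiset, Finsupp.degree_eq_weight_one]
        exact hP (MvPolynomial.mem_support_iff.1 hα)
      obtain ⟨hx, hxe⟩ := hword (Finsupp.toMultiset α).toList
      have hm := 𝓕.mul_mem (hd (P.coeff α)) hx
      have hi : 0 + (Finsupp.toMultiset α).toList.length = i := by rw [hdeg, zero_add]
      refine ⟨d (P.coeff α) * ((Finsupp.toMultiset α).toList.map Y).prod, hi ▸ hm,
        AddSubgroup.subset_closure ⟨⟨d (P.coeff α), hd _⟩, _, hdeg.le, rfl⟩, ?_⟩
      rw [← grSymb_congr hi rfl hm, ← grSymb_mul (hd _) hx, map_mul, hdC, hxe, ← Multiset.prod_coe,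
        ← Multiset.map_coe, Multiset.coe_toList, prod_map_X_toMultiset,
        MvPolynomial.C_mul_monomial, mul_one]
  intro i
  induction i with
  | zero =>
    intro x hx
    obtain ⟨x', hx', hw, hxe⟩ := hhom 0 _ ((he 0 (𝓕.grSymb 0 x hx)).1 ⟨_, rfl⟩)
    -- In degree 0 the lower step is zero, so equal symbols mean equal elements; in higher degrees
    -- the difference falls under the induction hypothesis.
    have h0 := grSymb_eq_iff.1 (e.injective hxe)
    rw [← sub_eq_zero.1 ((Submodule.mem_bot R).1 h0)]
    exact hw
  | succ i ih =>
    intro x hx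
    obtain ⟨x', hx', hw, hxe⟩ := hhom (i + 1) _ ((he (i + 1) (𝓕.grSymb (i + 1) x hx)).1 ⟨_, rfl⟩)
    have h0 := ih _ (grSymb_eq_iff.1 (e.injective hxe))
    rw [← sub_sub_cancel x' x]
    exact sub_mem hw (wordSpan_mono _ _ i.le_succ h0)

end Generators

end AlgFiltration

/-! ### Flatness from lattices -/

section FlatLattices

variable {P U S T : Type*} [Ring P] [Ring U] [Ring S] [Ring T]

theorem exists_ringHom_lift {f : P →+* T} {i : U →+* T} (hi : Function.Injective i)
    (h : ∀ x, ∃ u, i u = f x) : ∃ g : P →+* U, ∀ x, i (g x) = f x := by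
  choose g hg using h
  exact ⟨{ toFun := g
           map_one' := hi (by rw [hg, map_one, map_one])
           map_mul' x y := hi (by rw [hg, map_mul, map_mul, hg, hg])
           map_zero' := hi (by rw [hg, map_zero, map_zero])
           map_add' x y := hi (by rw [hg, map_add, map_add, hg, hg]) }, hg⟩

/-- By `hrange`, `P` is the full preimage of the lattice `U`. So if g t is divisible by `p` in `U`,
then p⁻¹ t already lies in `P`, and every element of `S` is carried into `P` by a power of `p`. What
remains is the completion `P → U` followed by inverting `p`. -/
theorem eqFlat_of_lattices [IsNoetherianRing P] {f : S →+* T} {j : P →+* S} {i : U →+* T}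
    {g : P →+* U} (hj : Function.Injective j) (hi : Function.Injective i)
    (hij : ∀ x, i (g x) = f (j x)) {p : P} (hp : IsUnit (j p)) (hpS : ∀ x, j p * x = x * j p)
    (hpT : ∀ x, f (j p) * x = x * f (j p)) (hU : IsCentralComplete (g p))
    (hrange : ∀ x u, i u = f x → ∃ t, j t = x) (happ : ∀ u, ∃ t u', u = g t + g p * u')
    (hT : ∀ x, ∃ (k : ℕ) (y : U), f (j p) ^ k * x = i y) : EqFlat f := by
  have hcomm : ∀ x, p * x = x * p := fun x => hj (by rw [map_mul, map_mul, hpS])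
  have hfp : IsUnit (f (j p)) := hp.map f
  have htf : ∀ u, g p * u = 0 → u = 0 := fun u hu => by
    apply hi
    have h1 := congrArg i hu
    rw [map_mul, hij, map_zero] at h1
    rw [map_zero]
    exact (hfp.mul_right_eq_zero).1 h1
  refine (eqFlat_of_complete g hcomm hU htf happ fun t u htu => ?_).localization (j := j) hi hij hp
    hpS hpT (fun x => ?_) hT ⟨p, rfl⟩ ⟨g p, hij p⟩
  · obtain ⟨t', ht'⟩ := hrange (Ring.inverse (j p) * j t) u (by
      rw [map_mul, ← hij t, htu, map_mul, hij, ← mul_assoc, ← map_mul,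
        Ring.inverse_mul_cancel _ hp, map_one, one_mul])
    exact ⟨t', hj (by rw [map_mul, ht', Ring.mul_inverse_cancel_left _ _ hp])⟩
  · obtain ⟨k, y, hy⟩ := hT (f x)
    obtain ⟨t, ht⟩ := hrange (j p ^ k * x) y (by rw [map_mul, map_pow, hy])
    exact ⟨k, t, ht.symm⟩

theorem isFlatHom_of_lattices [IsNoetherianRing P] [IsNoetherianRing Pᵐᵒᵖ] {f : S →+* T}
    {j : P →+* S} {i : U →+* T} {g : P →+* U} (hj : Function.Injective j)
    (hi : Function.Injective i) (hij : ∀ x, i (g x) = f (j x)) {p : P} (hp : IsUnit (j p))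
    (hpS : ∀ x, j p * x = x * j p) (hpT : ∀ x, f (j p) * x = x * f (j p))
    (hU : IsCentralComplete (g p)) (hrange : ∀ x u, i u = f x → ∃ t, j t = x)
    (happ : ∀ u, ∃ t u', u = g t + g p * u')
    (hT : ∀ x, ∃ (k : ℕ) (y : U), f (j p) ^ k * x = i y) :
    EqFlat f ∧ EqFlat (RingHom.op f) := by
  refine ⟨eqFlat_of_lattices hj hi hij hp hpS hpT hU hrange happ hT,
    eqFlat_of_lattices (j := RingHom.op j) (i := RingHom.op i) (g := RingHom.op g)
      (p := MulOpposite.op p) ?_ ?_ ?_ ?_ ?_ ?_ hU.op ?_ ?_ ?_⟩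
  · exact fun x y h => MulOpposite.unop_injective (hj (MulOpposite.op_injective h))
  · exact fun x y h => MulOpposite.unop_injective (hi (MulOpposite.op_injective h))
  · exact fun x => congrArg MulOpposite.op (hij x.unop)
  · exact hp.op
  · exact fun x => congrArg MulOpposite.op (hpS x.unop).symm
  · exact fun x => congrArg MulOpposite.op (hpT x.unop).symm
  · intro x u h
    obtain ⟨t, ht⟩ := hrange x.unop u.unop (MulOpposite.op_injective h)
    exact ⟨MulOpposite.op t, congrArg MulOpposite.op ht⟩
  · intro u
    obtain ⟨t, u', h⟩ := happ u.unop
    refine ⟨MulOpposite.op t, MulOpposite.op u', MulOpposite.unop_injective ?_⟩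
    change u.unop = g t + u' * g p
    rw [h, hU.comm]
  · intro x
    obtain ⟨k, y, h⟩ := hT x.unop
    refine ⟨k, MulOpposite.op y, MulOpposite.unop_injective ?_⟩
    change x.unop * f (j p) ^ k = i y
    rw [← h, commute_pow hpT]

end FlatLattices

/-! ### The completed lattice and the algebra -/

section LatticeCompletion

variable {R K : Type*} [CommRing R] [IsDomain R] [NormedField K] [Algebra R K]
  [IsFractionRing R K] [IsUnitBall R K] {B : Type*} [Ring B] [Algebra R B] {ϖ : R}

theorem exists_eq_latticeMap_add (hϖ : Irreducible ϖ) (htf : ∀ b : B, ϖ • b = 0 → b = 0)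
    (k : ℕ) (v : LatticeAlg R K (PiCompletion ϖ B)) :
    ∃ z u, v = latticeMap R K (toPiCompletion ϖ B) z +
      algebraMap R K ϖ ^ k • latticeIncl R K _ u := by
  obtain ⟨m, x, hx⟩ := exists_pow_smul_eq_latticeIncl hϖ v
  obtain ⟨b, u, rfl⟩ := exists_eq_toPiCompletion_add htf (m + k) x
  have h0 : algebraMap R K ϖ ^ m ≠ 0 := pow_ne_zero m (algebraMap_irreducible_ne_zero hϖ)
  refine ⟨(algebraMap R K ϖ ^ m)⁻¹ • latticeIncl R K B b, u, smul_right_injective _ h0 ?_⟩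
  change _ • v = _ • _
  rw [hx, map_smul, latticeMap_latticeIncl, smul_add, smul_inv_smul₀ h0, smul_smul, ← pow_add,
    map_add, latticeIncl_smul, map_pow]

/-- Divisibility of an element of `B` by ϖ^k can be tested in the completion, so completing adds no
new integral elements to `B_K`. -/
theorem exists_of_latticeMap_toPiCompletion [IsDiscreteValuationRing R] (hϖ : Irreducible ϖ)
    (htf : ∀ b : B, ϖ • b = 0 → b = 0) {z : LatticeAlg R K B} {u : PiCompletion ϖ B}
    (h : latticeMap R K (toPiCompletion ϖ B) z = latticeIncl R K _ u) :
    ∃ b, z = latticeIncl R K B b := by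
  obtain ⟨k, b, hb⟩ := exists_pow_smul_eq_latticeIncl hϖ z
  have h1 : toPiCompletion ϖ B b = ϖ ^ k • u := by
    apply latticeIncl_injective (K := K) hϖ (piCompletion_torsionFree htf)
    rw [latticeIncl_smul, ← h, ← latticeMap_latticeIncl, ← hb, map_smul, map_pow]
  obtain ⟨c, rfl⟩ := exists_eq_pow_smul_of_toPiCompletion h1
  refine ⟨c, smul_right_injective _ (pow_ne_zero k (algebraMap_irreducible_ne_zero (K := K) hϖ)) ?_⟩
  change _ • z = _ • _
  rw [hb, latticeIncl_smul, map_pow]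

end LatticeCompletion

namespace AlgFiltration

/-! ### The lattices A_n as almost polynomial extensions of F_0. -/

section Deform

variable {R A : Type*} [CommRing R] [Ring A] [Algebra R A] {𝓕 : AlgFiltration R A} {ϖ : R}

/-- Evaluating the Rees ring at X = ϖ^n shows that A_n is the additive span of the ϖ^(ni) F_i. -/
theorem deform_le {n : ℕ} (P : AddSubgroup A)
    (hP : ∀ i, ∀ a ∈ 𝓕.F i, ϖ ^ (n * i) • a ∈ P) {x : A} (hx : x ∈ 𝓕.deform ϖ n) : x ∈ P := by
  obtain ⟨p, hp, rfl⟩ := hx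
  change Polynomial.eval₂ _ _ p ∈ P
  rw [Polynomial.eval₂_eq_sum, Polynomial.sum]
  refine sum_mem fun i _ => ?_
  rw [← map_pow, ← pow_mul, ← Algebra.commutes, ← Algebra.smul_def]
  exact hP i _ (hp i)

theorem zeroPart_le_deform (𝓕 : AlgFiltration R A) (ϖ : R) (n : ℕ) :
    𝓕.zeroPart ≤ 𝓕.deform ϖ n := fun a ha => by
  simpa using 𝓕.pow_smul_mem_deform ϖ n (i := 0) ha

theorem pow_smul_gen_mem_deform (ϖ : R) (n : ℕ) {a : A} (ha : a ∈ 𝓕.F 1) :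
    ϖ ^ n • a ∈ 𝓕.deform ϖ n := by
  simpa using 𝓕.pow_smul_mem_deform ϖ n ha

theorem prod_map_smul {r : ℕ} (c : R) (Y : Fin r → A) (l : List (Fin r)) :
    (l.map fun j => c • Y j).prod = c ^ l.length • (l.map Y).prod := by
  induction l with
  | nil => simp
  | cons j l ih =>
    rw [List.map_cons, List.prod_cons, ih, List.map_cons, List.prod_cons, smul_mul_smul_comm,
      List.length_cons, pow_succ']

theorem _root_.AMEnvelope.exists_of_mem_wordSpan_one {C B : Type*} [Ring C] [Ring B]
    {φ : C →+* B} {r : ℕ} {y : Fin r → B} {x : B} (hx : x ∈ wordSpan φ y 1) :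
    ∃ (c₀ : C) (c : Fin r → C), x = φ c₀ + ∑ k, φ (c k) * y k := by
  induction hx using AddSubgroup.closure_induction with
  | mem x hx =>
    obtain ⟨c, l, hl, rfl⟩ := hx
    rcases l with _ | ⟨j, _ | ⟨i, l⟩⟩
    · exact ⟨c, 0, by simp⟩
    · refine ⟨0, Pi.single j c, ?_⟩
      rw [Finset.sum_eq_single j]
      · simp
      · intro k _ hk
        rw [Pi.single_eq_of_ne hk, map_zero, zero_mul]
      · simp
    · simp at hl
  | zero => exact ⟨0, 0, by simp⟩
  | add x x' _ _ hx hx' =>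
    obtain ⟨c₀, c, rfl⟩ := hx
    obtain ⟨d₀, d, rfl⟩ := hx'
    refine ⟨c₀ + d₀, c + d, ?_⟩
    simp only [map_add, Pi.add_apply, add_mul, Finset.sum_add_distrib]
    abel
  | neg x _ hx =>
    obtain ⟨c₀, c, rfl⟩ := hx
    refine ⟨-c₀, -c, ?_⟩
    simp only [map_neg, Pi.neg_apply, neg_mul, Finset.sum_neg_distrib, neg_add]

/-- The algebra `A_n` is an almost polynomial extension of `F 0`. -/
theorem isAlmostPolynomial_deform (ϖ : R) (hcomm : ∀ x y : 𝓕.gr, x * y = y * x) {r : ℕ}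
    {Y : Fin r → A} (hY : ∀ j, Y j ∈ 𝓕.F 1)
    (hgen : ∀ i, ∀ x ∈ 𝓕.F i, x ∈ wordSpan (𝓕.zeroPart.val : 𝓕.zeroPart →+* A) Y i) (n : ℕ) :
    IsAlmostPolynomial
      (Subalgebra.inclusion (𝓕.zeroPart_le_deform ϖ n) : 𝓕.zeroPart →+* 𝓕.deform ϖ n)
      fun j => (⟨ϖ ^ n • Y j, pow_smul_gen_mem_deform ϖ n (hY j)⟩ : 𝓕.deform ϖ n) where
  comm_base j c := by
    have h1 : Y j * c - c * Y j ∈ 𝓕.F 0 := commutator_mem_lower hcomm (hY j) (j := 0) c.2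
    refine ⟨⟨ϖ ^ n • (Y j * c - c * Y j), (𝓕.F 0).smul_mem _ h1⟩, Subtype.ext ?_⟩
    change ϖ ^ n • Y j * (c : A) = c * ϖ ^ n • Y j + ϖ ^ n • (Y j * c - c * Y j)
    rw [smul_mul_assoc, mul_smul_comm, ← smul_add, add_sub_cancel]
  comm_gen i j := by
    have h1 : Y i * Y j - Y j * Y i ∈ 𝓕.F 1 := commutator_mem_lower hcomm (hY i) (hY j)
    obtain ⟨c₀, c, hc⟩ := exists_of_mem_wordSpan_one (hgen 1 _ h1)
    -- The commutator carries ϖ^(2n); in the linear terms one factor ϖ^n goes to the generator and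
    -- the other to its coefficient.
    refine ⟨(ϖ ^ n * ϖ ^ n) • c₀, fun k => ϖ ^ n • c k, Subtype.ext ?_⟩
    have hs : ((∑ k, (Subalgebra.inclusion (𝓕.zeroPart_le_deform ϖ n) :
        𝓕.zeroPart →+* 𝓕.deform ϖ n) (ϖ ^ n • c k) *
          (⟨ϖ ^ n • Y k, pow_smul_gen_mem_deform ϖ n (hY k)⟩ : 𝓕.deform ϖ n) :
          𝓕.deform ϖ n) : A) = ∑ k, (ϖ ^ n • (c k : A)) * (ϖ ^ n • Y k) := by
      rw [AddSubmonoidClass.coe_finsetSum]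
      rfl
    change ϖ ^ n • Y i * ϖ ^ n • Y j = ϖ ^ n • Y j * ϖ ^ n • Y i +
      ((ϖ ^ n * ϖ ^ n) • (c₀ : A) + _)
    rw [hs]
    simp only [smul_mul_smul_comm]
    rw [← Finset.smul_sum, ← smul_add, ← smul_add]
    exact congrArg _ (sub_eq_iff_eq_add'.1 hc)
  generates P hφ hy := by
    refine eq_top_iff.2 fun x _ => ?_
    have hx : (x : A) ∈ (P.map ((𝓕.deform ϖ n).val : 𝓕.deform ϖ n →+* A)).toAddSubgroup := by
      refine deform_le _ (fun i a ha => ?_) x.2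
      have hw := hgen i a ha
      clear ha
      induction hw using AddSubgroup.closure_induction with
      | mem a ha =>
        obtain ⟨c, l, hl, rfl⟩ := ha
        have h1 : ((l.map fun j => (⟨ϖ ^ n • Y j, pow_smul_gen_mem_deform ϖ n (hY j)⟩ :
            𝓕.deform ϖ n)).prod) ∈ P := list_prod_mem (by
          intro z hz
          obtain ⟨j, -, rfl⟩ := List.mem_map.1 hz
          exact hy j)
        -- Each letter takes one factor ϖ^n; the surplus for a word shorter than `i` goes into the
        -- coefficient.
        refine ⟨_, P.mul_mem (hφ (ϖ ^ (n * (i - l.length)) • c)) h1, ?_⟩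
        rw [map_mul, map_list_prod, List.map_map]
        change (ϖ ^ (n * (i - l.length)) • (c : A)) * (l.map fun j => ϖ ^ n • Y j).prod = _
        rw [prod_map_smul, smul_mul_smul_comm, ← pow_mul, ← pow_add, ← Nat.mul_add,
          Nat.sub_add_cancel hl]
        rfl
      | zero => rw [smul_zero]; exact zero_mem _
      | add a b _ _ ha hb => rw [smul_add]; exact add_mem ha hb
      | neg a _ ha => rw [smul_neg]; exact neg_mem ha
    obtain ⟨z, hz, hzx⟩ := hx
    rwa [← Subtype.ext hzx]

end Deform

end AlgFiltration

/-! ### Noetherianity and flatness of the algebras `Â_{n,K}` -/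

namespace AlgFiltration

section Hat

variable {R A : Type*} [CommRing R] [Ring A] [Algebra R A] {𝓕 : AlgFiltration R A} {ϖ : R}

theorem isNoetherianRing_zeroPart_op (h : 𝓕.IsAdmissible ϖ) : IsNoetherianRing 𝓕.zeroPartᵐᵒᵖ := by
  have := h.zero_noetherian
  let _ := 𝓕.zeroPartCommRing h.zero_comm
  exact isNoetherianRing_of_ringEquiv 𝓕.zeroPart (RingEquiv.toOpposite 𝓕.zeroPart)

theorem isNoetherianRing_deform (h : 𝓕.IsAdmissible ϖ) (n : ℕ) :
    IsNoetherianRing (𝓕.deform ϖ n) ∧ IsNoetherianRing (𝓕.deform ϖ n)ᵐᵒᵖ := by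
  obtain ⟨r, Y, hY, hgen⟩ := h.exists_generators
  have hP := isAlmostPolynomial_deform ϖ h.gr_comm hY hgen n
  have := h.zero_noetherian
  have := isNoetherianRing_zeroPart_op h
  exact ⟨hP.isNoetherianRing, hP.op.isNoetherianRing⟩

theorem hatTransition_latticeIncl (K : Type*) [NormedField K] [Algebra R K] (n : ℕ)
    (u : PiCompletion ϖ (𝓕.deform ϖ (n + 1))) :
    𝓕.hatTransition K ϖ n (latticeIncl R K _ u) = latticeIncl R K _
      (piCompletionMap ϖ (Subalgebra.inclusion (𝓕.deform_succ_le ϖ n)) u) := rfl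

/-- Bracketing with F_1 maps F_i to itself, hence preserves each ϖ^((n+1)i) F_i, although `y` itself
need not lie in A_{n+1}. -/
theorem commutator_mem_deform (hcomm : ∀ x y : 𝓕.gr, x * y = y * x) {n : ℕ} {y b : A}
    (hy : y ∈ 𝓕.F 1) (hb : b ∈ 𝓕.deform ϖ (n + 1)) :
    y * b - b * y ∈ 𝓕.deform ϖ (n + 1) := by
  let P : AddSubgroup A :=
    { carrier := {b | y * b - b * y ∈ 𝓕.deform ϖ (n + 1)}
      add_mem' {a b} ha hb := by
        have := (𝓕.deform ϖ (n + 1)).add_mem ha hb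
        rwa [show y * a - a * y + (y * b - b * y) = y * (a + b) - (a + b) * y by
          noncomm_ring] at this
      zero_mem' := by simp
      neg_mem' {a} ha := by
        have := (𝓕.deform ϖ (n + 1)).neg_mem ha
        rwa [show -(y * a - a * y) = y * (-a) - (-a) * y by noncomm_ring] at this }
  refine deform_le P (fun i a ha => ?_) hb
  change y * (ϖ ^ ((n + 1) * i) • a) - (ϖ ^ ((n + 1) * i) • a) * y ∈ 𝓕.deform ϖ (n + 1)
  rw [mul_smul_comm, smul_mul_assoc, ← smul_sub]
  refine 𝓕.pow_smul_mem_deform ϖ (n + 1) ?_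
  have := commutator_mem_lower hcomm hy ha
  rwa [Nat.add_comm] at this

/-- The subring of `Â_{n+1,K}` of the elements that map to `Â_n`. -/
def hatSub (𝓕 : AlgFiltration R A) (K : Type*) [NormedField K] [Algebra R K] (ϖ : R) (n : ℕ) :
    Subring (𝓕.hatK K ϖ (n + 1)) :=
  (latticeIncl R K (PiCompletion ϖ (𝓕.deform ϖ n))).range.comap (𝓕.hatTransition K ϖ n).toRingHom

theorem mem_hatSub_iff {K : Type*} [NormedField K] [Algebra R K] {n : ℕ}
    {x : 𝓕.hatK K ϖ (n + 1)} :
    x ∈ 𝓕.hatSub K ϖ n ↔ ∃ u, latticeIncl R K _ u = 𝓕.hatTransition K ϖ n x := Iff.rfl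

/-- The map `Â_{n+1} → Â_{n+1,K}`, with values in the elements that map to `Â_n`. -/
def toHatSub (𝓕 : AlgFiltration R A) (K : Type*) [NormedField K] [Algebra R K] (ϖ : R) (n : ℕ) :
    PiCompletion ϖ (𝓕.deform ϖ (n + 1)) →+* 𝓕.hatSub K ϖ n :=
  (latticeIncl R K _).codRestrict (𝓕.hatSub K ϖ n) fun u =>
    ⟨_, (hatTransition_latticeIncl K n u).symm⟩

variable [IsDomain R]

theorem smul_eq_zero_of_flat [Module.Flat R A] (hϖ : Irreducible ϖ) (a : A) (h : ϖ • a = 0) :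
    a = 0 :=
  (smul_eq_zero.1 h).resolve_left hϖ.ne_zero

theorem deform_torsionFree [Module.Flat R A] (hϖ : Irreducible ϖ) (n : ℕ) (a : 𝓕.deform ϖ n)
    (h : ϖ • a = 0) : a = 0 :=
  Subtype.ext (smul_eq_zero_of_flat hϖ (a : A) (congrArg Subtype.val h))

theorem isNoetherianRing_piCompletion [Module.Flat R A] (hϖ : Irreducible ϖ)
    (h : 𝓕.IsAdmissible ϖ) (n : ℕ) :
    IsNoetherianRing (PiCompletion ϖ (𝓕.deform ϖ n)) ∧
      IsNoetherianRing (PiCompletion ϖ (𝓕.deform ϖ n))ᵐᵒᵖ := by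
  obtain ⟨h1, h2⟩ := isNoetherianRing_deform h n
  have hU := isCentralComplete_piCompletion (deform_torsionFree (𝓕 := 𝓕) hϖ n)
  have happ : ∀ u : PiCompletion ϖ (𝓕.deform ϖ n), ∃ b u',
      u = toPiCompletion ϖ _ b + algebraMap R _ ϖ * u' := fun u => by
    obtain ⟨b, u', hu⟩ := exists_eq_toPiCompletion_add (deform_torsionFree hϖ n) 1 u
    exact ⟨b, u', by rw [hu, pow_one, Algebra.smul_def]⟩
  refine ⟨hU.isNoetherianRing (toPiCompletion ϖ (𝓕.deform ϖ n)).toRingHom happ,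
    hU.op.isNoetherianRing (RingHom.op (toPiCompletion ϖ (𝓕.deform ϖ n)).toRingHom) fun u => ?_⟩
  obtain ⟨b, u', hu⟩ := happ u.unop
  refine ⟨MulOpposite.op b, MulOpposite.op u', MulOpposite.unop_injective ?_⟩
  change u.unop = toPiCompletion ϖ _ b + u' * algebraMap R _ ϖ
  rw [hu, Algebra.commutes]

variable {K : Type*} [NormedField K] [Algebra R K] [IsFractionRing R K]

theorem isUnit_algebraMap_irreducible (hϖ : Irreducible ϖ) (V : Type*) [Ring V] [Algebra K V] :
    IsUnit (algebraMap K V (algebraMap R K ϖ)) :=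
  (IsUnit.mk0 _ (algebraMap_irreducible_ne_zero hϖ)).map (algebraMap K V)

theorem exists_pow_mul_eq_latticeIncl [IsUnitBall R K] {B : Type*} [Ring B] [Algebra R B]
    (hϖ : Irreducible ϖ) (v : LatticeAlg R K B) :
    ∃ (k : ℕ) (b : B),
      algebraMap K (LatticeAlg R K B) (algebraMap R K ϖ) ^ k * v = latticeIncl R K B b := by
  obtain ⟨k, b, h⟩ := exists_pow_smul_eq_latticeIncl hϖ v
  exact ⟨k, b, by rw [← h, ← map_pow, ← Algebra.smul_def]⟩

theorem isNoetherianRing_hatK [IsUnitBall R K] [Module.Flat R A] (hϖ : Irreducible ϖ)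
    (h : 𝓕.IsAdmissible ϖ) (n : ℕ) :
    IsNoetherianRing (𝓕.hatK K ϖ n) ∧ IsNoetherianRing (𝓕.hatK K ϖ n)ᵐᵒᵖ := by
  obtain ⟨h1, h2⟩ := isNoetherianRing_piCompletion hϖ h n
  have hu := isUnit_algebraMap_irreducible (K := K) hϖ (𝓕.hatK K ϖ n)
  refine ⟨isNoetherianRing_localization (latticeIncl R K _) hu
      (exists_pow_mul_eq_latticeIncl hϖ),
    isNoetherianRing_localization (RingHom.op (latticeIncl R K _)) hu.op fun x => ?_⟩
  obtain ⟨k, b, hb⟩ := exists_pow_mul_eq_latticeIncl hϖ x.unop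
  refine ⟨k, MulOpposite.op b, MulOpposite.unop_injective ?_⟩
  change x.unop * algebraMap K _ (algebraMap R K ϖ) ^ k = latticeIncl R K _ b
  rw [← hb, ← map_pow, Algebra.commutes]

/-- The map `A → Â_{n,K}`. -/
def toHat (𝓕 : AlgFiltration R A) (K : Type*) [NormedField K] [Algebra R K] [IsFractionRing R K]
    (hϖ : Irreducible ϖ) (n : ℕ) : A →+* 𝓕.hatK K ϖ n :=
  (𝓕.toHatK K hϖ n).toRingHom.comp
    (Algebra.TensorProduct.includeRight : A →ₐ[R] K ⊗[R] A).toRingHom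

theorem toHat_apply (hϖ : Irreducible ϖ) (n : ℕ) (a : A) :
    𝓕.toHat K hϖ n a = 𝓕.toHatK K hϖ n (1 ⊗ₜ a) := rfl

theorem toHat_smul (hϖ : Irreducible ϖ) (n : ℕ) (c : R) (a : A) :
    𝓕.toHat K hϖ n (c • a) = algebraMap R K c • 𝓕.toHat K hϖ n a := by
  rw [toHat_apply, toHat_apply, ← map_smul]
  exact congrArg _ (latticeIncl_smul R K c a)

theorem toHat_of_mem (hϖ : Irreducible ϖ) (n : ℕ) (a : 𝓕.deform ϖ n) :
    𝓕.toHat K hϖ n a = latticeIncl R K _ (toPiCompletion ϖ (𝓕.deform ϖ n) a) :=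
  𝓕.toHatK_deformToAK K hϖ n (latticeIncl R K _ a)

theorem hatTransition_toHat (hϖ : Irreducible ϖ) (n : ℕ) (a : A) :
    𝓕.hatTransition K ϖ n (𝓕.toHat K hϖ (n + 1) a) = 𝓕.toHat K hϖ n a :=
  𝓕.hatTransition_toHatK K hϖ n _

theorem exists_of_toHatK_eq [IsDiscreteValuationRing R] [IsUnitBall R K] [Module.Flat R A]
    (hϖ : Irreducible ϖ) {n : ℕ} {v : K ⊗[R] A} {u : PiCompletion ϖ (𝓕.deform ϖ n)}
    (h : 𝓕.toHatK K hϖ n v = latticeIncl R K _ u) :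
    ∃ a : 𝓕.deform ϖ n, v = (1 : K) ⊗ₜ[R] (a : A) := by
  obtain ⟨z, rfl⟩ := (𝓕.deformToAK_bijective K hϖ n).2 v
  rw [toHatK_deformToAK] at h
  obtain ⟨a, rfl⟩ := exists_of_latticeMap_toPiCompletion hϖ (deform_torsionFree hϖ n) h
  exact ⟨a, rfl⟩

theorem exists_eq_toHatK_add [IsUnitBall R K] [Module.Flat R A] (hϖ : Irreducible ϖ) (n k : ℕ)
    (x : 𝓕.hatK K ϖ n) :
    ∃ v u, x = 𝓕.toHatK K hϖ n v + algebraMap R K ϖ ^ k • latticeIncl R K _ u := by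
  obtain ⟨z, u, rfl⟩ := exists_eq_latticeMap_add hϖ (deform_torsionFree hϖ n) k x
  exact ⟨𝓕.deformToAK K ϖ n z, u, by rw [toHatK_deformToAK]⟩

theorem toHat_mem_hatSub (hϖ : Irreducible ϖ) (n : ℕ) (a : 𝓕.deform ϖ n) :
    𝓕.toHat K hϖ (n + 1) a ∈ 𝓕.hatSub K ϖ n := by
  refine mem_hatSub_iff.2 ⟨toPiCompletion ϖ _ a, ?_⟩
  rw [hatTransition_toHat, toHat_of_mem]

/-- The map `A_n → Â_{n+1,K}`, with values in the elements that map to `Â_n`. -/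
def deformToHatSub (𝓕 : AlgFiltration R A) (K : Type*) [NormedField K] [Algebra R K]
    [IsFractionRing R K] (hϖ : Irreducible ϖ) (n : ℕ) : 𝓕.deform ϖ n →+* 𝓕.hatSub K ϖ n :=
  ((𝓕.toHat K hϖ (n + 1)).comp ((𝓕.deform ϖ n).val : 𝓕.deform ϖ n →+* A)).codRestrict
    (𝓕.hatSub K ϖ n) (toHat_mem_hatSub hϖ n)

theorem coe_deformToHatSub (hϖ : Irreducible ϖ) (n : ℕ) (a : 𝓕.deform ϖ n) :
    (𝓕.deformToHatSub K hϖ n a : 𝓕.hatK K ϖ (n + 1)) = 𝓕.toHat K hϖ (n + 1) a := rfl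

theorem deformToHatSub_inclusion (hϖ : Irreducible ϖ) (n : ℕ) (a : 𝓕.deform ϖ (n + 1)) :
    𝓕.deformToHatSub K hϖ n (Subalgebra.inclusion (𝓕.deform_succ_le ϖ n) a) =
      𝓕.toHatSub K ϖ n (toPiCompletion ϖ _ a) :=
  Subtype.ext (toHat_of_mem hϖ (n + 1) a)

/-- An element of Â_{n+1,K} differs from some `v` in A_K by an element of Â_{n+1}. If it maps to
Â_n, so does `v`, and then `v` comes from A_n. -/
theorem exists_eq_deformToHatSub_add [IsDiscreteValuationRing R] [IsUnitBall R K]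
    [Module.Flat R A] (hϖ : Irreducible ϖ) (n : ℕ) (x : 𝓕.hatSub K ϖ n) :
    ∃ a u, x = 𝓕.deformToHatSub K hϖ n a + 𝓕.toHatSub K ϖ n u := by
  obtain ⟨v, u, hx⟩ := exists_eq_toHatK_add hϖ (n + 1) 0 (x : 𝓕.hatK K ϖ (n + 1))
  rw [pow_zero, one_smul] at hx
  obtain ⟨w, hw⟩ := x.2
  have h1 : latticeIncl R K _ w = 𝓕.hatTransition K ϖ n x := hw
  rw [hx, map_add, hatTransition_toHatK, hatTransition_latticeIncl, ← sub_eq_iff_eq_add,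
    ← map_sub] at h1
  obtain ⟨a, rfl⟩ := exists_of_toHatK_eq hϖ h1.symm
  exact ⟨a, u, Subtype.ext hx⟩

/-- The heart of the flatness proof: over the completed lattice Â_{n+1}, the generators ϖ^n Y_j of
A_n still obey almost polynomial relations, which makes the intermediate ring noetherian. -/
theorem isAlmostPolynomial_hatSub [IsDiscreteValuationRing R] [IsUnitBall R K]
    [Module.Flat R A] (hϖ : Irreducible ϖ) (hcomm : ∀ x y : 𝓕.gr, x * y = y * x) {r : ℕ}
    {Y : Fin r → A} (hY : ∀ j, Y j ∈ 𝓕.F 1)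
    (hgen : ∀ i, ∀ x ∈ 𝓕.F i, x ∈ wordSpan (𝓕.zeroPart.val : 𝓕.zeroPart →+* A) Y i) (n : ℕ) :
    IsAlmostPolynomial (𝓕.toHatSub K ϖ n) fun j =>
      𝓕.deformToHatSub K hϖ n ⟨ϖ ^ n • Y j, pow_smul_gen_mem_deform ϖ n (hY j)⟩ := by
  have hP := isAlmostPolynomial_deform ϖ hcomm hY hgen n
  have hzero : ∀ c : 𝓕.zeroPart, 𝓕.deformToHatSub K hϖ n
      (Subalgebra.inclusion (𝓕.zeroPart_le_deform ϖ n) c) = 𝓕.toHatSub K ϖ n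
        (toPiCompletion ϖ _ (Subalgebra.inclusion (𝓕.zeroPart_le_deform ϖ (n + 1)) c)) :=
    fun c => deformToHatSub_inclusion hϖ n (Subalgebra.inclusion (𝓕.zeroPart_le_deform ϖ (n + 1)) c)
  refine ⟨fun j s => ?_, fun i j => ?_, fun P hφ hy => ?_⟩
  -- Write s = b + ϖu. The bracket of ϖ^n Y_j with `b` stays in A_{n+1}; for ϖu, the factor ϖ moves
  -- to the generator and turns it into ϖ^(n+1) Y_j, an element of A_{n+1}.
  · obtain ⟨b, u, rfl⟩ := exists_eq_toPiCompletion_add (deform_torsionFree hϖ (n + 1)) 1 s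
    let y' : 𝓕.deform ϖ (n + 1) := ⟨ϖ ^ (n + 1) • Y j, pow_smul_gen_mem_deform ϖ (n + 1) (hY j)⟩
    let d : 𝓕.deform ϖ (n + 1) := ⟨_, (𝓕.deform ϖ (n + 1)).smul_mem
      (commutator_mem_deform hcomm (hY j) b.2) (ϖ ^ n)⟩
    refine ⟨toPiCompletion ϖ _ d + (toPiCompletion ϖ _ y' * u - u * toPiCompletion ϖ _ y'),
      Subtype.ext ?_⟩
    have hb : latticeIncl R K _ (toPiCompletion ϖ _ b) = 𝓕.toHat K hϖ (n + 1) b :=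
      (toHat_of_mem hϖ (n + 1) b).symm
    have hd : latticeIncl R K _ (toPiCompletion ϖ _ d) = 𝓕.toHat K hϖ (n + 1) d :=
      (toHat_of_mem hϖ (n + 1) d).symm
    have hy' : latticeIncl R K _ (toPiCompletion ϖ _ y') =
        algebraMap R K ϖ • 𝓕.toHat K hϖ (n + 1) (ϖ ^ n • Y j) := by
      rw [← toHat_of_mem hϖ (n + 1) y', ← toHat_smul, smul_smul, ← pow_succ']
    change 𝓕.toHat K hϖ (n + 1) (ϖ ^ n • Y j) * latticeIncl R K _ _ =
      latticeIncl R K _ _ * 𝓕.toHat K hϖ (n + 1) (ϖ ^ n • Y j) + latticeIncl R K _ _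
    have hd' : (d : A) = (ϖ ^ n • Y j) * b - b * (ϖ ^ n • Y j) := by
      rw [smul_mul_assoc, mul_smul_comm, ← smul_sub]
    rw [pow_one, map_add, map_add, map_sub, map_mul, map_mul, latticeIncl_smul, hb, hd, hy', hd',
      map_sub, map_mul, map_mul]
    simp only [mul_add, add_mul, smul_mul_assoc, mul_smul_comm]
    abel
  · obtain ⟨c₀, c, hc⟩ := hP.comm_gen i j
    have h1 := congrArg (𝓕.deformToHatSub K hϖ n) hc
    simp only [map_add, map_mul, map_sum] at h1
    refine ⟨toPiCompletion ϖ _ (Subalgebra.inclusion (𝓕.zeroPart_le_deform ϖ (n + 1)) c₀),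
      fun k => toPiCompletion ϖ _
        (Subalgebra.inclusion (𝓕.zeroPart_le_deform ϖ (n + 1)) (c k)), h1.trans ?_⟩
    simp only [← hzero]
    rfl
  · have hQ := hP.generates (P.comap (𝓕.deformToHatSub K hϖ n)) (fun c => by
      change 𝓕.deformToHatSub K hϖ n (Subalgebra.inclusion (𝓕.zeroPart_le_deform ϖ n) c) ∈ P
      rw [hzero]
      exact hφ _) hy
    refine eq_top_iff.2 fun x _ => ?_
    obtain ⟨a, u, rfl⟩ := exists_eq_deformToHatSub_add hϖ n x
    exact add_mem (hQ.ge (Subring.mem_top a)) (hφ u)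

theorem isNoetherianRing_hatSub [IsDiscreteValuationRing R] [IsUnitBall R K]
    [Module.Flat R A] (hϖ : Irreducible ϖ) (h : 𝓕.IsAdmissible ϖ) (n : ℕ) :
    IsNoetherianRing (𝓕.hatSub K ϖ n) ∧ IsNoetherianRing (𝓕.hatSub K ϖ n)ᵐᵒᵖ := by
  obtain ⟨r, Y, hY, hgen⟩ := h.exists_generators
  have hP := isAlmostPolynomial_hatSub (K := K) hϖ h.gr_comm hY hgen n
  obtain ⟨h1, h2⟩ := isNoetherianRing_piCompletion hϖ h (n + 1)
  exact ⟨hP.isNoetherianRing, hP.op.isNoetherianRing⟩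

/-- The transition homomorphisms are flat on both sides. -/
theorem eqFlat_hatTransition [IsDiscreteValuationRing R] [IsUnitBall R K]
    [Module.Flat R A] (hϖ : Irreducible ϖ) (h : 𝓕.IsAdmissible ϖ) (n : ℕ) :
    EqFlat (𝓕.hatTransition K ϖ n).toRingHom ∧
      EqFlat (RingHom.op (𝓕.hatTransition K ϖ n).toRingHom) := by
  obtain ⟨h1, h2⟩ := isNoetherianRing_hatSub (K := K) hϖ h n
  have htf := piCompletion_torsionFree (deform_torsionFree (𝓕 := 𝓕) hϖ n)
  have hi := latticeIncl_injective (K := K) hϖ htf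
  -- The transition homomorphism restricted to the preimage of Â_n, with values in Â_n.
  obtain ⟨g, hg⟩ := exists_ringHom_lift
    (f := (𝓕.hatTransition K ϖ n).toRingHom.comp (𝓕.hatSub K ϖ n).subtype) hi fun x => x.2
  let p : 𝓕.hatSub K ϖ n := 𝓕.toHatSub K ϖ n (algebraMap R _ ϖ)
  have hincl : ∀ (B : Type _) [Ring B] [Algebra R B], latticeIncl R K B (algebraMap R B ϖ) =
      algebraMap K _ (algebraMap R K ϖ) := fun B _ _ => by
    rw [Algebra.algebraMap_eq_smul_one, latticeIncl_smul, map_one, ← Algebra.algebraMap_eq_smul_one]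
  have hp : (𝓕.hatSub K ϖ n).subtype p = algebraMap K _ (algebraMap R K ϖ) := hincl _
  have hfp : (𝓕.hatTransition K ϖ n).toRingHom ((𝓕.hatSub K ϖ n).subtype p) =
      algebraMap K _ (algebraMap R K ϖ) := by
    rw [hp]
    exact AlgHom.commutes _ _
  have hgp : g p = algebraMap R _ ϖ := hi (by
    rw [hg, hincl]
    exact hfp)
  refine isFlatHom_of_lattices (j := (𝓕.hatSub K ϖ n).subtype) (g := g) (p := p)
    Subtype.val_injective hi hg ?_ ?_ ?_ ?_ ?_ ?_ ?_
  · rw [hp]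
    exact isUnit_algebraMap_irreducible hϖ _
  · intro x
    rw [hp, Algebra.commutes]
  · intro x
    rw [hfp, Algebra.commutes]
  · rw [hgp]
    exact isCentralComplete_piCompletion (deform_torsionFree hϖ n)
  · exact fun x u hu => ⟨⟨x, u, hu⟩, rfl⟩
  -- Modulo ϖ every element of Â_n comes from A_n, whose image lies in the preimage ring.
  · intro u
    obtain ⟨b, u', hu⟩ := exists_eq_toPiCompletion_add (deform_torsionFree hϖ n) 1 u
    refine ⟨𝓕.deformToHatSub K hϖ n b, u', ?_⟩
    have hb : g (𝓕.deformToHatSub K hϖ n b) = toPiCompletion ϖ _ b := hi (by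
      rw [hg, ← toHat_of_mem (K := K) hϖ n b]
      exact (congrArg (𝓕.hatTransition K ϖ n) (coe_deformToHatSub hϖ n b)).trans
        (hatTransition_toHat (𝓕 := 𝓕) (K := K) hϖ n b))
    rw [hb, hgp, ← Algebra.smul_def, hu, pow_one]
  · intro x
    rw [hfp]
    exact exists_pow_mul_eq_latticeIncl hϖ x

end Hat

end AlgFiltration

/-! ### Completions and dense uniform embeddings -/

section Completion

open UniformSpace

/-- A complete Hausdorff topological ring that contains a dense image of `α` with the induced
uniformity is the completion of `α`. -/
theorem exists_completion_ringEquiv {α β : Type*} [Ring α] [UniformSpace α] [IsTopologicalRing α]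
    [IsUniformAddGroup α] [Ring β] [UniformSpace β] [IsTopologicalRing β] [IsUniformAddGroup β]
    [CompleteSpace β] [T2Space β] (f : α →+* β) (hf : IsUniformInducing f) (hd : DenseRange f) :
    ∃ e : Completion α ≃+* β, Continuous e ∧ Continuous e.symm ∧ ∀ a : α, e a = f a := by
  let pkg : AbstractCompletion α :=
    { space := β
      coe := f
      uniformStruct := inferInstance
      complete := inferInstance
      separation := inferInstance
      isUniformInducing := hf
      dense := hd }
  let e₀ : Completion α ≃ᵤ β := (Completion.cPkg (α := α)).compareEquiv pkg
  have he₀ : ∀ x, e₀ x = Completion.extensionHom f hf.uniformContinuous.continuous x := fun _ => rfl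
  refine ⟨RingEquiv.ofBijective (Completion.extensionHom f hf.uniformContinuous.continuous)
    e₀.bijective, ?_, ?_, fun a => ?_⟩
  · exact e₀.continuous
  · have hsymm : ∀ x, (RingEquiv.ofBijective
        (Completion.extensionHom f hf.uniformContinuous.continuous) e₀.bijective).symm x =
          e₀.symm x := fun x => by
      rw [RingEquiv.symm_apply_eq]
      exact (e₀.apply_symm_apply x).symm
    exact e₀.symm.continuous.congr fun x => (hsymm x).symm
  · exact Completion.extensionHom_coe f hf.uniformContinuous.continuous a

end Completion

/-! ### The topology of the projective limit -/

section Comap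

variable {K V W : Type*} [NormedField K] [Ring V] [Algebra K V] [Ring W] [Algebra K W]

/-- The pullback of a submultiplicative nonarchimedean seminorm. -/
def AlgSeminorm.comap (q : AlgSeminorm K V) (f : W →ₐ[K] V) : AlgSeminorm K W where
  toSeminorm := q.toSeminorm.comp f.toLinearMap
  add_le_max' x y := by
    change q.toSeminorm (f (x + y)) ≤ max (q.toSeminorm (f x)) (q.toSeminorm (f y))
    rw [map_add]
    exact q.add_le_max' _ _
  mul_le' x y := by
    change q.toSeminorm (f (x * y)) ≤ q.toSeminorm (f x) * q.toSeminorm (f y)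
    rw [map_mul]
    exact q.mul_le' _ _

theorem AlgSeminorm.uniformity_comap (q : AlgSeminorm K V) (f : W →ₐ[K] V) :
    seminormUniformity (q.comap f).toSeminorm =
      UniformSpace.comap f (seminormUniformity q.toSeminorm) :=
  seminormUniformity_comap _ _ f.toLinearMap.toAddMonoidHom fun _ => rfl

theorem SeminormedAlg.uniformSpace_singleton (q : AlgSeminorm K V) :
    SeminormedAlg.instUniformSpace ({q} : Set (AlgSeminorm K V)) =
      seminormUniformity q.toSeminorm :=
  iInf_unique (ι := ({q} : Set (AlgSeminorm K V))) (f := fun r => seminormUniformity r.1.toSeminorm)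

theorem SeminormedAlg.uniformSpace_comap (q : AlgSeminorm K V) (f : W →ₐ[K] V) :
    UniformSpace.comap f (seminormUniformity q.toSeminorm) =
      SeminormedAlg.instUniformSpace ({q.comap f} : Set (AlgSeminorm K W)) :=
  (q.uniformity_comap f).symm.trans (SeminormedAlg.uniformSpace_singleton _).symm

end Comap

namespace AlgFiltration

section Limit

variable {R A : Type*} [CommRing R] [Ring A] [Algebra R A] (𝓕 : AlgFiltration R A)
  (K : Type*) [NormedField K] [Algebra R K] (ϖ : R)

/-- The projection from the projective limit to `Â_{n,K}`. -/
def hatProj (n : ℕ) : 𝓕.hatLimit K ϖ →ₐ[K] 𝓕.hatK K ϖ n :=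
  (Pi.evalAlgHom K _ n).comp (𝓕.hatLimit K ϖ).val

theorem hatTransition_hatProj (n : ℕ) (x : 𝓕.hatLimit K ϖ) :
    𝓕.hatTransition K ϖ n (𝓕.hatProj K ϖ (n + 1) x) = 𝓕.hatProj K ϖ n x := x.2 n

theorem hatProj_toHatLimit [IsDomain R] [IsFractionRing R K] {ϖ : R} (hϖ : Irreducible ϖ) (n : ℕ)
    (v : K ⊗[R] A) :
    𝓕.hatProj K ϖ n (𝓕.toHatLimit K hϖ v) = 𝓕.toHatK K hϖ n v := rfl

variable [IsUnitBall R K]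

/-- The seminorm on the projective limit defined by the norm of `Â_{n,K}`. -/
def limitSeminorm (n : ℕ) : AlgSeminorm K (𝓕.hatLimit K ϖ) :=
  (latticeAlgSeminorm R K _).comap (𝓕.hatProj K ϖ n)

theorem limitSeminorm_le_succ (n : ℕ) :
    (𝓕.limitSeminorm K ϖ n).toSeminorm ≤ (𝓕.limitSeminorm K ϖ (n + 1)).toSeminorm := by
  intro x
  change latticeSeminorm R K _ (𝓕.hatProj K ϖ n x) ≤ latticeSeminorm R K _ (𝓕.hatProj K ϖ (n + 1) x)
  rw [← hatTransition_hatProj]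
  exact latticeSeminorm_latticeMap_le _ _

theorem limitSeminorm_mono : Monotone fun n => (𝓕.limitSeminorm K ϖ n).toSeminorm :=
  monotone_nat_of_le_succ (𝓕.limitSeminorm_le_succ K ϖ)

theorem uniformSpace_hatLimit : (instUniformSpaceSubtype : UniformSpace (𝓕.hatLimit K ϖ)) =
    ⨅ n, seminormUniformity (𝓕.limitSeminorm K ϖ n).toSeminorm := by
  change UniformSpace.comap Subtype.val (Pi.uniformSpace _) = _
  rw [Pi.uniformSpace_eq, UniformSpace.comap_iInf]
  refine iInf_congr fun n => ?_
  rw [limitSeminorm, AlgSeminorm.uniformity_comap, ← UniformSpace.comap_comap]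
  rfl

instance : IsUniformAddGroup (𝓕.hatLimit K ϖ) :=
  (𝓕.hatLimit K ϖ).toSubmodule.toAddSubgroup.isUniformAddGroup

instance : IsTopologicalRing (𝓕.hatLimit K ϖ) :=
  (𝓕.hatLimit K ϖ).toSubring.instIsTopologicalRing

theorem topology_hatLimit :
    (instUniformSpaceSubtype : UniformSpace (𝓕.hatLimit K ϖ)).toTopologicalSpace =
      ⨅ n, (seminormUniformity (𝓕.limitSeminorm K ϖ n).toSeminorm).toTopologicalSpace :=
  (congrArg (@UniformSpace.toTopologicalSpace _) (𝓕.uniformSpace_hatLimit K ϖ)).trans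
    UniformSpace.toTopologicalSpace_iInf

theorem hasBasis_nhds_hatLimit (x : 𝓕.hatLimit K ϖ) :
    (𝓝 x).HasBasis (fun i : ℕ × ℝ => 0 < i.2)
      fun i => {y | (𝓕.limitSeminorm K ϖ i.1).toSeminorm (y - x) < i.2} := by
  have hx : 𝓝 x = ⨅ n, @nhds _
      (seminormUniformity (𝓕.limitSeminorm K ϖ n).toSeminorm).toTopologicalSpace x :=
    (congrArg (fun t => @nhds _ t x) (𝓕.topology_hatLimit K ϖ)).trans nhds_iInf
  rw [hx]
  -- The seminorms increase with n, so a neighbourhood is already controlled by a single one; this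
  -- is what reduces density in the limit to density at each level.
  refine Filter.hasBasis_iInf_of_directed _ _ (fun n => hasBasis_nhds_seminorm _ x)
    (directed_of_isDirected_le fun m n hmn => ?_)
  refine nhds_mono (UniformSpace.toTopologicalSpace_mono (seminormUniformity_le one_pos ?_))
  intro y
  rw [one_mul]
  exact 𝓕.limitSeminorm_mono K ϖ hmn y

variable [IsDomain R] [IsFractionRing R K] [Module.Flat R A] {ϖ}

theorem denseRange_toHatK (hϖ : Irreducible ϖ) (n : ℕ) : DenseRange (𝓕.toHatK K hϖ n) := by
  intro x
  refine (mem_closure_iff_nhds_basis (hasBasis_nhds_seminorm _ x)).2 fun ε hε => ?_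
  obtain ⟨k, hk⟩ := exists_pow_lt_of_lt_one hε (norm_irreducible_lt_one (K := K) hϖ)
  obtain ⟨v, u, rfl⟩ := exists_eq_toHatK_add hϖ n k x
  refine ⟨_, ⟨v, rfl⟩, ?_⟩
  rw [Set.mem_ofPred_eq, sub_add_cancel_left, map_neg_eq_map]
  refine (latticeSeminorm_smul_le _ _).trans_lt ?_
  rwa [norm_pow]

theorem denseRange_toHatLimit (hϖ : Irreducible ϖ) : DenseRange (𝓕.toHatLimit K hϖ) := by
  intro x
  refine (mem_closure_iff_nhds_basis (𝓕.hasBasis_nhds_hatLimit K ϖ x)).2 fun ⟨n, ε⟩ hε => ?_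
  obtain ⟨_, ⟨v, rfl⟩, hv⟩ := (mem_closure_iff_nhds_basis (hasBasis_nhds_seminorm _ _)).1
    (𝓕.denseRange_toHatK K hϖ n (𝓕.hatProj K ϖ n x)) ε hε
  refine ⟨_, ⟨v, rfl⟩, ?_⟩
  change latticeSeminorm R K _ (𝓕.hatProj K ϖ n (𝓕.toHatLimit K hϖ v - x)) < ε
  rw [map_sub, hatProj_toHatLimit]
  exact hv

theorem denseRange_hatProj (hϖ : Irreducible ϖ) (n : ℕ) : DenseRange (𝓕.hatProj K ϖ n) :=
  (𝓕.denseRange_toHatK K hϖ n).mono (by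
    rintro _ ⟨v, rfl⟩
    exact ⟨𝓕.toHatLimit K hϖ v, rfl⟩)

theorem completeSpace_hatK (hϖ : Irreducible ϖ) (n : ℕ) : CompleteSpace (𝓕.hatK K ϖ n) :=
  completeSpace_latticeAlg hϖ (isCentralComplete_piCompletion (deform_torsionFree hϖ n))

variable [IsDiscreteValuationRing R]

theorem t2Space_hatK (hϖ : Irreducible ϖ) (n : ℕ) : T2Space (𝓕.hatK K ϖ n) :=
  t2Space_latticeAlg hϖ (isCentralComplete_piCompletion (deform_torsionFree hϖ n))
    (piCompletion_torsionFree (deform_torsionFree hϖ n))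

theorem t2Space_hatLimit (hϖ : Irreducible ϖ) : T2Space (𝓕.hatLimit K ϖ) := by
  have := 𝓕.t2Space_hatK K hϖ
  infer_instance

/-- The compatibility conditions are closed, so the limit is a closed subspace of a product of
complete spaces. -/
theorem completeSpace_hatLimit (hϖ : Irreducible ϖ) : CompleteSpace (𝓕.hatLimit K ϖ) := by
  have := 𝓕.t2Space_hatK K hϖ
  have := 𝓕.completeSpace_hatK K hϖ
  have hset : (𝓕.hatLimit K ϖ : Set (∀ n, 𝓕.hatK K ϖ n)) =
      ⋂ n, {x | 𝓕.hatTransition K ϖ n (x (n + 1)) = x n} := by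
    ext x
    rw [Set.mem_iInter]
    rfl
  have hcl : IsClosed (𝓕.hatLimit K ϖ : Set (∀ n, 𝓕.hatK K ϖ n)) := by
    rw [hset]
    exact isClosed_iInter fun n => isClosed_eq
      ((continuous_latticeMap _).comp (continuous_apply (n + 1))) (continuous_apply n)
  exact hcl.isComplete.completeSpace_coe

/-- The n-th seminorm is pulled back from Â_{n,K} along a projection with dense image, and Â_{n,K}
is complete and Hausdorff. -/
theorem exists_seminormCompletion_equiv (hϖ : Irreducible ϖ) (n : ℕ) :
    ∃ e : SeminormCompletion (𝓕.limitSeminorm K ϖ n) ≃+* 𝓕.hatK K ϖ n,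
      Continuous e ∧ ∀ x : 𝓕.hatLimit K ϖ,
        e (UniformSpace.Completion.coeRingHom
          (show SeminormedAlg {𝓕.limitSeminorm K ϖ n} from x)) = 𝓕.hatProj K ϖ n x := by
  have := 𝓕.t2Space_hatK K hϖ n
  have := 𝓕.completeSpace_hatK K hϖ n
  let f : SeminormedAlg {𝓕.limitSeminorm K ϖ n} →+* 𝓕.hatK K ϖ n := (𝓕.hatProj K ϖ n).toRingHom
  have hf : IsUniformInducing f := isUniformInducing_iff_uniformSpace.2
    (SeminormedAlg.uniformSpace_comap (latticeAlgSeminorm R K _) (𝓕.hatProj K ϖ n))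
  obtain ⟨e, he, -, hef⟩ := exists_completion_ringEquiv f hf (𝓕.denseRange_hatProj K hϖ n)
  exact ⟨e, he, hef⟩

variable {𝓕}

theorem isFrechetStein_hatLimit (hϖ : Irreducible ϖ) (h : 𝓕.IsAdmissible ϖ) :
    IsFrechetStein K (𝓕.hatLimit K ϖ) where
  isUniformAddGroup := inferInstance
  completeSpace := 𝓕.completeSpace_hatLimit K hϖ
  t2Space := 𝓕.t2Space_hatLimit K hϖ
  exists_seminorms := by
    refine ⟨𝓕.limitSeminorm K ϖ, 𝓕.limitSeminorm_le_succ K ϖ, 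
      𝓕.topology_hatLimit K ϖ, fun n => ?_, fun n => ?_⟩
    · obtain ⟨e, -, -⟩ := 𝓕.exists_seminormCompletion_equiv K hϖ n
      obtain ⟨h1, h2⟩ := isNoetherianRing_hatK (K := K) hϖ h n
      exact ⟨isNoetherianRing_of_ringEquiv _ e.symm,
        isNoetherianRing_of_ringEquiv _ (RingEquiv.op e.symm)⟩
    · obtain ⟨e, hec, he⟩ := 𝓕.exists_seminormCompletion_equiv K hϖ n
      obtain ⟨e', hec', he'⟩ := 𝓕.exists_seminormCompletion_equiv K hϖ (n + 1)
      have := 𝓕.t2Space_hatK K hϖ n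
      -- Two continuous maps to a Hausdorff space that agree on the dense image of the limit.
      have hcomm : ∀ x, e (completionTransition (𝓕.limitSeminorm_le_succ K ϖ n) x) =
          𝓕.hatTransition K ϖ n (e' x) := by
        intro x
        induction x using UniformSpace.Completion.induction_on with
        | hp =>
          exact isClosed_eq (hec.comp UniformSpace.Completion.continuous_map)
            ((continuous_latticeMap _).comp hec')
        | ih a =>
          refine Eq.trans ?_ ((hatTransition_hatProj 𝓕 K ϖ n a).symm.trans
            (congrArg (𝓕.hatTransition K ϖ n) (he' a).symm))
          exact (congrArg e (UniformSpace.Completion.mapRingHom_coe _ a)).trans (he a)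
      obtain ⟨h1, h2⟩ := eqFlat_hatTransition (K := K) hϖ h n
      have hsymm : ∀ x, e.symm ((𝓕.hatTransition K ϖ n).toRingHom x) =
          completionTransition (𝓕.limitSeminorm_le_succ K ϖ n) (e'.symm x) := fun x => by
        rw [RingEquiv.symm_apply_eq, hcomm, RingEquiv.apply_symm_apply]
        rfl
      exact ⟨(h1.of_ringEquiv e'.symm e.symm hsymm).rightFlat,
        (h2.of_ringEquiv (RingEquiv.op e'.symm) (RingEquiv.op e.symm) fun x =>
          congrArg MulOpposite.op (hsymm x.unop)).rightFlat⟩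

end Limit

end AlgFiltration

/-! ### The continuous seminorms on `A_K` -/

section Ball

variable {K V : Type*} [NormedField K] [Ring V] [Algebra K V]

/-- The closed balls of a nonarchimedean seminorm are additive subgroups. -/
def AlgSeminorm.ball (q : AlgSeminorm K V) {C : ℝ} (hC : 0 ≤ C) : AddSubgroup V where
  carrier := {x | q.toSeminorm x ≤ C}
  zero_mem' := (map_zero q.toSeminorm).trans_le hC
  add_mem' {x y} hx hy := (q.add_le_max' x y).trans (max_le hx hy)
  neg_mem' {x} hx := (map_neg_eq_map q.toSeminorm x).trans_le hx

theorem AlgSeminorm.mul_list_prod_le (q : AlgSeminorm K V) {r : ℕ} {Z : Fin r → V} {M : ℝ}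
    (hM : 0 ≤ M) (hZ : ∀ j, q.toSeminorm (Z j) ≤ M) (l : List (Fin r)) (x : V) :
    q.toSeminorm (x * (l.map Z).prod) ≤ q.toSeminorm x * M ^ l.length := by
  induction l generalizing x with
  | nil => simp
  | cons j l ih =>
    rw [List.map_cons, List.prod_cons, ← mul_assoc, List.length_cons, pow_succ', ← mul_assoc]
    refine (ih _).trans (mul_le_mul_of_nonneg_right ?_ (pow_nonneg hM _))
    exact (q.mul_le' _ _).trans (mul_le_mul_of_nonneg_left (hZ j) (apply_nonneg q.toSeminorm x))

end Ball

namespace AlgFiltration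

/-! ### Comparison of the continuous seminorms on A_K with the gauges of the A_n. -/

section Gauge

variable {R A : Type*} [CommRing R] [Ring A] [Algebra R A] (𝓕 : AlgFiltration R A)
  (K : Type*) [NormedField K] [Algebra R K]

theorem continuous_zeroPartToAK [IsUnitBall R K] :
    Continuous[inferInstance, 𝓕.topologyAK K] (𝓕.zeroPartToAK K) :=
  continuous_sInf_rng.2 fun _ h => h.2

variable [IsDomain R] [IsFractionRing R K] {ϖ : R}

theorem toHatK_zeroPartToAK (hϖ : Irreducible ϖ) (n : ℕ) (z : LatticeAlg R K 𝓕.zeroPart) :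
    𝓕.toHatK K hϖ n (𝓕.zeroPartToAK K z) = latticeMap R K
      ((toPiCompletion ϖ (𝓕.deform ϖ n)).comp
        (Subalgebra.inclusion (zeroPart_le_deform 𝓕 ϖ n))) z :=
  latticeAlg_hom_ext (φ := (𝓕.toHatK K hϖ n).comp (𝓕.zeroPartToAK K))
    (ψ := latticeMap R K ((toPiCompletion ϖ (𝓕.deform ϖ n)).comp
      (Subalgebra.inclusion (zeroPart_le_deform 𝓕 ϖ n))))
    (fun b => toHat_of_mem hϖ n (Subalgebra.inclusion (zeroPart_le_deform 𝓕 ϖ n) b)) z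

variable [IsUnitBall R K]

/-- The seminorm on `A_K` with unit ball `A_n`. -/
def gauge (hϖ : Irreducible ϖ) (n : ℕ) : AlgSeminorm K (K ⊗[R] A) :=
  (latticeAlgSeminorm R K _).comap (𝓕.toHatK K hϖ n)

theorem uniformity_gauge (hϖ : Irreducible ϖ) (n : ℕ) :
    seminormUniformity (𝓕.gauge K hϖ n).toSeminorm =
      UniformSpace.comap (𝓕.toHatK K hϖ n) inferInstance :=
  (latticeAlgSeminorm R K _).uniformity_comap (𝓕.toHatK K hϖ n)

/-- The topology of this one seminorm is locally convex and makes (F_0)_K → A_K continuous, because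
F_0 ⊆ A_n; the finest such topology is therefore finer. -/
theorem gauge_mem_contSeminorms (hϖ : Irreducible ϖ) (n : ℕ) :
    𝓕.gauge K hϖ n ∈ 𝓕.contSeminorms K := by
  refine continuous_le_dom (sInf_le ?_) (continuous_seminormUniformity (𝓕.gauge K hϖ n).toSeminorm)
  refine ⟨⟨{(𝓕.gauge K hϖ n).toSeminorm}, ?_, ?_⟩, ?_⟩
  · rintro _ rfl
    exact (𝓕.gauge K hϖ n).add_le_max'
  · exact (iInf_singleton (f := fun q : Seminorm K (K ⊗[R] A) =>
      (seminormUniformity q).toTopologicalSpace)).symm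
  · rw [uniformity_gauge]
    refine continuous_induced_rng.2 ?_
    exact (continuous_latticeMap _).congr fun z => (𝓕.toHatK_zeroPartToAK K hϖ n z).symm

variable {𝓕 K}

/-- By continuity q is less than 1 on ϖ^k F_0 for some k; rescaling gives the constant. -/
theorem exists_bound_zeroPart (hϖ : Irreducible ϖ) {q : AlgSeminorm K (K ⊗[R] A)}
    (hq : q ∈ 𝓕.contSeminorms K) :
    ∃ C : ℝ, 0 < C ∧ ∀ c : 𝓕.zeroPart, q.toSeminorm ((1 : K) ⊗ₜ[R] (c : A)) ≤ C := by
  have hcont : Continuous fun z => q.toSeminorm (𝓕.zeroPartToAK K z) :=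
    @Continuous.comp _ _ _ _ (𝓕.topologyAK K) _ _ _ hq (𝓕.continuous_zeroPartToAK K)
  have hnhds : ∀ᶠ z in 𝓝 (0 : LatticeAlg R K 𝓕.zeroPart),
      q.toSeminorm (𝓕.zeroPartToAK K z) < 1 := by
    refine hcont.continuousAt.eventually_lt continuousAt_const ?_
    rw [map_zero, map_zero]
    exact one_pos
  obtain ⟨ε, hε, hball⟩ := (hasBasis_nhds_seminorm _ _).eventually_iff.1 hnhds
  obtain ⟨k, hk⟩ := exists_pow_lt_of_lt_one hε (norm_irreducible_lt_one (K := K) hϖ)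
  have h0 : 0 < ‖algebraMap R K ϖ‖ ^ k :=
    pow_pos (norm_pos_iff.2 (algebraMap_irreducible_ne_zero hϖ)) k
  refine ⟨(‖algebraMap R K ϖ‖ ^ k)⁻¹, inv_pos.2 h0, fun c => ?_⟩
  have h1 := hball (x := (algebraMap R K ϖ) ^ k • latticeIncl R K _ c) (by
    rw [Set.mem_ofPred_eq, sub_zero]
    refine (latticeSeminorm_smul_le _ _).trans_lt ?_
    rwa [norm_pow])
  rw [map_smul, map_smul_eq_mul, norm_pow] at h1
  exact (lt_inv_mul_iff₀ h0).2 h1 |>.le.trans_eq (mul_one _)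

/-- With `C` a bound on F_0 and `M` one on the generators, `q` is at most C (|ϖ|^n M)^i on ϖ^(ni)
times a word of length at most i. A large n makes this at most `C` for all i at once. Taking M ≥ 1
lets shorter words be bounded by M^i. -/
theorem exists_bound_deform (hϖ : Irreducible ϖ) (h : 𝓕.IsAdmissible ϖ)
    {q : AlgSeminorm K (K ⊗[R] A)} (hq : q ∈ 𝓕.contSeminorms K) :
    ∃ (n : ℕ) (C : ℝ), 0 < C ∧
      ∀ a ∈ 𝓕.deform ϖ n, q.toSeminorm ((1 : K) ⊗ₜ[R] a) ≤ C := by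
  obtain ⟨C, hC, hbound⟩ := exists_bound_zeroPart hϖ hq
  obtain ⟨r, Y, -, hgen⟩ := h.exists_generators
  let ι : A →ₐ[R] K ⊗[R] A := Algebra.TensorProduct.includeRight
  obtain ⟨M, hM1, hM⟩ : ∃ M : ℝ, 1 ≤ M ∧ ∀ j, q.toSeminorm (ι (Y j)) ≤ M := by
    obtain ⟨M, hM⟩ := (Set.finite_range fun j => q.toSeminorm (ι (Y j))).bddAbove
    exact ⟨max 1 M, le_max_left _ _, fun j => (hM ⟨j, rfl⟩).trans (le_max_right _ _)⟩
  have hM0 : 0 < M := one_pos.trans_le hM1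
  obtain ⟨n, hn⟩ := exists_pow_lt_of_lt_one (inv_pos.2 hM0) (norm_irreducible_lt_one (K := K) hϖ)
  have hnM : ‖algebraMap R K ϖ‖ ^ n * M ≤ 1 := by
    rw [← inv_mul_cancel₀ hM0.ne']
    exact mul_le_mul_of_nonneg_right hn.le hM0.le
  refine ⟨n, C, hC, fun a ha => ?_⟩
  refine deform_le ((q.ball hC.le).comap (ι : A →+ K ⊗[R] A)) (fun i b hb => ?_) ha
  have hword : wordSpan (𝓕.zeroPart.val : 𝓕.zeroPart →+* A) Y i ≤
      ((q.ball hC.le).comap (ι : A →+ K ⊗[R] A)).comap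
        (DistribSMul.toAddMonoidHom A (ϖ ^ (n * i))) := by
    refine (AddSubgroup.closure_le _).2 ?_
    rintro _ ⟨c, l, hl, rfl⟩
    change q.toSeminorm (ι (ϖ ^ (n * i) • ((c : A) * (l.map Y).prod))) ≤ C
    have h1 : ι (ϖ ^ (n * i) • ((c : A) * (l.map Y).prod)) =
        algebraMap R K (ϖ ^ (n * i)) • (ι c * (l.map fun j => ι (Y j)).prod) := by
      refine (latticeIncl_smul R K (ϖ ^ (n * i)) _).trans (congrArg _ ?_)
      refine (map_mul ι _ _).trans (congrArg _ ?_)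
      rw [map_list_prod, List.map_map]
      rfl
    rw [h1, map_smul_eq_mul, map_pow, norm_pow, pow_mul]
    calc (‖algebraMap R K ϖ‖ ^ n) ^ i * q.toSeminorm (ι c * (l.map fun j => ι (Y j)).prod)
        ≤ (‖algebraMap R K ϖ‖ ^ n) ^ i * (C * M ^ i) := by
          refine mul_le_mul_of_nonneg_left ?_ (by positivity)
          exact (q.mul_list_prod_le hM0.le hM l _).trans (mul_le_mul (hbound c)
            (pow_le_pow_right₀ hM1 hl) (by positivity) hC.le)
      _ = C * (‖algebraMap R K ϖ‖ ^ n * M) ^ i := by rw [mul_pow]; ring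
      _ ≤ C := mul_le_of_le_one_right hC.le (pow_le_one₀ (by positivity) hnM)
  exact hword (hgen i b hb)

theorem comap_toHatLimit (hϖ : Irreducible ϖ) :
    UniformSpace.comap (𝓕.toHatLimit K hϖ) instUniformSpaceSubtype =
      ⨅ n, seminormUniformity (𝓕.gauge K hϖ n).toSeminorm := by
  rw [uniformSpace_hatLimit, UniformSpace.comap_iInf]
  refine iInf_congr fun n => ?_
  exact (AlgSeminorm.uniformity_comap (𝓕.limitSeminorm K ϖ n) (𝓕.toHatLimit K hϖ)).symm

variable [IsDiscreteValuationRing R] [Module.Flat R A]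

/-- Boundedness on the lattice A_n becomes domination by its gauge through scaling. -/
theorem exists_le_gauge (hϖ : Irreducible ϖ) (h : 𝓕.IsAdmissible ϖ)
    {q : AlgSeminorm K (K ⊗[R] A)} (hq : q ∈ 𝓕.contSeminorms K) :
    ∃ (n : ℕ) (C : ℝ), 0 < C ∧
      ∀ v, q.toSeminorm v ≤ C * (𝓕.gauge K hϖ n).toSeminorm v := by
  obtain ⟨n, C, hC, hbound⟩ := exists_bound_deform hϖ h hq
  refine ⟨n, C, hC, fun v => ?_⟩
  rw [← div_le_iff₀' hC]
  refine le_of_forall_gt_imp_ge_of_dense fun s hs => ?_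
  obtain ⟨d, u, hd0, hd, hds⟩ : ∃ (d : K) (u : PiCompletion ϖ (𝓕.deform ϖ n)), d ≠ 0 ∧
      𝓕.toHatK K hϖ n v = d • latticeIncl R K _ u ∧ ‖d‖ < s := by
    obtain ⟨d, u, hd, hds⟩ := exists_of_latticeSeminorm_lt (v := 𝓕.toHatK K hϖ n v) hs
    -- The scalar must be inverted below; a zero scalar is replaced by a small power of ϖ.
    by_cases hd0 : d = 0
    · obtain ⟨k, hk⟩ := exists_pow_lt_of_lt_one ((norm_nonneg d).trans_lt hds)
        (norm_irreducible_lt_one (K := K) hϖ)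
      refine ⟨algebraMap R K ϖ ^ k, 0, pow_ne_zero k (algebraMap_irreducible_ne_zero hϖ), ?_, ?_⟩
      · rw [hd, hd0, zero_smul, map_zero, smul_zero]
      · rwa [norm_pow]
    · exact ⟨d, u, hd0, hd, hds⟩
  obtain ⟨a, ha⟩ := exists_of_toHatK_eq (v := d⁻¹ • v) hϖ (u := u) (by
    rw [map_smul, hd, smul_smul, inv_mul_cancel₀ hd0, one_smul])
  have hv : v = d • ((1 : K) ⊗ₜ[R] (a : A)) := by
    rw [← ha, smul_smul, mul_inv_cancel₀ hd0, one_smul]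
  rw [div_le_iff₀ hC, hv, map_smul_eq_mul]
  exact mul_le_mul hds.le (hbound a a.2) (apply_nonneg _ _) ((norm_nonneg d).trans hds.le)

/-- The gauges are continuous and, up to constants, cofinal among the continuous submultiplicative
seminorms. -/
theorem uniformSpace_contSeminorms (hϖ : Irreducible ϖ) (h : 𝓕.IsAdmissible ϖ) :
    SeminormedAlg.instUniformSpace (𝓕.contSeminorms K) =
      ⨅ n, seminormUniformity (𝓕.gauge K hϖ n).toSeminorm := by
  refine le_antisymm (le_iInf fun n => ?_) (le_iInf fun q => ?_)
  · exact iInf_le (fun q : 𝓕.contSeminorms K => seminormUniformity q.1.toSeminorm)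
      ⟨_, 𝓕.gauge_mem_contSeminorms K hϖ n⟩
  · obtain ⟨n, C, hC, hle⟩ := exists_le_gauge hϖ h q.2
    exact (iInf_le _ n).trans (seminormUniformity_le hC hle)

/-- The limit is complete and Hausdorff, contains a dense image of A_K and induces on it the
Arens–Michael uniformity, so uniqueness of completions applies. -/
theorem exists_hatLimit_algEquiv (hϖ : Irreducible ϖ) (h : 𝓕.IsAdmissible ϖ) :
    ∃ e : 𝓕.hatLimit K ϖ ≃ₐ[K] 𝓕.ArensMichael K, Continuous e ∧ Continuous e.symm ∧
      ∀ a : K ⊗[R] A, e (𝓕.toHatLimit K hϖ a) = 𝓕.toArensMichael K a := by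
  have := 𝓕.t2Space_hatLimit K hϖ
  have := 𝓕.completeSpace_hatLimit K hϖ
  let f : SeminormedAlg (𝓕.contSeminorms K) →+* 𝓕.hatLimit K ϖ := (𝓕.toHatLimit K hϖ).toRingHom
  have hf : IsUniformInducing f := isUniformInducing_iff_uniformSpace.2
    ((comap_toHatLimit hϖ).trans (uniformSpace_contSeminorms hϖ h).symm)
  obtain ⟨e, he, he', hef⟩ := exists_completion_ringEquiv f hf (𝓕.denseRange_toHatLimit K hϖ)
  have hcoe : ∀ a : K ⊗[R] A, e.symm (𝓕.toHatLimit K hϖ a) = 𝓕.toArensMichael K a := fun a =>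
    (RingEquiv.symm_apply_eq e).2 (hef a).symm
  refine ⟨AlgEquiv.ofRingEquiv (f := e.symm) fun c => ?_, he', he, hcoe⟩
  refine Eq.trans ?_ ((hcoe (algebraMap K (K ⊗[R] A) c)).trans ?_)
  · rw [AlgHom.commutes]
  · exact (UniformSpace.Completion.algebraMap_def
      (SeminormedAlg (𝓕.contSeminorms K)) K c).symm

end Gauge

end AlgFiltration

end

end AMEnvelope

theorem mainTheorem8 {R K A : Type*} [CommRing R] [IsDomain R] [IsDiscreteValuationRing R]
    [IsAdicComplete (IsLocalRing.maximalIdeal R) R]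
    [NormedField K] [Algebra R K] [IsFractionRing R K] [IsUnitBall R K]
    [Ring A] [Algebra R A] [Module.Flat R A]
    (ϖ : R) (hϖ : Irreducible ϖ) (𝓕 : AlgFiltration R A) (h𝓕 : 𝓕.IsAdmissible ϖ) :
    (∀ n : ℕ, IsFlatHom (𝓕.hatTransition K ϖ n).toRingHom) ∧
    IsFrechetStein K (𝓕.hatLimit K ϖ) ∧
    ∃ e : 𝓕.hatLimit K ϖ ≃ₐ[K] 𝓕.ArensMichael K,
      Continuous e ∧ Continuous e.symm ∧
      ∀ a : TensorProduct R K A, e (𝓕.toHatLimit K hϖ a) = 𝓕.toArensMichael K a :=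
  ⟨fun n => ⟨(AlgFiltration.eqFlat_hatTransition hϖ h𝓕 n).1.rightFlat,
    (AlgFiltration.eqFlat_hatTransition hϖ h𝓕 n).2.rightFlat⟩,
    AlgFiltration.isFrechetStein_hatLimit K hϖ h𝓕,
    AlgFiltration.exists_hatLimit_algEquiv hϖ h𝓕⟩
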